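/- Let $c\in\{-1,0,1\}$, $n\ge 1$, and let $\mathbb Q=\mathbb Q^{n+1}_c$ be the space form of curvature $c$: $\mathbb R^{n+1}$ if $c=0$, the unit sphere of $\mathbb R^{n+2}$ if $c=1$, the hyperboloid $\{\langle x,x\rangle=-1,\ x_{n+2}>0\}$ of Minkowski space $\mathbb R^{n+2}_1$ if $c=-1$. Put $(\mathrm{co},\mathrm{si})(s)=(\cos s,\sin s)$, $(1,s)$, $(\cosh s,\sinh s)$ for $c=1,0,-1$ respectively, and $\mathrm{ct}=\mathrm{co}/\mathrm{si}$. Let $I$ be an open interval, $w>0$ a smooth function on $I$, and equip $\mathbb Q\times I$ with the metric $\langle\cdot,\cdot\rangle_w=w(t)^2\langle\cdot,\cdot\rangle-dt^2$. For $t_0\in I$ put $\theta(t)=\int_{t_0}^t ds/w(s)$. A spacelike immersion $f$ of an $n$-dimensional manifold $\mathcal M$ into $\mathbb Q\times_w I$, with mean curvature vector $\vec H$ ($1/n$ times the trace of the second fundamental form), is marginally trapped if $\langle\vec H,\vec H\rangle_w=0$ everywhere; it is marginally trapped along $N$ if $N$ is a continuous, nowhere vanishing, null normal field along $f$ and $\vec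 H$ is everywhere collinear to $N$ (so that $f$ is marginally trapped). (1) Let $t_0\in I$, let $\varphi:\mathcal M\to\mathbb Q$ be an immersed hypersurface of class $C^4$ with Gauss map (continuous unit normal field) $\nu$ and shape operator $A$, $d\nu=-d\varphi\circ A$, and let $\tau\in C^2(\mathcal M)$ have values in $I$. Denote by $\kappa_1,\dots,\kappa_p$ the distinct principal curvatures of $\varphi$ at a point and by $m_1,\dots,m_p$ their multiplicities ($p$ and the $m_i$ may depend on the point). Put $$\bar\varphi=(\mathrm{co}(\theta\circ\tau)\varphi+\mathrm{si}(\theta\circ\tau)\nu,\ \tau),\qquad \bar\nu=(-c\,\mathrm{si}(\theta\circ\tau)\varphi+\mathrm{co}(\theta\circ\tau)\nu,\ w\circ\tau).$$ Then $\bar\varphi$ is a spacelike immersion (of class $C^2$, into $\mathbb Q\times_w I$) that is marginally trapped along $\bar\nu$ if and only if at every point $\mathrm{ct}(\theta\circ\tau)\ne\kappa_i$ for all $i$ and $$n\,w'(\tau)-\sum_{i=1}^p m_i\,\frac{\kappa_i\,\mathrm{ct}(\theta\circ\tau)+c}{\mathrm{ct}(\theta\circ\tau)-\kappa_i}=0,$$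 where, at points with $\mathrm{si}(\theta\circ\tau)=0$ (so that $\mathrm{ct}(\theta\circ\tau)=\infty$), the condition $\mathrm{ct}(\theta\circ\tau)\neq\kappa_i$ holds and the fraction means its limit $\kappa_i$. In this case $\bar\varphi$ is marginally trapped. (2) Conversely, let $f:\mathcal M\to\mathbb Q\times_w I$ be a spacelike immersion of class $C^5$ of an $n$-dimensional manifold. Say that $f$ is locally represented at $x$ if for every $t_1\in I$ and $\varepsilon>0$ there are $t_0\in I$ with $|t_0-t_1|<\varepsilon$, an open neighbourhood $U$ of $x$, a $C^4$ immersed hypersurface $\varphi:U\to\mathbb Q$ with Gauss map $\nu$, and $\tau\in C^2(U)$, such that $f=\bar\varphi$ on $U$ and the conditions of (1) (non-equality and equation) hold on $U$. If $f$ is marginally trapped along some null normal field $N$ on a neighbourhood of $x$, then $f$ is locally represented at $x$. If $f$ is marginally trapped, then the points at which it is locally represented form a dense subset of $\mathcal M$. -/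

import Mathlib

open scoped Manifold ContDiff
open Set

namespace RobertsonWalker

noncomputable section

/-! ### Space forms -/

/-- Dimension of the linear space in which the space form of dimension `n + 1` and curvature `c`
lives: `n + 1` if `c = 0` and `n + 2` if `c = 1` or `c = -1`. -/
def ambDim : SignType → ℕ → ℕ
  | .zero, n => n + 1
  | .pos, n => n + 2
  | .neg, n => n + 2

/-- The linear space in which the space form lives. -/
abbrev Amb (c : SignType) (n : ℕ) : Type := EuclideanSpace ℝ (Fin (ambDim c n))

/-- The flat scalar product of `Amb c n`: the Euclidean one if `c = 0` or `c = 1`, and the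
Lorentzian one, with a minus sign at the last coordinate (the one of index `n + 1`),
if `c = -1`. -/
def form (c : SignType) (n : ℕ) (x y : Amb c n) : ℝ :=
  ∑ i : Fin (ambDim c n), (if c = -1 ∧ (i : ℕ) = n + 1 then -1 else 1) * (x i * y i)

/-- The space form of dimension `n + 1`: Euclidean space, the unit sphere, or the upper sheet of
the hyperboloid. -/
def spaceForm : (c : SignType) → (n : ℕ) → Set (Amb c n)
  | .zero, _ => univ
  | .pos, n => {x | form .pos n x x = 1}
  | .neg, n => {x | form .neg n x x = -1 ∧ 0 < x (Fin.last (n + 1))}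

/-- The function `co`: `cos`, `1` or `cosh`. -/
def co : SignType → ℝ → ℝ
  | .zero, _ => 1
  | .pos, t => Real.cos t
  | .neg, t => Real.cosh t

/-- The function `si`: `sin`, `t` or `sinh`. -/
def si : SignType → ℝ → ℝ
  | .zero, t => t
  | .pos, t => Real.sin t
  | .neg, t => Real.sinh t

/-- The function `ct = co / si`. -/
def ct (c : SignType) (t : ℝ) : ℝ := co c t / si c t

/-! ### Hypersurfaces of a space form -/

section Manifold

variable {n : ℕ} {M : Type*} [TopologicalSpace M] [ChartedSpace (EuclideanSpace ℝ (Fin n)) M]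

/-- The differential at `x` of a map from an `n`-dimensional manifold to a vector space. -/
def dmap {E : Type*} [NormedAddCommGroup E] [NormedSpace ℝ E] (f : M → E) (x : M) :
    EuclideanSpace ℝ (Fin n) →L[ℝ] E :=
  mfderiv (𝓡 n) 𝓘(ℝ, E) f x

/-- The second derivative at `x` of a map from an `n`-dimensional manifold to a vector space, in
the preferred chart at `x`. -/
def ddmap {E : Type*} [NormedAddCommGroup E] [NormedSpace ℝ E] (f : M → E) (x : M)
    (u v : EuclideanSpace ℝ (Fin n)) : E :=
  fderiv ℝ (fderiv ℝ (f ∘ (extChartAt (𝓡 n) x).symm)) (extChartAt (𝓡 n) x x) u v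

/-- On the open set `U`, `φ` is an immersion of class `C^4` into the space form of dimension
`n + 1` and curvature `c`, and `ν` is a Gauss map of `φ`, i.e. a continuous field of unit vectors
tangent to the space form and normal to `φ`. -/
structure IsHypersurface (c : SignType) (U : Set M) (φ ν : M → Amb c n) : Prop where
  mem : ∀ x ∈ U, φ x ∈ spaceForm c n
  contMDiffOn : ContMDiffOn (𝓡 n) 𝓘(ℝ, Amb c n) 4 φ U
  immersion : ∀ x ∈ U, Function.Injective (dmap (n := n) φ x)
  continuousOn : ContinuousOn ν U
  tangent : ∀ x ∈ U, (c : ℝ) * form c n (φ x) (ν x) = 0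
  normal : ∀ x ∈ U, ∀ v : EuclideanSpace ℝ (Fin n), form c n (dmap φ x v) (ν x) = 0
  unit : ∀ x ∈ U, form c n (ν x) (ν x) = 1

/-- The shape operator `A` of `φ` with respect to `ν` at `x`, characterized by
`dν = - dφ ∘ A`. -/
def shapeOperator {c : SignType} (φ ν : M → Amb c n) (x : M) :
    Module.End ℝ (EuclideanSpace ℝ (Fin n)) :=
  Classical.epsilon fun A => ∀ v, dmap ν x v = - dmap φ x (A v)

/-- The multiplicity of the principal curvature `κ` at `x`. -/
def principalMultiplicity {c : SignType} (φ ν : M → Amb c n) (x : M) (κ : ℝ) : ℕ :=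
  Module.finrank ℝ (Module.End.eigenspace (shapeOperator φ ν x) κ)

/-- The quotient `(κ ct(s) + c) / (ct(s) - κ)`. Where `si(s) = 0`, so that `ct(s)` is infinite,
it takes its limit value `κ`. -/
def curvTerm (c : SignType) (κ s : ℝ) : ℝ :=
  if si c s = 0 then κ else (κ * ct c s + c) / (ct c s - κ)

/-! ### Submanifolds of codimension two of the warped product -/

/-- The function `θ`, primitive of `1 / w` that vanishes at `t₀`. -/
def theta (w : ℝ → ℝ) (t₀ t : ℝ) : ℝ := ∫ s in t₀..t, 1 / w s

/-- The map `(co(θ ∘ τ) φ + si(θ ∘ τ) ν, τ)`. -/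
def phiBar {c : SignType} (w : ℝ → ℝ) (t₀ : ℝ) (φ ν : M → Amb c n) (τ : M → ℝ) (x : M) :
    Amb c n × ℝ :=
  (co c (theta w t₀ (τ x)) • φ x + si c (theta w t₀ (τ x)) • ν x, τ x)

/-- The field `(-c si(θ ∘ τ) φ + co(θ ∘ τ) ν, w ∘ τ)` along `phiBar`. -/
def nuBar {c : SignType} (w : ℝ → ℝ) (t₀ : ℝ) (φ ν : M → Amb c n) (τ : M → ℝ) (x : M) :
    Amb c n × ℝ :=
  (-((c : ℝ) * si c (theta w t₀ (τ x))) • φ x + co c (theta w t₀ (τ x)) • ν x, w (τ x))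

/-- At the point `x`, no principal curvature `κ` satisfies `ct(θ ∘ τ) = κ`, and
`n w'(τ) - ∑ m (κ ct(θ ∘ τ) + c) / (ct(θ ∘ τ) - κ) = 0`, where the sum is over the distinct
principal curvatures `κ` and `m` is the multiplicity of `κ`. -/
def MainEquation {c : SignType} (w : ℝ → ℝ) (t₀ : ℝ) (φ ν : M → Amb c n) (τ : M → ℝ) (x : M) :
    Prop :=
  (∀ κ : Module.End.Eigenvalues (shapeOperator φ ν x),
    si c (theta w t₀ (τ x)) = 0 ∨ ct c (theta w t₀ (τ x)) ≠ (κ : ℝ)) ∧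
  n * deriv w (τ x) - ∑ κ : Module.End.Eigenvalues (shapeOperator φ ν x),
    principalMultiplicity φ ν x κ * curvTerm c κ (theta w t₀ (τ x)) = 0

/-- The warped metric `w(t)² ⟨·,·⟩ - dt²` on `Amb c n × I`. The metric of the Robertson-Walker
space is its restriction to the tangent vectors of the product of the space form with `I`. -/
def warpedMetric (c : SignType) (n : ℕ) (w : ℝ → ℝ) (p u v : Amb c n × ℝ) : ℝ :=
  w p.2 ^ 2 * form c n u.1 v.1 - u.2 * v.2

/-- Christoffel symbols of the first kind of a metric `G` on an open subset of a vector space. -/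
def christoffel {F : Type*} [NormedAddCommGroup F] [NormedSpace ℝ F] (G : F → F → F → ℝ)
    (p u v z : F) : ℝ :=
  (fderiv ℝ (fun q => G q v z) p u + fderiv ℝ (fun q => G q u z) p v
    - fderiv ℝ (fun q => G q u v) p z) / 2

/-- On the open set `U`, `f` is a spacelike immersion of class `C^k` into the product of the space
form with `I`: the metric induced by the warped metric is positive definite. -/
structure IsSpacelike (c : SignType) (I : Set ℝ) (w : ℝ → ℝ) (k : ℕ∞) (U : Set M)
    (f : M → Amb c n × ℝ) : Prop where
  mem : ∀ x ∈ U, f x ∈ spaceForm c n ×ˢ I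
  contMDiffOn : ContMDiffOn (𝓡 n) 𝓘(ℝ, Amb c n × ℝ) k f U
  pos : ∀ x ∈ U, ∀ v : EuclideanSpace ℝ (Fin n), v ≠ 0 → 0 < warpedMetric c n w (f x) (dmap f x v) (dmap f x v)

/-- `Z` is tangent at `f x` to the product of the space form with `I`, and normal to `f`. -/
def IsNormalAt {c : SignType} (w : ℝ → ℝ) (f : M → Amb c n × ℝ) (x : M) (Z : Amb c n × ℝ) :
    Prop :=
  (c : ℝ) * form c n (f x).1 Z.1 = 0 ∧ ∀ v : EuclideanSpace ℝ (Fin n), warpedMetric c n w (f x) (dmap f x v) Z = 0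

/-- For `Z` normal to `f` at `x`, the number `⟨h(u, v), Z⟩`, where `h` is the second fundamental
form of `f`. It is `⟨D_u (df v), Z⟩` for the Levi-Civita connection `D` of the warped metric on
`Amb c n × I`; that of the Robertson-Walker space is its orthogonal projection, and `Z` is tangent
to the Robertson-Walker space. -/
def secondForm {c : SignType} (w : ℝ → ℝ) (f : M → Amb c n × ℝ) (x : M) (Z : Amb c n × ℝ)
    (u v : EuclideanSpace ℝ (Fin n)) : ℝ :=
  warpedMetric c n w (f x) (ddmap f x u v) Z
    + christoffel (warpedMetric c n w) (f x) (dmap f x u) (dmap f x v) Z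

/-- The Gram matrix of the metric induced by `f` at `x`. -/
def gram {c : SignType} (w : ℝ → ℝ) (f : M → Amb c n × ℝ) (x : M) : Matrix (Fin n) (Fin n) ℝ :=
  Matrix.of fun i j => warpedMetric c n w (f x)
    (dmap f x (EuclideanSpace.single i 1)) (dmap f x (EuclideanSpace.single j 1))

/-- The mean curvature vector of `f` at `x`: the normal vector `H` such that, for every normal `Z`,
`⟨H, Z⟩` is `1 / n` times the trace of `⟨h, Z⟩` with respect to the induced metric. -/
def meanCurvatureVector {c : SignType} (w : ℝ → ℝ) (f : M → Amb c n × ℝ) (x : M) : Amb c n × ℝ :=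
  Classical.epsilon fun H => IsNormalAt w f x H ∧ ∀ Z, IsNormalAt w f x Z →
    warpedMetric c n w (f x) H Z = 1 / (n : ℝ) * ∑ i, ∑ j, (gram w f x)⁻¹ i j *
      secondForm w f x Z (EuclideanSpace.single i 1) (EuclideanSpace.single j 1)

/-- On `U`, `f` is marginally trapped: its mean curvature vector is null. -/
def IsMarginallyTrapped {c : SignType} (w : ℝ → ℝ) (U : Set M) (f : M → Amb c n × ℝ) : Prop :=
  ∀ x ∈ U, warpedMetric c n w (f x) (meanCurvatureVector w f x) (meanCurvatureVector w f x) = 0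

/-- On `U`, `N` is a continuous, nowhere vanishing, null normal field along `f`, and the mean
curvature vector of `f` is collinear to `N`. -/
structure IsMarginallyTrappedAlong {c : SignType} (w : ℝ → ℝ) (U : Set M) (f N : M → Amb c n × ℝ) :
    Prop where
  continuousOn : ContinuousOn N U
  ne_zero : ∀ x ∈ U, N x ≠ 0
  normal : ∀ x ∈ U, IsNormalAt w f x (N x)
  null : ∀ x ∈ U, warpedMetric c n w (f x) (N x) (N x) = 0
  collinear : ∀ x ∈ U, ∃ a : ℝ, meanCurvatureVector w f x = a • N x

/-- In a neighbourhood of `x`, `f` is of the form `(co(θ ∘ τ) φ + si(θ ∘ τ) ν, τ)` where `φ`, `ν`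
and `τ` satisfy the main equation; the base point `t₀` of `θ` can be chosen arbitrarily close to
any point of `I`. -/
def IsLocallyRepresentedAt {c : SignType} (I : Set ℝ) (w : ℝ → ℝ) (f : M → Amb c n × ℝ) (x : M) :
    Prop :=
  ∀ t₁ ∈ I, ∀ ε > 0, ∃ t₀ ∈ I, |t₀ - t₁| < ε ∧
    ∃ (U : Set M) (φ ν : M → Amb c n) (τ : M → ℝ), IsOpen U ∧ x ∈ U ∧
      IsHypersurface c U φ ν ∧ ContMDiffOn (𝓡 n) 𝓘(ℝ, ℝ) 2 τ U ∧
      (∀ y ∈ U, f y = phiBar w t₀ φ ν τ y) ∧ ∀ y ∈ U, MainEquation w t₀ φ ν τ y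

end Manifold

end

end RobertsonWalker

open RobertsonWalker

/-!
The null geodesics through `(φ, t₀)` with initial velocity a multiple of `(ν, w)` project onto the
unit speed geodesics of the space form, with parameter `θ`. Hence `(φ, ν)` and the pair `(ψ, ζ)`
underlying `φ̄ = (ψ, τ)` and `ν̄ = (ζ, w ∘ τ)` differ by the rotation with angle `θ ∘ τ`, which can
be undone: every spacelike `f = (ψ, τ)` with null normal field `(ζ, w ∘ τ)` is a `φ̄`, provided that
the hypersurface obtained at height `t₀` is immersed. At a given point this excludes only finitely
many values of the angle, up to periods, whence the freedom to choose `t₀`.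

Along the null normal `ν̄`, the pairing `n ⟨H, ν̄⟩` is `-(tr D + n w'(τ))`, where `D` is given by
`dζ = dψ ∘ D` up to terms in `ψ` and `ζ`. With `A` the shape operator of `φ` and `s = θ ∘ τ`,
`D = -(c si(s) + co(s) A) (co(s) - si(s) A)⁻¹`, whose trace is minus the sum over the principal
curvatures in the equation. As the normal planes are Lorentzian, `H` is collinear to `ν̄` if and
only if it is orthogonal to it.

Near every point there are two null normal fields that are nowhere collinear, and a null `H` is
collinear to one of them on an open set arbitrarily close to the point, which gives the density.
-/

namespace RobertsonWalker

noncomputable section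

open scoped Topology

section SpaceFormFunctions

lemma hasDerivAt_co (c : SignType) (t : ℝ) : HasDerivAt (co c) (-((c : ℝ) * si c t)) t := by
  rcases c with _ | _ | _
  · exact (hasDerivAt_const t (1 : ℝ)).congr_deriv (by simp)
  · exact (Real.hasDerivAt_cosh t).congr_deriv (by simp [si])
  · exact (Real.hasDerivAt_cos t).congr_deriv (by simp [si])

lemma hasDerivAt_si (c : SignType) (t : ℝ) : HasDerivAt (si c) (co c t) t := by
  rcases c with _ | _ | _
  · exact hasDerivAt_id t
  · exact Real.hasDerivAt_sinh t
  · exact Real.hasDerivAt_sin t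

lemma analyticOnNhd_co (c : SignType) : AnalyticOnNhd ℝ (co c) univ := by
  intro t _
  rcases c with _ | _ | _
  · exact analyticAt_const
  · exact Real.analyticAt_cosh
  · exact Real.analyticAt_cos

lemma analyticOnNhd_si (c : SignType) : AnalyticOnNhd ℝ (si c) univ := by
  intro t _
  rcases c with _ | _ | _
  · exact analyticAt_id
  · exact Real.analyticAt_sinh
  · exact Real.analyticAt_sin

lemma contDiff_co (c : SignType) {k : ℕ∞ω} : ContDiff ℝ k (co c) :=
  contDiff_iff_contDiffAt.2 fun t => (analyticOnNhd_co c t trivial).contDiffAt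

lemma contDiff_si (c : SignType) {k : ℕ∞ω} : ContDiff ℝ k (si c) :=
  contDiff_iff_contDiffAt.2 fun t => (analyticOnNhd_si c t trivial).contDiffAt

lemma co_sq_add_si_sq (c : SignType) (t : ℝ) : co c t ^ 2 + c * si c t ^ 2 = 1 := by
  rcases c with _ | _ | _
  · simp [co, si]
  · simp [co, si, Real.cosh_sq]
  · simp [co, si]

lemma co_zero (c : SignType) : co c 0 = 1 := by rcases c with _ | _ | _ <;> simp [co]

lemma si_zero (c : SignType) : si c 0 = 0 := by rcases c with _ | _ | _ <;> simp [si]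

lemma co_neg (c : SignType) (s : ℝ) : co c (-s) = co c s := by
  rcases c with _ | _ | _ <;> simp [co]

lemma si_neg (c : SignType) (s : ℝ) : si c (-s) = -si c s := by
  rcases c with _ | _ | _ <;> simp [si]

lemma sign_cube (c : SignType) : (c : ℝ) * c * c = c := by
  rcases c with _ | _ | _ <;> simp

end SpaceFormFunctions

section Form

variable {c : SignType} {n : ℕ}

lemma form_comm (c : SignType) (n : ℕ) (x y : Amb c n) : form c n x y = form c n y x := by
  simp only [form, mul_comm (x _)]

/-- The flat scalar product as a continuous bilinear map. -/
def formL (c : SignType) (n : ℕ) : Amb c n →L[ℝ] Amb c n →L[ℝ] ℝ :=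
  (LinearMap.mk₂ ℝ (form c n)
    (fun x y z => by simp [form, add_mul, mul_add, Finset.sum_add_distrib])
    (fun a x y => by
      simp only [form, PiLp.smul_apply, smul_eq_mul, Finset.mul_sum]
      exact Finset.sum_congr rfl fun i _ => by ring)
    (fun x y z => by simp [form, mul_add, Finset.sum_add_distrib])
    (fun a x y => by
      simp only [form, PiLp.smul_apply, smul_eq_mul, Finset.mul_sum]
      exact Finset.sum_congr rfl fun i _ => by ring)).toContinuousBilinearMap

lemma formL_apply (c : SignType) (n : ℕ) (x y : Amb c n) : formL c n x y = form c n x y := rfl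

lemma form_add_left (x y z : Amb c n) : form c n (x + y) z = form c n x z + form c n y z := by
  simp [← formL_apply]

lemma form_add_right (x y z : Amb c n) : form c n x (y + z) = form c n x y + form c n x z := by
  simp [← formL_apply]

lemma form_sub_left (x y z : Amb c n) : form c n (x - y) z = form c n x z - form c n y z := by
  simp [← formL_apply]

lemma form_sub_right (x y z : Amb c n) : form c n x (y - z) = form c n x y - form c n x z := by
  simp [← formL_apply]

lemma form_neg_left (x y : Amb c n) : form c n (-x) y = -form c n x y := by simp [← formL_apply]

lemma form_neg_right (x y : Amb c n) : form c n x (-y) = -form c n x y := by simp [← formL_apply]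

lemma form_smul_left (x y : Amb c n) (a : ℝ) : form c n (a • x) y = a * form c n x y := by
  simp [← formL_apply]

lemma form_smul_right (x y : Amb c n) (a : ℝ) : form c n x (a • y) = a * form c n x y := by
  simp [← formL_apply]

lemma form_zero_left (y : Amb c n) : form c n 0 y = 0 := by simp [← formL_apply]

lemma form_zero_right (x : Amb c n) : form c n x 0 = 0 := by simp [← formL_apply]

end Form

section Minkowski

variable {n : ℕ}

lemma form_neg_eq_sum_castSucc (x y : Amb .neg n) :
    form .neg n x y + x (Fin.last (n + 1)) * y (Fin.last (n + 1)) =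
      ∑ i : Fin (n + 1), x i.castSucc * y i.castSucc := by
  have hform : form .neg n x y = ∑ i : Fin (n + 1 + 1),
    (if (SignType.neg = -1) ∧ (i : ℕ) = n + 1 then -1 else 1) * (x i * y i) := rfl
  have hne : ∀ i : Fin (n + 1), (i : ℕ) ≠ n + 1 := fun i => i.2.ne
  rw [hform, Fin.sum_univ_castSucc]
  simp [hne]

lemma neg_last_sq_le_form_neg (x : Amb .neg n) :
    -x (Fin.last (n + 1)) ^ 2 ≤ form .neg n x x := by
  have hsum : 0 ≤ ∑ i : Fin (n + 1), x i.castSucc * x i.castSucc :=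
    Finset.sum_nonneg fun i _ => mul_self_nonneg _
  linarith [form_neg_eq_sum_castSucc x x]

lemma form_neg_cauchySchwarz (x y : Amb .neg n) :
    (form .neg n x y + x (Fin.last (n + 1)) * y (Fin.last (n + 1))) ^ 2 ≤
      (form .neg n x x + x (Fin.last (n + 1)) ^ 2) *
        (form .neg n y y + y (Fin.last (n + 1)) ^ 2) := by
  have hcs := Finset.sum_mul_sq_le_sq_mul_sq Finset.univ
    (fun i : Fin (n + 1) => x i.castSucc) (fun i => y i.castSucc)
  simpa only [sq, form_neg_eq_sum_castSucc] using hcs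

lemma eq_zero_of_form_neg_self_nonpos {x : Amb .neg n} (hx : form .neg n x x ≤ 0)
    (hlast : x (Fin.last (n + 1)) = 0) : x = 0 := by
  have hsum := form_neg_eq_sum_castSucc x x
  rw [hlast, mul_zero, add_zero] at hsum
  have hzero := (Finset.sum_eq_zero_iff_of_nonneg fun i _ => mul_self_nonneg _).1
    (le_antisymm (hsum ▸ hx) (Finset.sum_nonneg fun i _ => mul_self_nonneg (x i.castSucc)))
  ext i
  refine Fin.lastCases ?_ (fun j => ?_) (i : Fin (n + 1 + 1))
  · exact hlast
  · exact mul_self_eq_zero.1 (hzero j (Finset.mem_univ j))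

lemma form_neg_self_pos {p v : Amb .neg n} (hp : form .neg n p p = -1)
    (hv : form .neg n p v = 0) (hv0 : v ≠ 0) : 0 < form .neg n v v := by
  by_contra! hle
  have hcs := form_neg_cauchySchwarz p v
  have hp1 := neg_last_sq_le_form_neg p
  rw [hv, hp] at hcs
  rw [hp] at hp1
  exact hv0 (eq_zero_of_form_neg_self_nonpos hle (pow_eq_zero_iff two_ne_zero |>.1
    (le_antisymm (by nlinarith) (sq_nonneg _))))

lemma last_pos_of_form_neg {p q : Amb .neg n} (hp : form .neg n p p = -1)
    (hq : form .neg n q q = -1) (hpq : form .neg n p q < 0) (hpos : 0 < p (Fin.last (n + 1))) :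
    0 < q (Fin.last (n + 1)) := by
  by_contra! hle
  have hcs := form_neg_cauchySchwarz p q
  have hp1 := neg_last_sq_le_form_neg p
  have hprod := mul_nonpos_of_nonneg_of_nonpos hpos.le hle
  rw [hp, hq] at hcs
  rw [hp] at hp1
  nlinarith [sq_nonneg (q (Fin.last (n + 1)))]

end Minkowski

section SpaceForm

variable {c : SignType} {n : ℕ} {p v : Amb c n}

lemma sign_mul_form_self (hp : p ∈ spaceForm c n) : (c : ℝ) * form c n p p = c * c := by
  rcases c with _ | _ | _
  · simp
  · have : form .neg n p p = -1 := hp.1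
    rw [this]; simp
  · have : form .pos n p p = 1 := hp
    rw [this]; simp

lemma form_self_pos (hp : p ∈ spaceForm c n) (hv : (c : ℝ) * form c n p v = 0) (hv0 : v ≠ 0) :
    0 < form c n v v := by
  by_cases hc : c = -1
  · subst hc
    exact form_neg_self_pos hp.1 (by simpa using hv) hv0
  · have hform : form c n v v = ∑ i, v i * v i := by simp [form, hc]
    rw [hform]
    refine (Finset.sum_nonneg fun i _ => mul_self_nonneg _).lt_of_ne' fun h => hv0 ?_
    have hzero := (Finset.sum_eq_zero_iff_of_nonneg fun i _ => mul_self_nonneg (v i)).1 h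
    ext i
    exact mul_self_eq_zero.1 (hzero i (Finset.mem_univ i))

lemma form_self_nonneg (hp : p ∈ spaceForm c n) (hv : (c : ℝ) * form c n p v = 0) :
    0 ≤ form c n v v := by
  rcases eq_or_ne v 0 with rfl | h
  · rw [form_zero_left]
  · exact (form_self_pos hp hv h).le

/-- The point at signed distance `s` from `p` on the geodesic of the space form that starts at `p`
in the unit direction `z`. -/
def rot (c : SignType) {n : ℕ} (s : ℝ) (p z : Amb c n) : Amb c n := co c s • p + si c s • z

/-- The velocity at `rot c s p z` of the geodesic that starts at `p` in the direction `z`. -/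
def rotNormal (c : SignType) {n : ℕ} (s : ℝ) (p z : Amb c n) : Amb c n :=
  -((c : ℝ) * si c s) • p + co c s • z

lemma rot_neg_rot (s : ℝ) (p z : Amb c n) : rot c (-s) (rot c s p z) (rotNormal c s p z) = p := by
  have h := co_sq_add_si_sq c s
  simp only [rot, rotNormal, co_neg, si_neg]
  calc _ = (co c s ^ 2 + c * si c s ^ 2) • p := by module
    _ = p := by rw [h, one_smul]

lemma rotNormal_neg_rot (s : ℝ) (p z : Amb c n) :
    rotNormal c (-s) (rot c s p z) (rotNormal c s p z) = z := by
  have h := co_sq_add_si_sq c s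
  simp only [rot, rotNormal, co_neg, si_neg]
  calc _ = (co c s ^ 2 + c * si c s ^ 2) • z := by module
    _ = z := by rw [h, one_smul]

variable {z : Amb c n}

lemma form_rot_rotNormal (hp : p ∈ spaceForm c n) (hz : (c : ℝ) * form c n p z = 0)
    (hz1 : form c n z z = 1) (s : ℝ) :
    (c : ℝ) * form c n (rot c s p z) (rotNormal c s p z) = 0 := by
  simp only [rot, rotNormal, form_add_left, form_add_right, form_smul_left, form_smul_right,
    form_comm c n z p, hz1]
  linear_combination (-co c s * c * si c s) * sign_mul_form_self hp -
    (co c s * si c s) * sign_cube c + (co c s ^ 2 - c * si c s ^ 2) * hz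

lemma form_rotNormal_self (hp : p ∈ spaceForm c n) (hz : (c : ℝ) * form c n p z = 0)
    (hz1 : form c n z z = 1) (s : ℝ) : form c n (rotNormal c s p z) (rotNormal c s p z) = 1 := by
  simp only [rotNormal, form_add_left, form_add_right, form_smul_left, form_smul_right,
    form_comm c n z p, hz1]
  linear_combination (c * si c s ^ 2) * sign_mul_form_self hp + co_sq_add_si_sq c s +
    si c s ^ 2 * sign_cube c - 2 * si c s * co c s * hz

lemma sign_mul_form_rot_self (hp : p ∈ spaceForm c n) (hz : (c : ℝ) * form c n p z = 0)
    (hz1 : form c n z z = 1) (s : ℝ) :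
    (c : ℝ) * form c n (rot c s p z) (rot c s p z) = c * c := by
  simp only [rot, form_add_left, form_add_right, form_smul_left, form_smul_right,
    form_comm c n z p, hz1]
  linear_combination co c s ^ 2 * sign_mul_form_self hp + 2 * co c s * si c s * hz +
    c * c * co_sq_add_si_sq c s - si c s ^ 2 * sign_cube c

lemma rot_mem (hp : p ∈ spaceForm c n) (hz : (c : ℝ) * form c n p z = 0)
    (hz1 : form c n z z = 1) (s : ℝ) : rot c s p z ∈ spaceForm c n := by
  have hself := sign_mul_form_rot_self hp hz hz1 s
  rcases c with _ | _ | _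
  · trivial
  · have hp1 : form .neg n p p = -1 := hp.1
    have hz0 : form .neg n p z = 0 := by simpa using hz
    have hself' : form .neg n (rot .neg s p z) (rot .neg s p z) = -1 := by
      simpa [neg_eq_iff_eq_neg] using hself
    have hpq : form .neg n p (rot .neg s p z) = -Real.cosh s := by
      rw [rot, form_add_right, form_smul_right, form_smul_right, hp1, hz0]; simp [co]
    exact ⟨hself', last_pos_of_form_neg hp1 hself' (by rw [hpq]; linarith [Real.cosh_pos s]) hp.2⟩
  · change form .pos n _ _ = 1
    simpa using hself

/-- The tangent space of the space form at `p`. -/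
def tangentSub (p : Amb c n) : Submodule ℝ (Amb c n) :=
  LinearMap.ker ((c : ℝ) • (formL c n p : Amb c n →ₗ[ℝ] ℝ))

lemma mem_tangentSub : v ∈ tangentSub p ↔ (c : ℝ) * form c n p v = 0 := by
  simp [tangentSub, formL_apply]

lemma finrank_tangentSub (hp : p ∈ spaceForm c n) : Module.finrank ℝ (tangentSub p) = n + 1 := by
  have hamb := finrank_euclideanSpace_fin (𝕜 := ℝ) (n := ambDim c n)
  by_cases hc : c = 0
  · subst hc
    have : (tangentSub p : Submodule ℝ (Amb 0 n)) = ⊤ := by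
      ext v; simp [mem_tangentSub]
    rw [this, finrank_top]
    exact hamb
  · have hsq : (c : ℝ) * c = 1 := by rcases c with _ | _ | _ <;> simp at hc ⊢
    have hne : (c : ℝ) • (formL c n p : Amb c n →ₗ[ℝ] ℝ) ≠ 0 := fun h => one_ne_zero (α := ℝ) <| by
      rw [← hsq, ← sign_mul_form_self hp]
      exact LinearMap.congr_fun h p
    have hdim : ambDim c n = n + 2 := by
      rcases c with _ | _ | _ <;> first | rfl | exact absurd rfl hc
    have hker := Module.Dual.finrank_ker_add_one_of_ne_zero hne
    change Module.finrank ℝ (tangentSub p) + 1 = Module.finrank ℝ (Amb c n) at hker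
    rw [hamb] at hker
    omega

end SpaceForm

section LinearAlgebra

lemma trace_eq_sum_eigenvalues {K V : Type*} [Field K] [AddCommGroup V] [Module K V]
    [FiniteDimensional K V] [DecidableEq K] {A B : Module.End K V}
    [Fintype (Module.End.Eigenvalues A)]
    (hA : DirectSum.IsInternal fun κ : Module.End.Eigenvalues A => A.eigenspace (κ : K)) {q : K → K}
    (hB : ∀ κ : K, ∀ v ∈ A.eigenspace κ, B v = q κ • v) :
    LinearMap.trace K V B =
      ∑ κ : Module.End.Eigenvalues A, (Module.finrank K (A.eigenspace (κ : K)) : K) * q κ := by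
  have hmaps : ∀ κ : Module.End.Eigenvalues A,
      MapsTo B (A.eigenspace (κ : K)) (A.eigenspace (κ : K)) := by
    intro κ v hv
    rw [SetLike.mem_coe, hB κ v hv]
    exact Submodule.smul_mem _ _ hv
  rw [LinearMap.trace_eq_sum_trace_restrict hA hmaps]
  refine Finset.sum_congr rfl fun κ _ => ?_
  have hrestrict : B.restrict (hmaps κ) = q κ • LinearMap.id := by
    ext v
    simp only [LinearMap.smul_apply, LinearMap.id_coe, id_eq, Submodule.coe_smul]
    exact hB κ v v.2
  rw [hrestrict, map_smul, LinearMap.trace_id, smul_eq_mul, mul_comm]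

lemma isInternal_eigenspace_of_posDef {V : Type*} [AddCommGroup V] [Module ℝ V]
    [FiniteDimensional ℝ V] {g : LinearMap.BilinForm ℝ V} (hg : ∀ u v, g u v = g v u)
    (hpos : ∀ v, v ≠ 0 → 0 < g v v) {A : Module.End ℝ V} (hA : ∀ u v, g (A u) v = g u (A v)) :
    DirectSum.IsInternal fun κ : Module.End.Eigenvalues A => A.eigenspace (κ : ℝ) := by
  have hnonneg : ∀ v, 0 ≤ g v v := fun v => by
    rcases eq_or_ne v 0 with rfl | h
    · simp
    · exact (hpos v h).le
  let core : InnerProductSpace.Core ℝ V :=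
    { inner := fun u v => g u v
      conj_inner_symm := fun u v => by simpa using hg v u
      re_inner_nonneg := fun v => by simpa using hnonneg v
      add_left := fun u v z => by simp
      smul_left := fun u v r => by simp
      definite := fun v hv => by_contra fun h => (hpos v h).ne' hv }
  let _ : NormedAddCommGroup V := core.toNormedAddCommGroup
  let _ : InnerProductSpace ℝ V := InnerProductSpace.ofCore core.toCore
  have hsym : LinearMap.IsSymmetric A := fun u v => hA u v
  exact hsym.direct_sum_isInternal

lemma nondegenerate_of_pos {V : Type*} [AddCommGroup V] [Module ℝ V] {g : LinearMap.BilinForm ℝ V}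
    (hpos : ∀ v, v ≠ 0 → 0 < g v v) : g.Nondegenerate :=
  ⟨fun v hv => by_contra fun h => (hpos v h).ne' (hv v),
    fun v hv => by_contra fun h => (hpos v h).ne' (hv v)⟩

lemma sum_inv_toMatrix_mul_eq_trace {K V ι : Type*} [Field K] [AddCommGroup V] [Module K V]
    [Fintype ι] [DecidableEq ι] (b : Module.Basis ι K V) {g : LinearMap.BilinForm K V}
    (hg : g.Nondegenerate) (D : Module.End K V) :
    ∑ i, ∑ j, (LinearMap.BilinForm.toMatrix b g)⁻¹ i j * g (b j) (D (b i)) =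
      LinearMap.trace K V D := by
  have hdet := (LinearMap.BilinForm.nondegenerate_iff_det_ne_zero b).1 hg
  calc _ = ((LinearMap.BilinForm.toMatrix b g)⁻¹ *
        LinearMap.BilinForm.toMatrix b (g.compRight D)).trace := by
        simp [Matrix.trace, Matrix.mul_apply, LinearMap.BilinForm.toMatrix_apply]
    _ = (LinearMap.toMatrix b b D).trace := by
        rw [LinearMap.BilinForm.toMatrix_compRight,
          Matrix.nonsing_inv_mul_cancel_left _ _ hdet.isUnit]
    _ = LinearMap.trace K V D := (LinearMap.trace_eq_matrix_trace K b D).symm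

lemma isInvertible_of_pos {V : Type*} [NormedAddCommGroup V] [NormedSpace ℝ V]
    [FiniteDimensional ℝ V] {g : V →L[ℝ] V →L[ℝ] ℝ} (hpos : ∀ v, v ≠ 0 → 0 < g v v) :
    g.IsInvertible := by
  have hinj : Function.Injective (g : V →ₗ[ℝ] V →L[ℝ] ℝ) := by
    rw [← LinearMap.ker_eq_bot, LinearMap.ker_eq_bot']
    exact fun v hv => by_contra fun h => (hpos v h).ne' (DFunLike.congr_fun hv v)
  have hfr : Module.finrank ℝ V = Module.finrank ℝ (V →L[ℝ] ℝ) := by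
    rw [← (LinearMap.toContinuousLinearMap (𝕜 := ℝ) (E := V) (F' := ℝ)).finrank_eq,
      Module.finrank_linearMap_self]
  exact ⟨(LinearEquiv.ofInjectiveOfFinrankEq _ hinj hfr).toContinuousLinearEquiv, rfl⟩

end LinearAlgebra

/-- `a` is an isomorphism onto a hyperplane of the tangent space of the space form at `p`, such as
the differential at a point of a hypersurface. -/
structure TangentFrame {c : SignType} {n : ℕ} (p : Amb c n)
    (a : EuclideanSpace ℝ (Fin n) →L[ℝ] Amb c n) : Prop where
  mem : p ∈ spaceForm c n
  injective : Function.Injective a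
  tangent : ∀ v, (c : ℝ) * form c n p (a v) = 0

lemma TangentFrame.pos {c : SignType} {n : ℕ} {p : Amb c n}
    {a : EuclideanSpace ℝ (Fin n) →L[ℝ] Amb c n} (h : TangentFrame p a)
    {v : EuclideanSpace ℝ (Fin n)} (hv : v ≠ 0) : 0 < form c n (a v) (a v) :=
  form_self_pos h.mem (h.tangent v) fun h0 => hv (h.injective (by rw [h0, map_zero]))

/-- A frame of a tangent hyperplane of the space form at `p`, together with a unit normal `z` of
that hyperplane. It is the linear situation at a point of a hypersurface `φ` (`p = φ x`, `a = dφ`,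
`z = ν x`). -/
structure AdaptedFrame {c : SignType} {n : ℕ} (p : Amb c n)
    (a : EuclideanSpace ℝ (Fin n) →L[ℝ] Amb c n) (z : Amb c n) : Prop extends
    TangentFrame p a where
  normal : ∀ v, form c n (a v) z = 0
  tangent_unit : (c : ℝ) * form c n p z = 0
  unit : form c n z z = 1

namespace AdaptedFrame

variable {c : SignType} {n : ℕ} {p z : Amb c n} {a : EuclideanSpace ℝ (Fin n) →L[ℝ] Amb c n}

lemma form_add_smul (h : AdaptedFrame p a z) (v : EuclideanSpace ℝ (Fin n)) (s : ℝ) :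
    form c n (a v + s • z) z = s := by
  rw [form_add_left, form_smul_left, h.normal, h.unit, zero_add, mul_one]

lemma exists_eq_add_smul (h : AdaptedFrame p a z) {W : Amb c n}
    (hW : (c : ℝ) * form c n p W = 0) :
    ∃ (v : EuclideanSpace ℝ (Fin n)) (s : ℝ), a v + s • z = W := by
  let L : EuclideanSpace ℝ (Fin n) × ℝ →ₗ[ℝ] tangentSub p :=
    LinearMap.codRestrict _ ((a : EuclideanSpace ℝ (Fin n) →ₗ[ℝ] Amb c n).coprod
      (LinearMap.toSpanSingleton ℝ _ z)) (by
        rintro ⟨v, s⟩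
        rw [mem_tangentSub]
        simp only [LinearMap.coprod_apply, ContinuousLinearMap.coe_coe,
          LinearMap.toSpanSingleton_apply, form_add_right, form_smul_right]
        linear_combination h.tangent v + s * h.tangent_unit)
  have hinj : Function.Injective L := by
    rw [← LinearMap.ker_eq_bot, LinearMap.ker_eq_bot']
    rintro ⟨v, s⟩ hvs
    have hvs' : a v + s • z = 0 := congrArg Subtype.val hvs
    obtain rfl : s = 0 := by rw [← h.form_add_smul v s, hvs', form_zero_left]
    obtain rfl : v = 0 := h.injective (by simpa using hvs')
    rfl
  have hfr : Module.finrank ℝ (EuclideanSpace ℝ (Fin n) × ℝ) = Module.finrank ℝ (tangentSub p) := by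
    rw [finrank_tangentSub h.mem]; simp
  obtain ⟨⟨v, s⟩, hv⟩ := (LinearMap.injective_iff_surjective_of_finrank_eq_finrank hfr).1 hinj
    ⟨W, mem_tangentSub.2 hW⟩
  exact ⟨v, s, congrArg Subtype.val hv⟩

lemma exists_eq (h : AdaptedFrame p a z) {W : Amb c n} (hW : (c : ℝ) * form c n p W = 0)
    (hz : form c n W z = 0) : ∃ v, W = a v := by
  obtain ⟨v, s, rfl⟩ := h.exists_eq_add_smul hW
  obtain rfl : s = 0 := by rw [← h.form_add_smul v s, hz]
  exact ⟨v, by simp⟩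

lemma eq_zero (h : AdaptedFrame p a z) {W : Amb c n} (hW : (c : ℝ) * form c n p W = 0)
    (hz : form c n W z = 0) (ha : ∀ v, form c n (a v) W = 0) : W = 0 := by
  obtain ⟨v, rfl⟩ := h.exists_eq hW hz
  exact by_contra fun hne => (form_self_pos h.mem hW hne).ne' (ha v)

lemma exists_factor (h : AdaptedFrame p a z) (L : EuclideanSpace ℝ (Fin n) →L[ℝ] Amb c n)
    (hL : ∀ v, (c : ℝ) * form c n p (L v) = 0) (hz : ∀ v, form c n (L v) z = 0) :
    ∃ D : Module.End ℝ (EuclideanSpace ℝ (Fin n)), ∀ v, L v = a (D v) := by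
  choose D hD using fun v => h.exists_eq (hL v) (hz v)
  refine ⟨{ toFun := D, map_add' := fun u v => ?_, map_smul' := fun r v => ?_ }, hD⟩
  · exact h.injective (by rw [← hD, map_add, map_add, hD, hD])
  · exact h.injective (by rw [← hD, map_smul, hD]; simp)

end AdaptedFrame

/-- The bilinear form on the source induced by a linear map `a` into the ambient space; the first
fundamental form when `a` is the differential of an immersion. -/
def inducedForm {c : SignType} {n : ℕ} (a : EuclideanSpace ℝ (Fin n) →L[ℝ] Amb c n) :
    EuclideanSpace ℝ (Fin n) →L[ℝ] EuclideanSpace ℝ (Fin n) →L[ℝ] ℝ :=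
  (formL c n).bilinearComp a a

lemma inducedForm_apply {c : SignType} {n : ℕ} (a : EuclideanSpace ℝ (Fin n) →L[ℝ] Amb c n)
    (u v : EuclideanSpace ℝ (Fin n)) : inducedForm a u v = form c n (a u) (a v) := rfl

section Charts

variable {n : ℕ} {M : Type*} [TopologicalSpace M] [ChartedSpace (EuclideanSpace ℝ (Fin n)) M]
  {F : Type*} [NormedAddCommGroup F] [NormedSpace ℝ F]

lemma dmap_eq_fderiv {f : M → F} {x : M} (hf : MDifferentiableAt (𝓡 n) 𝓘(ℝ, F) f x) :
    dmap f x = fderiv ℝ (f ∘ (extChartAt (𝓡 n) x).symm) (extChartAt (𝓡 n) x x) := by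
  refine (MDifferentiableAt.mfderiv hf).trans ?_
  simp only [writtenInExtChartAt, extChartAt_model_space_eq_id, PartialEquiv.refl_coe,
    Function.id_comp, modelWithCornersSelf_coe, range_id]
  exact congrFun fderivWithin_univ _

lemma contDiffAt_chart {f : M → F} {x : M} {k : ℕ∞ω} (hf : ContMDiffAt (𝓡 n) 𝓘(ℝ, F) k f x) :
    ContDiffAt ℝ k (f ∘ (extChartAt (𝓡 n) x).symm) (extChartAt (𝓡 n) x x) := by
  have h := (contMDiffAt_iff.1 hf).2
  simpa only [extChartAt_model_space_eq_id, PartialEquiv.refl_coe, Function.id_comp,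
    modelWithCornersSelf_coe, range_id, contDiffWithinAt_univ] using h

lemma contMDiffAt_of_chart {f : M → F} {x : M} {k : ℕ∞ω} (hc : ContinuousAt f x)
    (hf : ContDiffAt ℝ k (f ∘ (extChartAt (𝓡 n) x).symm) (extChartAt (𝓡 n) x x)) :
    ContMDiffAt (𝓡 n) 𝓘(ℝ, F) k f x := by
  refine contMDiffAt_iff.2 ⟨hc, ?_⟩
  simpa only [extChartAt_model_space_eq_id, PartialEquiv.refl_coe, Function.id_comp,
    modelWithCornersSelf_coe, range_id, contDiffWithinAt_univ] using hf

lemma tendsto_chart_symm (x : M) :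
    Filter.Tendsto (extChartAt (𝓡 n) x).symm (𝓝 (extChartAt (𝓡 n) x x)) (𝓝 x) := by
  have h := continuousAt_extChartAt_symm (I := 𝓡 n) x
  rw [ContinuousAt, extChartAt_to_inv] at h
  exact h

lemma tendsto_chart (x : M) :
    Filter.Tendsto (extChartAt (𝓡 n) x) (𝓝 x) (𝓝 (extChartAt (𝓡 n) x x)) :=
  continuousAt_extChartAt x

lemma eventually_chart {x : M} {P : M → Prop} :
    (∀ᶠ z in 𝓝 (extChartAt (𝓡 n) x x), P ((extChartAt (𝓡 n) x).symm z)) ↔ ∀ᶠ y in 𝓝 x, P y := by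
  refine ⟨fun h => ?_, fun h => tendsto_chart_symm x h⟩
  filter_upwards [tendsto_chart x h, extChartAt_source_mem_nhds (I := 𝓡 n) x] with y hy hs
  have hy' : P ((extChartAt (𝓡 n) x).symm (extChartAt (𝓡 n) x y)) := hy
  rwa [(extChartAt (𝓡 n) x).left_inv hs] at hy'

lemma eventually_fderiv_chart_eq [IsManifold (𝓡 n) 1 M] (x : M) :
    ∀ᶠ z in 𝓝 (extChartAt (𝓡 n) x x),
    ∃ T : EuclideanSpace ℝ (Fin n) ≃L[ℝ] EuclideanSpace ℝ (Fin n),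
      ∀ (F : Type*) [NormedAddCommGroup F] [NormedSpace ℝ F] (f : M → F),
        MDifferentiableAt (𝓡 n) 𝓘(ℝ, F) f ((extChartAt (𝓡 n) x).symm z) →
        fderiv ℝ (f ∘ (extChartAt (𝓡 n) x).symm) z =
          (dmap f ((extChartAt (𝓡 n) x).symm z)).comp
            (T : EuclideanSpace ℝ (Fin n) →L[ℝ] EuclideanSpace ℝ (Fin n)) := by
  filter_upwards [extChartAt_target_mem_nhds (I := 𝓡 n) x] with z hz
  obtain ⟨T, hT⟩ := isInvertible_mfderivWithin_extChartAt_symm (I := 𝓡 n) hz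
  refine ⟨T, fun F _ _ f hf => ?_⟩
  have hsymm : MDifferentiableAt 𝓘(ℝ, EuclideanSpace ℝ (Fin n)) (𝓡 n)
      (extChartAt (𝓡 n) x).symm z := by
    have := mdifferentiableWithinAt_extChartAt_symm (I := 𝓡 n) hz
    simpa [mdifferentiableWithinAt_univ] using this
  have hcomp := mfderiv_comp z hf hsymm
  rw [mfderiv_eq_fderiv] at hcomp
  rw [modelWithCornersSelf_coe, range_id, mfderivWithin_univ] at hT
  rw [hcomp, ← hT]
  rfl

end Charts

section ImplicitFields

lemma contDiffAt_of_implicit {X V K : Type*} [NormedAddCommGroup X] [NormedSpace ℝ X]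
    [CompleteSpace X] [NormedAddCommGroup V] [NormedSpace ℝ V] [FiniteDimensional ℝ V]
    [NormedAddCommGroup K] [NormedSpace ℝ K] [FiniteDimensional ℝ K] {k : ℕ∞ω} (hk : k ≠ 0)
    {Φ : X × V → K} {Z : X → V} {x : X} (hΦ : ContDiffAt ℝ k Φ (x, Z x))
    (hZ : ContinuousAt Z x) (h0 : ∀ᶠ y in 𝓝 x, Φ (y, Z y) = 0)
    (hinj : ∀ v, fderiv ℝ Φ (x, Z x) (0, v) = 0 → v = 0) : ContDiffAt ℝ k Z x := by
  have := FiniteDimensional.complete ℝ V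
  set L : V →L[ℝ] K := fderiv ℝ Φ (x, Z x) ∘L ContinuousLinearMap.inr ℝ X V
  have hker : LinearMap.ker (L : V →ₗ[ℝ] K) = ⊥ := by
    rw [LinearMap.ker_eq_bot']
    intro v hv
    exact hinj v hv
  obtain ⟨Γ, hΓ⟩ := (L : V →ₗ[ℝ] K).exists_leftInverse_of_injective hker
  set Γ' : K →L[ℝ] V := LinearMap.toContinuousLinearMap Γ
  have hΨ : ContDiffAt ℝ k (fun q => Γ' (Φ q)) (x, Z x) := Γ'.contDiff.contDiffAt.comp _ hΦ
  have hfd : fderiv ℝ (fun q => Γ' (Φ q)) (x, Z x) = Γ' ∘L fderiv ℝ Φ (x, Z x) :=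
    (Γ'.hasFDerivAt.comp _ (hΦ.differentiableAt hk).hasFDerivAt).fderiv
  have hinv : (fderiv ℝ (fun q => Γ' (Φ q)) (x, Z x) ∘L
      ContinuousLinearMap.inr ℝ X V).IsInvertible := by
    refine ⟨ContinuousLinearEquiv.refl ℝ V, ?_⟩
    rw [hfd]
    ext v
    exact (LinearMap.congr_fun hΓ v).symm
  have hx0 : Φ (x, Z x) = 0 := h0.self_of_nhds
  have hev := hΨ.eventually_apply_eq_iff_implicitFunction hk hinv
  have hcont : Filter.Tendsto (fun y => (y, Z y)) (𝓝 x) (𝓝 (x, Z x)) :=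
    Filter.Tendsto.prodMk_nhds Filter.tendsto_id hZ
  refine (hΨ.contDiffAt_implicitFunction hk hinv).congr_of_eventuallyEq ?_
  filter_upwards [hcont.eventually hev, h0] with y hy hy0
  exact (hy.1 (by rw [hy0, hx0])).symm

variable {c : SignType} {n : ℕ}

/-- The conditions `⟨A v, Y⟩ = b v`, `c ⟨P, Y⟩ = 0` and `⟨Y, Y⟩ = 1` on a vector `Y`, written as the
vanishing of one smooth map, to which the implicit function theorem applies. -/
def unitConstraint (A : EuclideanSpace ℝ (Fin n) →L[ℝ] Amb c n)
    (b : EuclideanSpace ℝ (Fin n) →L[ℝ] ℝ) (P Y : Amb c n) :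
    (EuclideanSpace ℝ (Fin n) →L[ℝ] ℝ) × ℝ × ℝ :=
  (((formL c n).flip Y).comp A - b, (c : ℝ) * formL c n P Y, formL c n Y Y - 1)

lemma unitConstraint_eq_zero_iff {A : EuclideanSpace ℝ (Fin n) →L[ℝ] Amb c n}
    {b : EuclideanSpace ℝ (Fin n) →L[ℝ] ℝ} {P Y : Amb c n} :
    unitConstraint A b P Y = 0 ↔ (∀ v, form c n (A v) Y = b v) ∧
      (c : ℝ) * form c n P Y = 0 ∧ form c n Y Y = 1 := by
  simp only [unitConstraint, Prod.mk_eq_zero, sub_eq_zero, formL_apply, ContinuousLinearMap.ext_iff]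
  rfl

lemma hasFDerivAt_unitConstraint (A : EuclideanSpace ℝ (Fin n) →L[ℝ] Amb c n)
    (b : EuclideanSpace ℝ (Fin n) →L[ℝ] ℝ) (P Y : Amb c n) :
    HasFDerivAt (unitConstraint A b P)
      (((((ContinuousLinearMap.compL ℝ (EuclideanSpace ℝ (Fin n)) (Amb c n) ℝ).flip A).comp
        (formL c n).flip)).prod (((c : ℝ) • formL c n P).prod
          (formL c n Y + (formL c n).flip Y))) Y := by
  refine HasFDerivAt.prodMk ?_ (HasFDerivAt.prodMk ?_ ?_)
  · exact (((ContinuousLinearMap.compL ℝ (EuclideanSpace ℝ (Fin n)) (Amb c n) ℝ).flip A).comp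
      (formL c n).flip).hasFDerivAt.sub_const b
  · exact ((c : ℝ) • formL c n P).hasFDerivAt
  · exact (((formL c n).hasFDerivAt_of_bilinear (hasFDerivAt_id Y)
      (hasFDerivAt_id Y)).congr_fderiv (by ext W; simp [formL_apply])).sub_const 1

variable {X : Type*} [NormedAddCommGroup X] [NormedSpace ℝ X] {k : ℕ∞ω}
  {a : X → EuclideanSpace ℝ (Fin n) →L[ℝ] Amb c n} {β : X → EuclideanSpace ℝ (Fin n) →L[ℝ] ℝ}
  {p : X → Amb c n}

lemma contDiffAt_unitConstraint {x : X} {Y : Amb c n} (ha : ContDiffAt ℝ k a x)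
    (hβ : ContDiffAt ℝ k β x) (hp : ContDiffAt ℝ k p x) :
    ContDiffAt ℝ k (fun q : X × Amb c n => unitConstraint (a q.1) (β q.1) (p q.1) q.2) (x, Y) := by
  have ha' : ContDiffAt ℝ k (fun q : X × Amb c n => a q.1) (x, Y) :=
    ContDiffAt.comp (x, Y) (g := a) ha contDiffAt_fst
  have hβ' : ContDiffAt ℝ k (fun q : X × Amb c n => β q.1) (x, Y) :=
    ContDiffAt.comp (x, Y) (g := β) hβ contDiffAt_fst
  have hp' : ContDiffAt ℝ k (fun q : X × Amb c n => p q.1) (x, Y) :=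
    ContDiffAt.comp (x, Y) (g := p) hp contDiffAt_fst
  unfold unitConstraint
  fun_prop

lemma contDiffAt_unit_field [CompleteSpace X] (hk : k ≠ 0) {Z : X → Amb c n} {x : X}
    (ha : ContDiffAt ℝ k a x) (hβ : ContDiffAt ℝ k β x) (hp : ContDiffAt ℝ k p x)
    (hZ : ContinuousAt Z x) (hframe : ∀ᶠ y in 𝓝 x, ∀ v, form c n (a y v) (Z y) = β y v)
    (htangent : ∀ᶠ y in 𝓝 x, (c : ℝ) * form c n (p y) (Z y) = 0)
    (hunit : ∀ᶠ y in 𝓝 x, form c n (Z y) (Z y) = 1)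
    (hinj : ∀ W, (∀ v, form c n (a x v) W = 0) → (c : ℝ) * form c n (p x) W = 0 →
      form c n (Z x) W = 0 → W = 0) : ContDiffAt ℝ k Z x := by
  have hΦ := contDiffAt_unitConstraint (Y := Z x) ha hβ hp
  refine contDiffAt_of_implicit hk hΦ hZ ?_ fun W hW => ?_
  · filter_upwards [hframe, htangent, hunit] with y h₁ h₂ h₃
    exact unitConstraint_eq_zero_iff.2 ⟨h₁, h₂, h₃⟩
  · have hpartial := ((hΦ.differentiableAt hk).hasFDerivAt.comp (Z x)
      (hasFDerivAt_prodMk_right x (Z x))).unique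
        (hasFDerivAt_unitConstraint (a x) (β x) (p x) (Z x))
    have hW' := (DFunLike.congr_fun hpartial W).symm.trans hW
    have hself : form c n (Z x) W + form c n W (Z x) = 0 := congrArg (fun q => q.2.2) hW'
    rw [form_comm c n W] at hself
    exact hinj W (DFunLike.congr_fun (congrArg Prod.fst hW')) (congrArg (fun q => q.2.1) hW')
      (by linarith)

lemma contMDiffAt_unit_field {M : Type*} [TopologicalSpace M]
    [ChartedSpace (EuclideanSpace ℝ (Fin n)) M] [IsManifold (𝓡 n) 1 M] {m : ℕ∞ω} (hk : k ≠ 0)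
    (hkm : k + 1 ≤ m) {g Z : M → Amb c n} {h τ : M → ℝ} {x : M}
    (hg : ∀ᶠ y in 𝓝 x, ContMDiffAt (𝓡 n) 𝓘(ℝ, Amb c n) m g y)
    (hτ : ∀ᶠ y in 𝓝 x, ContMDiffAt (𝓡 n) 𝓘(ℝ, ℝ) m τ y)
    (hh : ContMDiffAt (𝓡 n) 𝓘(ℝ, ℝ) k h x) (hZ : ContinuousAt Z x)
    (hframe : ∀ᶠ y in 𝓝 x, ∀ v : EuclideanSpace ℝ (Fin n),
      form c n (dmap g y v) (Z y) = h y * dmap τ y v)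
    (htangent : ∀ᶠ y in 𝓝 x, (c : ℝ) * form c n (g y) (Z y) = 0)
    (hunit : ∀ᶠ y in 𝓝 x, form c n (Z y) (Z y) = 1)
    (hinj : ∀ W, (∀ v : EuclideanSpace ℝ (Fin n), form c n (dmap g x v) W = 0) →
      (c : ℝ) * form c n (g x) W = 0 → form c n (Z x) W = 0 → W = 0) :
    ContMDiffAt (𝓡 n) 𝓘(ℝ, Amb c n) k Z x := by
  have hm : m ≠ 0 := by
    rintro rfl
    simp at hkm
  have hkm' : k ≤ m := le_trans le_self_add hkm
  refine contMDiffAt_of_chart hZ ?_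
  have hgx := contDiffAt_chart hg.self_of_nhds
  have hτx := contDiffAt_chart hτ.self_of_nhds
  refine contDiffAt_unit_field hk
    (a := fun z => fderiv ℝ (g ∘ (extChartAt (𝓡 n) x).symm) z)
    (β := fun z => (h ∘ (extChartAt (𝓡 n) x).symm) z •
      fderiv ℝ (τ ∘ (extChartAt (𝓡 n) x).symm) z) (p := g ∘ (extChartAt (𝓡 n) x).symm)
    (hgx.fderiv_right hkm) ((contDiffAt_chart hh).smul (hτx.fderiv_right hkm))
    (hgx.of_le hkm') ?_ ?_ (eventually_chart.2 htangent) (eventually_chart.2 hunit) ?_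
  · exact ContinuousAt.comp (by simpa using hZ) (continuousAt_extChartAt_symm x)
  · filter_upwards [eventually_fderiv_chart_eq x, eventually_chart.2 hframe, eventually_chart.2 hg,
      eventually_chart.2 hτ] with z ⟨T, hT⟩ hz hgz hτz v
    rw [hT _ g (hgz.mdifferentiableAt hm), hT _ τ (hτz.mdifferentiableAt hm)]
    exact hz (T v)
  · rw [← dmap_eq_fderiv (hg.self_of_nhds.mdifferentiableAt hm)]
    simpa using hinj

end ImplicitFields

section ProductDerivatives

variable {n : ℕ} {M : Type*} [TopologicalSpace M] [ChartedSpace (EuclideanSpace ℝ (Fin n)) M]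
  {F G : Type*} [NormedAddCommGroup F] [NormedSpace ℝ F] [NormedAddCommGroup G] [NormedSpace ℝ G]
  {c : SignType}

lemma differentiableAt_chart {f : M → F} {x : M}
    (hf : MDifferentiableAt (𝓡 n) 𝓘(ℝ, F) f x) :
    DifferentiableAt ℝ (f ∘ (extChartAt (𝓡 n) x).symm) (extChartAt (𝓡 n) x x) := by
  have := (mdifferentiableAt_iff _ _).1 hf
  simpa only [writtenInExtChartAt, extChartAt_model_space_eq_id, PartialEquiv.refl_coe,
    Function.id_comp, modelWithCornersSelf_coe, range_id, differentiableWithinAt_univ] using this.2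

lemma hasFDerivAt_chart {f : M → F} {x : M}
    (hf : MDifferentiableAt (𝓡 n) 𝓘(ℝ, F) f x) :
    HasFDerivAt (f ∘ (extChartAt (𝓡 n) x).symm) (dmap f x) (extChartAt (𝓡 n) x x) := by
  rw [dmap_eq_fderiv hf]
  exact (differentiableAt_chart hf).hasFDerivAt

lemma mdifferentiableAt_of_chart {f : M → F} {x : M} (hc : ContinuousAt f x)
    (hf : DifferentiableAt ℝ (f ∘ (extChartAt (𝓡 n) x).symm) (extChartAt (𝓡 n) x x)) :
    MDifferentiableAt (𝓡 n) 𝓘(ℝ, F) f x := by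
  refine (mdifferentiableAt_iff _ _).2 ⟨hc, ?_⟩
  simpa only [writtenInExtChartAt, extChartAt_model_space_eq_id, PartialEquiv.refl_coe,
    Function.id_comp, modelWithCornersSelf_coe, range_id, differentiableWithinAt_univ] using hf

lemma dmap_eq_of_hasFDerivAt {f : M → F} {x : M} {L : EuclideanSpace ℝ (Fin n) →L[ℝ] F}
    (hc : ContinuousAt f x)
    (hf : HasFDerivAt (f ∘ (extChartAt (𝓡 n) x).symm) L (extChartAt (𝓡 n) x x)) :
    dmap f x = L := by
  rw [dmap_eq_fderiv (mdifferentiableAt_of_chart hc hf.differentiableAt), hf.fderiv]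

lemma mdifferentiableAt_clm (L : F →L[ℝ] G) {f : M → F} {x : M}
    (hf : MDifferentiableAt (𝓡 n) 𝓘(ℝ, F) f x) :
    MDifferentiableAt (𝓡 n) 𝓘(ℝ, G) (fun y => L (f y)) x :=
  L.mdifferentiableAt.comp x hf

lemma dmap_clm (L : F →L[ℝ] G) {f : M → F} {x : M} (hf : MDifferentiableAt (𝓡 n) 𝓘(ℝ, F) f x)
    (v : EuclideanSpace ℝ (Fin n)) : dmap (fun y => L (f y)) x v = L (dmap f x v) :=
  DFunLike.congr_fun (L.hasMFDerivAt.comp x hf.hasMFDerivAt).mfderiv v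

lemma dmap_fst {f : M → Amb c n × ℝ} {x : M} (hf : MDifferentiableAt (𝓡 n) 𝓘(ℝ, Amb c n × ℝ) f x)
    (v : EuclideanSpace ℝ (Fin n)) : dmap (fun y => (f y).1) x v = (dmap f x v).1 :=
  dmap_clm (ContinuousLinearMap.fst ℝ (Amb c n) ℝ) hf v

lemma dmap_snd {f : M → Amb c n × ℝ} {x : M} (hf : MDifferentiableAt (𝓡 n) 𝓘(ℝ, Amb c n × ℝ) f x)
    (v : EuclideanSpace ℝ (Fin n)) : dmap (fun y => (f y).2) x v = (dmap f x v).2 :=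
  dmap_clm (ContinuousLinearMap.snd ℝ (Amb c n) ℝ) hf v

lemma mul_form_dmap_add_eq_zero {g h : M → Amb c n} {x : M} {s K : ℝ}
    (hg : MDifferentiableAt (𝓡 n) 𝓘(ℝ, Amb c n) g x)
    (hh : MDifferentiableAt (𝓡 n) 𝓘(ℝ, Amb c n) h x)
    (hgh : ∀ᶠ y in 𝓝 x, s * form c n (g y) (h y) = K) (v : EuclideanSpace ℝ (Fin n)) :
    s * (form c n (dmap g x v) (h x) + form c n (g x) (dmap h x v)) = 0 := by
  have hderiv := ((formL c n).hasFDerivAt_of_bilinear (hasFDerivAt_chart hg)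
    (hasFDerivAt_chart hh)).const_mul s
  have hconst := hderiv.congr_of_eventuallyEq (f₁ := fun _ => K)
    ((eventually_chart.2 hgh).mono fun z hz => hz.symm)
  have hzero := DFunLike.congr_fun (hconst.unique (hasFDerivAt_const K _)) v
  simp only [Function.comp_apply, extChartAt_to_inv] at hzero
  rw [add_comm]
  exact hzero

lemma sign_mul_form_dmap_self {g : M → Amb c n} {x : M}
    (hg : MDifferentiableAt (𝓡 n) 𝓘(ℝ, Amb c n) g x)
    (hmem : ∀ᶠ y in 𝓝 x, g y ∈ spaceForm c n) (v : EuclideanSpace ℝ (Fin n)) :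
    (c : ℝ) * form c n (g x) (dmap g x v) = 0 := by
  have h := mul_form_dmap_add_eq_zero hg hg (hmem.mono fun y hy => sign_mul_form_self hy) v
  rw [form_comm c n (dmap g x v)] at h
  linarith

end ProductDerivatives

section WarpedMetric

variable {c : SignType} {n : ℕ} {w : ℝ → ℝ} (p u v z : Amb c n × ℝ) (a : ℝ)

lemma warpedMetric_comm : warpedMetric c n w p u v = warpedMetric c n w p v u := by
  simp only [warpedMetric, form_comm c n u.1, mul_comm u.2]

lemma warpedMetric_add_right :
    warpedMetric c n w p u (v + z) = warpedMetric c n w p u v + warpedMetric c n w p u z := by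
  simp only [warpedMetric, Prod.fst_add, Prod.snd_add, form_add_right]; ring

lemma warpedMetric_sub_right :
    warpedMetric c n w p u (v - z) = warpedMetric c n w p u v - warpedMetric c n w p u z := by
  simp only [warpedMetric, Prod.fst_sub, Prod.snd_sub, form_sub_right]; ring

lemma warpedMetric_smul_right :
    warpedMetric c n w p u (a • v) = a * warpedMetric c n w p u v := by
  simp only [warpedMetric, Prod.smul_fst, Prod.smul_snd, form_smul_right, smul_eq_mul]; ring

lemma warpedMetric_add_left :
    warpedMetric c n w p (u + v) z = warpedMetric c n w p u z + warpedMetric c n w p v z := by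
  simp only [warpedMetric, Prod.fst_add, Prod.snd_add, form_add_left]; ring

lemma warpedMetric_sub_left :
    warpedMetric c n w p (u - v) z = warpedMetric c n w p u z - warpedMetric c n w p v z := by
  simp only [warpedMetric, Prod.fst_sub, Prod.snd_sub, form_sub_left]; ring

lemma warpedMetric_smul_left :
    warpedMetric c n w p (a • u) v = a * warpedMetric c n w p u v := by
  simp only [warpedMetric, Prod.smul_fst, Prod.smul_snd, form_smul_left, smul_eq_mul]; ring

lemma warpedMetric_null {z : Amb c n} {t : ℝ} (hz : form c n z z = 1) (hp : w p.2 = t) :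
    warpedMetric c n w p (z, t) (z, t) = 0 := by
  simp only [warpedMetric, hz, hp]
  ring

variable {p} in
lemma christoffel_warpedMetric (hw : DifferentiableAt ℝ w p.2) :
    christoffel (warpedMetric c n w) p u v z = w p.2 * deriv w p.2 *
      (u.2 * form c n v.1 z.1 + v.2 * form c n u.1 z.1 - z.2 * form c n u.1 v.1) := by
  have hfderiv : ∀ a b d : Amb c n × ℝ, fderiv ℝ (fun q => warpedMetric c n w q a b) p d =
      2 * w p.2 * deriv w p.2 * d.2 * form c n a.1 b.1 := by
    intro a b d
    have hwsnd : HasFDerivAt (fun q : Amb c n × ℝ => w q.2)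
        (deriv w p.2 • ContinuousLinearMap.snd ℝ (Amb c n) ℝ) p :=
      hw.hasDerivAt.comp_hasFDerivAt p hasFDerivAt_snd
    have hmetric : HasFDerivAt (fun q => warpedMetric c n w q a b) _ p :=
      ((hwsnd.pow 2).mul_const (form c n a.1 b.1)).sub_const (a.2 * b.2)
    rw [hmetric.fderiv]
    simp
    ring
  rw [christoffel, hfderiv, hfderiv, hfderiv]
  ring

end WarpedMetric

section ScreenMap

variable {n : ℕ} {M : Type*} [TopologicalSpace M] [ChartedSpace (EuclideanSpace ℝ (Fin n)) M]
  {c : SignType} {w : ℝ → ℝ} {f : M → Amb c n × ℝ} {x : M} {z : Amb c n}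

/-- The part of the differential of `f` orthogonal to the unit vector `z`, when the null vector
`(z, w)` is normal to `f`. Its square length is that of `df`, up to the factor `w²`. -/
def screenMap (w : ℝ → ℝ) (f : M → Amb c n × ℝ) (x : M) (z : Amb c n) :
    EuclideanSpace ℝ (Fin n) →L[ℝ] Amb c n :=
  (ContinuousLinearMap.fst ℝ (Amb c n) ℝ).comp (dmap f x) -
    (w (f x).2)⁻¹ • ((ContinuousLinearMap.snd ℝ (Amb c n) ℝ).comp (dmap f x)).smulRight z

lemma screenMap_apply (v : EuclideanSpace ℝ (Fin n)) :
    screenMap w f x z v = (dmap f x v).1 - ((w (f x).2)⁻¹ * (dmap f x v).2) • z := by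
  simp [screenMap, smul_smul]

lemma IsNormalAt.form_fst (hN : IsNormalAt w f x (z, w (f x).2)) (hw : w (f x).2 ≠ 0)
    (v : EuclideanSpace ℝ (Fin n)) :
    form c n (dmap f x v).1 z = (w (f x).2)⁻¹ * (dmap f x v).2 := by
  have h := hN.2 v
  simp only [warpedMetric] at h
  field_simp
  refine mul_left_cancel₀ hw ?_
  linear_combination h

lemma adaptedFrame_screenMap (hmem : (f x).1 ∈ spaceForm c n)
    (htan : ∀ v : EuclideanSpace ℝ (Fin n), (c : ℝ) * form c n (f x).1 (dmap f x v).1 = 0)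
    (hw : w (f x).2 ≠ 0)
    (hpos : ∀ v : EuclideanSpace ℝ (Fin n), v ≠ 0 →
      0 < warpedMetric c n w (f x) (dmap f x v) (dmap f x v))
    (hN : IsNormalAt w f x (z, w (f x).2)) (hz : form c n z z = 1) :
    AdaptedFrame (f x).1 (screenMap w f x z) z := by
  refine ⟨⟨hmem, ?_, fun v => ?_⟩, fun v => ?_, hN.1, hz⟩
  · rw [injective_iff_map_eq_zero]
    intro v hv
    by_contra hne
    refine (hpos v hne).ne' ?_
    rw [screenMap_apply, sub_eq_zero] at hv
    simp only [warpedMetric, hv, form_smul_left, form_smul_right, hz]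
    field_simp
    ring
  · rw [screenMap_apply, form_sub_right, form_smul_right]
    linear_combination htan v - (w (f x).2)⁻¹ * (dmap f x v).2 * hN.1
  · rw [screenMap_apply, form_sub_left, form_smul_left, hz, hN.form_fst hw]
    ring

namespace AdaptedFrame

lemma form_fst (h : AdaptedFrame (f x).1 (screenMap w f x z) z) (v : EuclideanSpace ℝ (Fin n)) :
    form c n (dmap f x v).1 z = (w (f x).2)⁻¹ * (dmap f x v).2 := by
  have hv := h.normal v
  rw [screenMap_apply, form_sub_left, form_smul_left, h.unit] at hv
  linarith

lemma tangent_fst (h : AdaptedFrame (f x).1 (screenMap w f x z) z)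
    (v : EuclideanSpace ℝ (Fin n)) : (c : ℝ) * form c n (f x).1 (dmap f x v).1 = 0 := by
  have hv := h.tangent v
  rw [screenMap_apply, form_sub_right, form_smul_right] at hv
  linear_combination hv + (w (f x).2)⁻¹ * (dmap f x v).2 * h.tangent_unit

lemma isNormalAt (h : AdaptedFrame (f x).1 (screenMap w f x z) z) :
    IsNormalAt w f x (z, w (f x).2) := by
  refine ⟨h.tangent_unit, fun v => ?_⟩
  simp only [warpedMetric, h.form_fst]
  field_simp
  ring

lemma warpedMetric_dmap (hw : w (f x).2 ≠ 0) (h : AdaptedFrame (f x).1 (screenMap w f x z) z)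
    (u v : EuclideanSpace ℝ (Fin n)) : warpedMetric c n w (f x) (dmap f x u) (dmap f x v) =
      w (f x).2 ^ 2 * form c n (screenMap w f x z u) (screenMap w f x z v) := by
  have hcomm : ∀ v : EuclideanSpace ℝ (Fin n),
      form c n z (dmap f x v).1 = (w (f x).2)⁻¹ * (dmap f x v).2 :=
    fun v => (form_comm c n _ _).trans (h.form_fst v)
  simp only [warpedMetric, screenMap_apply, form_sub_left, form_sub_right, form_smul_left,
    form_smul_right, h.form_fst, hcomm, h.unit]
  field_simp
  ring

lemma warpedMetric_dmap_pos (hw : w (f x).2 ≠ 0)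
    (h : AdaptedFrame (f x).1 (screenMap w f x z) z) {v : EuclideanSpace ℝ (Fin n)} (hv : v ≠ 0) :
    0 < warpedMetric c n w (f x) (dmap f x v) (dmap f x v) := by
  rw [h.warpedMetric_dmap hw]
  exact mul_pos (by positivity) (h.pos hv)

lemma eq_smul_null (hw : w (f x).2 ≠ 0) (h : AdaptedFrame (f x).1 (screenMap w f x z) z)
    {H : Amb c n × ℝ} (hH : IsNormalAt w f x H)
    (hHz : warpedMetric c n w (f x) H (z, w (f x).2) = 0) :
    H = (H.2 * (w (f x).2)⁻¹) • (z, w (f x).2) := by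
  set b := H.2 * (w (f x).2)⁻¹ with hb
  have hbw : b * w (f x).2 = H.2 := by rw [hb]; field_simp
  have hunit : form c n (H.1 - b • z) z = 0 := by
    rw [form_sub_left, form_smul_left, h.unit]
    simp only [warpedMetric] at hHz
    refine mul_left_cancel₀ (pow_ne_zero 2 hw) ?_
    linear_combination hHz - w (f x).2 * hbw
  have htangent : (c : ℝ) * form c n (f x).1 (H.1 - b • z) = 0 := by
    rw [form_sub_right, form_smul_right]
    linear_combination hH.1 - b * h.tangent_unit
  have hscreen : ∀ v, form c n (screenMap w f x z v) (H.1 - b • z) = 0 := by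
    intro v
    rw [screenMap_apply, form_sub_left, form_smul_left, form_comm c n z, hunit, form_sub_right,
      form_smul_right, h.form_fst]
    have hv := hH.2 v
    simp only [warpedMetric] at hv
    have hinv : w (f x).2 * (w (f x).2)⁻¹ = 1 := mul_inv_cancel₀ hw
    refine mul_left_cancel₀ (pow_ne_zero 2 hw) ?_
    linear_combination hv - (dmap f x v).2 * w (f x).2 * b * hinv - (dmap f x v).2 * hbw
  exact Prod.ext (sub_eq_zero.1 (h.eq_zero htangent hunit hscreen)) hbw.symm

end AdaptedFrame

end ScreenMap

section MeanCurvatureVector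

variable {n : ℕ} {M : Type*} [TopologicalSpace M] [ChartedSpace (EuclideanSpace ℝ (Fin n)) M]
  {c : SignType} {w : ℝ → ℝ} {f : M → Amb c n × ℝ} {x : M}

/-- The warped metric at the point `p`, as a bilinear form. -/
def warpedForm (w : ℝ → ℝ) (p : Amb c n × ℝ) : LinearMap.BilinForm ℝ (Amb c n × ℝ) :=
  LinearMap.mk₂ ℝ (warpedMetric c n w p)
    (warpedMetric_add_left p) (fun a u v => warpedMetric_smul_left p u v a)
    (warpedMetric_add_right p) (fun a u v => warpedMetric_smul_right p u v a)

/-- The normal space of `f` at `x`, as a subspace of the ambient vector space. -/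
def normalSpace (w : ℝ → ℝ) (f : M → Amb c n × ℝ) (x : M) : Submodule ℝ (Amb c n × ℝ) where
  carrier := {Z | IsNormalAt w f x Z}
  add_mem' {Y Z} hY hZ := by
    refine ⟨?_, fun v => by rw [warpedMetric_add_right, hY.2, hZ.2, add_zero]⟩
    rw [Prod.fst_add, form_add_right]
    linear_combination hY.1 + hZ.1
  zero_mem' := ⟨by simp [form_zero_right], fun v => by simp [warpedMetric, form_zero_right]⟩
  smul_mem' a Z hZ := by
    refine ⟨?_, fun v => by rw [warpedMetric_smul_right, hZ.2, mul_zero]⟩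
    rw [Prod.smul_fst, form_smul_right]
    linear_combination a * hZ.1

lemma exists_isNormalAt_sub_dmap
    (htan : ∀ v : EuclideanSpace ℝ (Fin n), (c : ℝ) * form c n (f x).1 (dmap f x v).1 = 0)
    (hpos : ∀ v : EuclideanSpace ℝ (Fin n), v ≠ 0 →
      0 < warpedMetric c n w (f x) (dmap f x v) (dmap f x v))
    {Y : Amb c n × ℝ} (hY : (c : ℝ) * form c n (f x).1 Y.1 = 0) :
    ∃ v : EuclideanSpace ℝ (Fin n), IsNormalAt w f x (Y - dmap f x v) := by
  let G := (warpedForm w (f x)).toContinuousBilinearMap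
  obtain ⟨g', hg'⟩ := isInvertible_of_pos (g := G.bilinearComp (dmap f x) (dmap f x)) hpos
  let v := g'.symm ((G Y).comp (dmap f x))
  have hproj : g' v = (G Y).comp (dmap f x) := g'.apply_symm_apply _
  refine ⟨v, ?_, fun u => ?_⟩
  · rw [Prod.fst_sub, form_sub_right]
    linear_combination hY - htan v
  · have hvu : warpedMetric c n w (f x) (dmap f x v) (dmap f x u) =
        warpedMetric c n w (f x) Y (dmap f x u) := by
      rw [← ContinuousLinearEquiv.coe_coe, hg'] at hproj
      exact DFunLike.congr_fun hproj u
    rw [warpedMetric_comm, warpedMetric_sub_left, hvu, sub_self]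

lemma IsNormalAt.eq_zero (hmem : (f x).1 ∈ spaceForm c n) (hw : w (f x).2 ≠ 0)
    (htan : ∀ v : EuclideanSpace ℝ (Fin n), (c : ℝ) * form c n (f x).1 (dmap f x v).1 = 0)
    (hpos : ∀ v : EuclideanSpace ℝ (Fin n), v ≠ 0 →
      0 < warpedMetric c n w (f x) (dmap f x v) (dmap f x v))
    {Z : Amb c n × ℝ} (hZ : IsNormalAt w f x Z)
    (hortho : ∀ Z', IsNormalAt w f x Z' → warpedMetric c n w (f x) Z Z' = 0) : Z = 0 := by
  obtain ⟨v, hv⟩ := exists_isNormalAt_sub_dmap htan hpos (Y := (Z.1, -Z.2)) hZ.1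
  -- Reversing the sign of the time component turns the Lorentzian square of `Z` into a positive
  -- definite one.
  have hsq : w (f x).2 ^ 2 * form c n Z.1 Z.1 + Z.2 * Z.2 = 0 := by
    have h := hortho _ hv
    rw [warpedMetric_sub_right, warpedMetric_comm _ Z (dmap f x v), hZ.2 v] at h
    simp only [warpedMetric] at h
    linarith
  have hform := form_self_nonneg hmem hZ.1
  have hfst : Z.1 = 0 := by
    by_contra hne
    have := form_self_pos hmem hZ.1 hne
    nlinarith [mul_pos (sq_pos_of_ne_zero hw) this, mul_self_nonneg Z.2]
  rw [hfst, form_zero_left, mul_zero, zero_add] at hsq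
  exact Prod.ext hfst (mul_self_eq_zero.1 hsq)

lemma exists_isNormalAt_forall_warpedMetric_eq (hmem : (f x).1 ∈ spaceForm c n)
    (hw : w (f x).2 ≠ 0)
    (htan : ∀ v : EuclideanSpace ℝ (Fin n), (c : ℝ) * form c n (f x).1 (dmap f x v).1 = 0)
    (hpos : ∀ v : EuclideanSpace ℝ (Fin n), v ≠ 0 →
      0 < warpedMetric c n w (f x) (dmap f x v) (dmap f x v))
    (ℓ : Amb c n × ℝ →ₗ[ℝ] ℝ) :
    ∃ H, IsNormalAt w f x H ∧ ∀ Z, IsNormalAt w f x Z → warpedMetric c n w (f x) H Z = ℓ Z := by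
  let S := normalSpace w f x
  let B : S →ₗ[ℝ] Module.Dual ℝ S := (warpedForm w (f x)).domRestrict₁₂ S S
  have hB : Function.Injective B := by
    rw [← LinearMap.ker_eq_bot, LinearMap.ker_eq_bot']
    intro Z hZ
    refine Subtype.ext (IsNormalAt.eq_zero hmem hw htan hpos Z.2 fun Z' hZ' => ?_)
    exact LinearMap.congr_fun hZ ⟨Z', hZ'⟩
  obtain ⟨H, hH⟩ := (LinearMap.injective_iff_surjective_of_finrank_eq_finrank
    (Subspace.dual_finrank_eq (K := ℝ) (V := S)).symm).1 hB (ℓ.domRestrict S)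
  exact ⟨H, H.2, fun Z hZ => LinearMap.congr_fun hH ⟨Z, hZ⟩⟩

lemma isLinearMap_secondForm (hwd : DifferentiableAt ℝ w (f x).2)
    (u v : EuclideanSpace ℝ (Fin n)) : IsLinearMap ℝ fun Z => secondForm w f x Z u v where
  map_add Y Z := by
    simp only [secondForm, christoffel_warpedMetric _ _ _ hwd, warpedMetric_add_right,
      Prod.fst_add, Prod.snd_add, form_add_right]
    ring
  map_smul a Z := by
    simp only [secondForm, christoffel_warpedMetric _ _ _ hwd, warpedMetric_smul_right,
      Prod.smul_fst, Prod.smul_snd, form_smul_right, smul_eq_mul]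
    ring

lemma meanCurvatureVector_spec (hmem : (f x).1 ∈ spaceForm c n) (hw : w (f x).2 ≠ 0)
    (hwd : DifferentiableAt ℝ w (f x).2)
    (htan : ∀ v : EuclideanSpace ℝ (Fin n), (c : ℝ) * form c n (f x).1 (dmap f x v).1 = 0)
    (hpos : ∀ v : EuclideanSpace ℝ (Fin n), v ≠ 0 →
      0 < warpedMetric c n w (f x) (dmap f x v) (dmap f x v)) :
    IsNormalAt w f x (meanCurvatureVector w f x) ∧ ∀ Z, IsNormalAt w f x Z →
      warpedMetric c n w (f x) (meanCurvatureVector w f x) Z =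
        1 / (n : ℝ) * ∑ i, ∑ j, (gram w f x)⁻¹ i j *
          secondForm w f x Z (EuclideanSpace.single i 1) (EuclideanSpace.single j 1) := by
  obtain ⟨H, hnormal, hH⟩ := exists_isNormalAt_forall_warpedMetric_eq hmem hw htan hpos
    ((1 / (n : ℝ)) • ∑ i, ∑ j, (gram w f x)⁻¹ i j •
      (isLinearMap_secondForm hwd (EuclideanSpace.single i 1) (EuclideanSpace.single j 1)).mk')
  refine Classical.epsilon_spec (p := fun H => IsNormalAt w f x H ∧ ∀ Z, IsNormalAt w f x Z →
    warpedMetric c n w (f x) H Z = 1 / (n : ℝ) * ∑ i, ∑ j, (gram w f x)⁻¹ i j *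
      secondForm w f x Z (EuclideanSpace.single i 1) (EuclideanSpace.single j 1))
    ⟨H, hnormal, fun Z hZ => ?_⟩
  rw [hH Z hZ]
  simp

end MeanCurvatureVector

section Weingarten

variable {n : ℕ} {M : Type*} [TopologicalSpace M] [ChartedSpace (EuclideanSpace ℝ (Fin n)) M]
  {c : SignType} {w : ℝ → ℝ} {f : M → Amb c n × ℝ} {ζ : M → Amb c n} {x : M}
  {D : Module.End ℝ (EuclideanSpace ℝ (Fin n))}

/-- `D` is, up to sign, the Weingarten operator at `x` of the null normal field `(ζ, w ∘ τ)` along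
`f = (ψ, τ)`: the component of `dζ` tangent to the space form is the screen map composed with `D`.
The term in `c` removes the component of `dζ` along the position vector `ψ`. -/
def IsWeingarten (w : ℝ → ℝ) (f : M → Amb c n × ℝ) (ζ : M → Amb c n) (x : M)
    (D : Module.End ℝ (EuclideanSpace ℝ (Fin n))) : Prop :=
  ∀ v : EuclideanSpace ℝ (Fin n),
    dmap ζ x v + ((c : ℝ) * ((w (f x).2)⁻¹ * (dmap f x v).2)) • (f x).1 =
      screenMap w f x (ζ x) (D v)

lemma exists_isWeingarten (hf : MDifferentiableAt (𝓡 n) 𝓘(ℝ, Amb c n × ℝ) f x)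
    (hζ : MDifferentiableAt (𝓡 n) 𝓘(ℝ, Amb c n) ζ x)
    (h : AdaptedFrame (f x).1 (screenMap w f x (ζ x)) (ζ x))
    (htan : ∀ᶠ y in 𝓝 x, (c : ℝ) * form c n (f y).1 (ζ y) = 0)
    (hunit : ∀ᶠ y in 𝓝 x, form c n (ζ y) (ζ y) = 1) :
    ∃ D : Module.End ℝ (EuclideanSpace ℝ (Fin n)), IsWeingarten w f ζ x D := by
  have hψ := mdifferentiableAt_clm (ContinuousLinearMap.fst ℝ (Amb c n) ℝ) hf
  let L : EuclideanSpace ℝ (Fin n) →L[ℝ] Amb c n := dmap ζ x + ((c : ℝ) * (w (f x).2)⁻¹) •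
    ((ContinuousLinearMap.snd ℝ (Amb c n) ℝ).comp (dmap f x)).smulRight (f x).1
  have hL : ∀ v : EuclideanSpace ℝ (Fin n),
      L v = dmap ζ x v + ((c : ℝ) * ((w (f x).2)⁻¹ * (dmap f x v).2)) • (f x).1 := by
    intro v
    simp [L, smul_smul, mul_assoc]
  have htangent : ∀ v, (c : ℝ) * form c n (f x).1 (L v) = 0 := by
    intro v
    have hderiv := mul_form_dmap_add_eq_zero hψ hζ htan v
    simp only [ContinuousLinearMap.coe_fst', dmap_fst hf] at hderiv
    rw [h.form_fst v] at hderiv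
    rw [hL, form_add_right, form_smul_right]
    linear_combination hderiv + c * ((w (f x).2)⁻¹ * (dmap f x v).2) * sign_mul_form_self h.mem +
      ((w (f x).2)⁻¹ * (dmap f x v).2) * sign_cube c
  have hnormal : ∀ v, form c n (L v) (ζ x) = 0 := by
    intro v
    have hderiv := mul_form_dmap_add_eq_zero (s := 1) hζ hζ
      (hunit.mono fun y hy => by rw [hy, one_mul]) v
    rw [form_comm c n (ζ x)] at hderiv
    rw [hL, form_add_left, form_smul_left]
    linear_combination (1 / 2) * hderiv + ((w (f x).2)⁻¹ * (dmap f x v).2) * h.tangent_unit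
  obtain ⟨D, hD⟩ := h.exists_factor L htangent hnormal
  exact ⟨D, fun v => by rw [← hL, hD]⟩

lemma IsWeingarten.form_dmap (hD : IsWeingarten w f ζ x D)
    (h : AdaptedFrame (f x).1 (screenMap w f x (ζ x)) (ζ x)) (u v : EuclideanSpace ℝ (Fin n)) :
    form c n (dmap f x v).1 (dmap ζ x u) =
      form c n (screenMap w f x (ζ x) v) (screenMap w f x (ζ x) (D u)) := by
  have hζ : dmap ζ x u = screenMap w f x (ζ x) (D u) -
      ((c : ℝ) * ((w (f x).2)⁻¹ * (dmap f x u).2)) • (f x).1 := by rw [← hD]; abel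
  have hf : (dmap f x v).1 =
      screenMap w f x (ζ x) v + ((w (f x).2)⁻¹ * (dmap f x v).2) • ζ x := by
    rw [screenMap_apply]; abel
  have hscreen : form c n (dmap f x v).1 (screenMap w f x (ζ x) (D u)) =
      form c n (screenMap w f x (ζ x) v) (screenMap w f x (ζ x) (D u)) := by
    rw [hf, form_add_left, form_smul_left, form_comm c n (ζ x), h.normal]; ring
  rw [hζ, form_sub_right, form_smul_right, hscreen, form_comm c n (dmap f x v).1]
  linear_combination (-((w (f x).2)⁻¹ * (dmap f x u).2)) * h.tangent_fst v

section SecondForm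

variable [IsManifold (𝓡 n) 1 M] (hf : ContMDiffAt (𝓡 n) 𝓘(ℝ, Amb c n × ℝ) 2 f x)
  (hζ : MDifferentiableAt (𝓡 n) 𝓘(ℝ, Amb c n) ζ x)
  (hwd : DifferentiableAt ℝ w (f x).2)
  (hrel : ∀ᶠ y in 𝓝 x, ∀ v : EuclideanSpace ℝ (Fin n),
    w (f y).2 * form c n (dmap f y v).1 (ζ y) = (dmap f y v).2)

include hf hζ hwd hrel

lemma snd_ddmap_eq (u v : EuclideanSpace ℝ (Fin n)) :
    (ddmap f x u v).2 = w (f x).2 * (form c n (dmap f x v).1 (dmap ζ x u) +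
      form c n (ddmap f x u v).1 (ζ x)) +
      form c n (dmap f x v).1 (ζ x) * (deriv w (f x).2 * (dmap f x u).2) := by
  set χ := extChartAt (𝓡 n) x with hχ
  have hfd : ∀ᶠ y in 𝓝 x, MDifferentiableAt (𝓡 n) 𝓘(ℝ, Amb c n × ℝ) f y :=
    ((contMDiffAt_iff_contMDiffAt_nhds (by simp)).1 (hf.of_le one_le_two)).mono fun y hy =>
      hy.mdifferentiableAt one_ne_zero
  have hfx := hasFDerivAt_chart hfd.self_of_nhds
  have hζx := hasFDerivAt_chart hζ
  rw [← hχ] at hfx hζx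
  have hxx : χ.symm (χ x) = x := extChartAt_to_inv x
  have hF : DifferentiableAt ℝ (fderiv ℝ (f ∘ χ.symm)) (χ x) :=
    ((contDiffAt_chart hf).fderiv_right (m := 1) (by norm_num)).differentiableAt one_ne_zero
  have hFv : HasFDerivAt (fun q => fderiv ℝ (f ∘ χ.symm) q v)
      ((fderiv ℝ (fderiv ℝ (f ∘ χ.symm)) (χ x)).flip v) (χ x) :=
    (hF.hasFDerivAt.clm_apply (hasFDerivAt_const v (χ x))).congr_fderiv (by
      rw [ContinuousLinearMap.comp_zero, zero_add])
  have hwF : HasFDerivAt (fun q => w ((f ∘ χ.symm) q).2) _ (χ x) :=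
    HasDerivAt.comp_hasFDerivAt (h₂ := w) (f := fun q => ((f ∘ χ.symm) q).2) (χ x) (by
      simp only [Function.comp_apply, hxx]
      exact hwd.hasDerivAt) hfx.snd
  have hrelF : (fun q => (fderiv ℝ (f ∘ χ.symm) q v).2) =ᶠ[𝓝 (χ x)] fun q =>
      w ((f ∘ χ.symm) q).2 * formL c n (fderiv ℝ (f ∘ χ.symm) q v).1 ((ζ ∘ χ.symm) q) := by
    filter_upwards [eventually_fderiv_chart_eq x, eventually_chart.2 hfd, eventually_chart.2 hrel]
      with q ⟨T, hT⟩ hfq hq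
    rw [hT _ f hfq]
    exact (hq (T v)).symm
  have hprod := hwF.mul ((formL c n).hasFDerivAt_of_bilinear hFv.fst hζx)
  have hderiv := DFunLike.congr_fun (hFv.snd.unique (hprod.congr_of_eventuallyEq hrelF)) u
  have hdf : fderiv ℝ (f ∘ χ.symm) (χ x) = dmap f x := (dmap_eq_fderiv hfd.self_of_nhds).symm
  simp only [Function.comp_apply, hxx, hdf] at hderiv
  exact hderiv

lemma secondForm_null (hw : w (f x).2 ≠ 0)
    (h : AdaptedFrame (f x).1 (screenMap w f x (ζ x)) (ζ x)) (hD : IsWeingarten w f ζ x D)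
    (u v : EuclideanSpace ℝ (Fin n)) :
    secondForm w f x (ζ x, w (f x).2) u v = -(w (f x).2 ^ 2 *
      (form c n (screenMap w f x (ζ x) v) (screenMap w f x (ζ x) (D u)) +
        deriv w (f x).2 * form c n (screenMap w f x (ζ x) v) (screenMap w f x (ζ x) u))) := by
  have hddmap := snd_ddmap_eq hf hζ hwd hrel u v
  have hmetric := h.warpedMetric_dmap hw v u
  have hinv : w (f x).2 * (w (f x).2)⁻¹ = 1 := mul_inv_cancel₀ hw
  rw [hD.form_dmap h, h.form_fst] at hddmap
  rw [warpedMetric] at hmetric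
  rw [secondForm, christoffel_warpedMetric _ _ _ hwd, form_comm c n (dmap f x u).1 (dmap f x v).1]
  simp only [warpedMetric, h.form_fst]
  linear_combination -w (f x).2 * hddmap - deriv w (f x).2 * hmetric +
    deriv w (f x).2 * (dmap f x u).2 * (dmap f x v).2 * hinv

lemma sum_gram_inv_mul_secondForm_null (hw : w (f x).2 ≠ 0)
    (h : AdaptedFrame (f x).1 (screenMap w f x (ζ x)) (ζ x)) (hD : IsWeingarten w f ζ x D) :
    ∑ i, ∑ j, (gram w f x)⁻¹ i j * secondForm w f x (ζ x, w (f x).2)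
      (EuclideanSpace.single i 1) (EuclideanSpace.single j 1) =
      -(LinearMap.trace ℝ _ D + n * deriv w (f x).2) := by
  let b := (EuclideanSpace.basisFun (Fin n) ℝ).toBasis
  let g : LinearMap.BilinForm ℝ (EuclideanSpace ℝ (Fin n)) :=
    (warpedForm w (f x)).compl₁₂ (dmap f x).toLinearMap (dmap f x).toLinearMap
  have hg : ∀ u v, g u v =
      w (f x).2 ^ 2 * form c n (screenMap w f x (ζ x) u) (screenMap w f x (ζ x) v) :=
    h.warpedMetric_dmap hw
  have hb : ∀ i, b i = EuclideanSpace.single i 1 := fun i => by simp [b]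
  have hgram : gram w f x = LinearMap.BilinForm.toMatrix b g := by
    ext i j
    rw [LinearMap.BilinForm.toMatrix_apply, hb, hb]
    rfl
  let T : Module.End ℝ (EuclideanSpace ℝ (Fin n)) := D + deriv w (f x).2 • LinearMap.id
  have hsecond : ∀ i j, secondForm w f x (ζ x, w (f x).2) (EuclideanSpace.single i 1)
      (EuclideanSpace.single j 1) = -g (b j) (T (b i)) := by
    intro i j
    rw [secondForm_null hf hζ hwd hrel hw h hD, hg, hb, hb]
    simp only [T, LinearMap.add_apply, LinearMap.smul_apply, LinearMap.id_apply, map_add,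
      map_smul, form_add_right, form_smul_right]
  have htrace := sum_inv_toMatrix_mul_eq_trace b
    (nondegenerate_of_pos (g := g) fun v hv => h.warpedMetric_dmap_pos hw hv) T
  rw [map_add, map_smul, LinearMap.trace_id, finrank_euclideanSpace_fin, smul_eq_mul,
    mul_comm] at htrace
  simp only [hgram, hsecond, mul_neg, Finset.sum_neg_distrib, htrace]

lemma mul_warpedMetric_meanCurvatureVector (hn : n ≠ 0) (hw : w (f x).2 ≠ 0)
    (h : AdaptedFrame (f x).1 (screenMap w f x (ζ x)) (ζ x)) (hD : IsWeingarten w f ζ x D) :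
    n * warpedMetric c n w (f x) (meanCurvatureVector w f x) (ζ x, w (f x).2) =
      -(LinearMap.trace ℝ _ D + n * deriv w (f x).2) := by
  rw [(meanCurvatureVector_spec h.mem hw hwd h.tangent_fst
    fun v hv => h.warpedMetric_dmap_pos hw hv).2 _ h.isNormalAt,
    sum_gram_inv_mul_secondForm_null hf hζ hwd hrel hw h hD]
  field_simp

lemma exists_meanCurvatureVector_eq_smul_iff (hn : n ≠ 0) (hw : w (f x).2 ≠ 0)
    (h : AdaptedFrame (f x).1 (screenMap w f x (ζ x)) (ζ x)) (hD : IsWeingarten w f ζ x D) :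
    (∃ a : ℝ, meanCurvatureVector w f x = a • (ζ x, w (f x).2)) ↔
      LinearMap.trace ℝ _ D + n * deriv w (f x).2 = 0 := by
  have hnormal := (meanCurvatureVector_spec h.mem hw hwd h.tangent_fst
    fun v hv => h.warpedMetric_dmap_pos hw hv).1
  have hH := mul_warpedMetric_meanCurvatureVector hf hζ hwd hrel hn hw h hD
  constructor
  · rintro ⟨a, ha⟩
    rw [ha, warpedMetric_smul_left, warpedMetric_null _ h.unit rfl] at hH
    linarith
  · intro h0
    rw [h0, neg_zero] at hH
    exact ⟨_, h.eq_smul_null hw hnormal ((mul_eq_zero.1 hH).resolve_left (Nat.cast_ne_zero.2 hn))⟩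

end SecondForm

end Weingarten

section Theta

variable {I : Set ℝ} {w : ℝ → ℝ} {t₀ t : ℝ}

lemma intervalIntegrable_one_div (hI' : I.OrdConnected) (hw : ContinuousOn w I)
    (hw0 : ∀ t ∈ I, w t ≠ 0) (h₀ : t₀ ∈ I) (ht : t ∈ I) :
    IntervalIntegrable (fun s => 1 / w s) MeasureTheory.volume t₀ t :=
  ((continuousOn_const.div hw hw0).mono (hI'.uIcc_subset h₀ ht)).intervalIntegrable

lemma hasDerivAt_theta (hI : IsOpen I) (hI' : I.OrdConnected) (hw : ContinuousOn w I)
    (hw0 : ∀ t ∈ I, w t ≠ 0) (h₀ : t₀ ∈ I) (ht : t ∈ I) :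
    HasDerivAt (theta w t₀) (w t)⁻¹ t := by
  have hc : ContinuousOn (fun s => 1 / w s) I := continuousOn_const.div hw hw0
  rw [← one_div]
  exact intervalIntegral.integral_hasDerivAt_right (intervalIntegrable_one_div hI' hw hw0 h₀ ht)
    (hc.stronglyMeasurableAtFilter hI t ht) (hc.continuousAt (hI.mem_nhds ht))

lemma hasDerivAt_theta_left (hI : IsOpen I) (hI' : I.OrdConnected) (hw : ContinuousOn w I)
    (hw0 : ∀ t ∈ I, w t ≠ 0) (h₀ : t₀ ∈ I) (ht : t ∈ I) :
    HasDerivAt (fun s => theta w s t) (-(w t₀)⁻¹) t₀ := by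
  have hc : ContinuousOn (fun s => 1 / w s) I := continuousOn_const.div hw hw0
  rw [← one_div]
  exact intervalIntegral.integral_hasDerivAt_left (intervalIntegrable_one_div hI' hw hw0 h₀ ht)
    (hc.stronglyMeasurableAtFilter hI t₀ h₀) (hc.continuousAt (hI.mem_nhds h₀))

lemma contDiffOn_theta {k : ℕ∞} (hI : IsOpen I) (hI' : I.OrdConnected) (hw : ContDiffOn ℝ k w I)
    (hw0 : ∀ t ∈ I, w t ≠ 0) (h₀ : t₀ ∈ I) : ContDiffOn ℝ (k + 1) (theta w t₀) I := by
  have hderiv : ∀ t ∈ I, HasDerivAt (theta w t₀) (w t)⁻¹ t := fun t ht =>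
    hasDerivAt_theta hI hI' hw.continuousOn hw0 h₀ ht
  rw [contDiffOn_succ_iff_deriv_of_isOpen hI]
  exact ⟨fun t ht => (hderiv t ht).differentiableAt.differentiableWithinAt,
    fun hk => absurd hk (by simp), (hw.inv hw0).congr fun t ht => (hderiv t ht).deriv⟩

end Theta

section Rotation

variable {n : ℕ} {c : SignType}

section Vector

variable {X : Type*} [NormedAddCommGroup X] [NormedSpace ℝ X] {s : X → ℝ} {g h : X → Amb c n}
  {x : X} {s' : X →L[ℝ] ℝ} {g' h' : X →L[ℝ] Amb c n}

lemma hasFDerivAt_rot (hs : HasFDerivAt s s' x) (hg : HasFDerivAt g g' x)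
    (hh : HasFDerivAt h h' x) :
    HasFDerivAt (fun y => rot c (s y) (g y) (h y))
      (co c (s x) • g' + si c (s x) • h' + s'.smulRight (rotNormal c (s x) (g x) (h x))) x := by
  have hco : HasFDerivAt (fun y => co c (s y)) _ x :=
    (hasDerivAt_co c (s x)).comp_hasFDerivAt x hs
  have hsi : HasFDerivAt (fun y => si c (s y)) _ x :=
    (hasDerivAt_si c (s x)).comp_hasFDerivAt x hs
  refine ((hco.smul hg).add (hsi.smul hh)).congr_fderiv (ContinuousLinearMap.ext fun v => ?_)
  simp only [rotNormal, add_apply, smul_apply, ContinuousLinearMap.smulRight_apply, smul_eq_mul]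
  module

lemma hasFDerivAt_rotNormal (hs : HasFDerivAt s s' x) (hg : HasFDerivAt g g' x)
    (hh : HasFDerivAt h h' x) :
    HasFDerivAt (fun y => rotNormal c (s y) (g y) (h y))
      (-((c : ℝ) * si c (s x)) • g' + co c (s x) • h' -
        ((c : ℝ) • s').smulRight (rot c (s x) (g x) (h x))) x := by
  have hco : HasFDerivAt (fun y => co c (s y)) _ x :=
    (hasDerivAt_co c (s x)).comp_hasFDerivAt x hs
  have hsi : HasFDerivAt (fun y => -((c : ℝ) * si c (s y))) _ x :=
    (((hasDerivAt_si c (s x)).comp_hasFDerivAt x hs).const_mul (c : ℝ)).neg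
  refine ((hsi.smul hg).add (hco.smul hh)).congr_fderiv (ContinuousLinearMap.ext fun v => ?_)
  simp only [rot, add_apply, sub_apply, neg_apply, smul_apply, ContinuousLinearMap.smulRight_apply,
    smul_eq_mul]
  module

end Vector

variable {M : Type*} [TopologicalSpace M] [ChartedSpace (EuclideanSpace ℝ (Fin n)) M]
  {x : M} {s : M → ℝ} {g h : M → Amb c n}

lemma contMDiffAt_rot {k : ℕ∞ω} (hs : ContMDiffAt (𝓡 n) 𝓘(ℝ, ℝ) k s x)
    (hg : ContMDiffAt (𝓡 n) 𝓘(ℝ, Amb c n) k g x) (hh : ContMDiffAt (𝓡 n) 𝓘(ℝ, Amb c n) k h x) :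
    ContMDiffAt (𝓡 n) 𝓘(ℝ, Amb c n) k (fun y => rot c (s y) (g y) (h y)) x :=
  (((contDiff_co c).comp_contMDiffAt hs).smul hg).add
    (((contDiff_si c).comp_contMDiffAt hs).smul hh)

lemma contMDiffAt_rotNormal {k : ℕ∞ω} (hs : ContMDiffAt (𝓡 n) 𝓘(ℝ, ℝ) k s x)
    (hg : ContMDiffAt (𝓡 n) 𝓘(ℝ, Amb c n) k g x) (hh : ContMDiffAt (𝓡 n) 𝓘(ℝ, Amb c n) k h x) :
    ContMDiffAt (𝓡 n) 𝓘(ℝ, Amb c n) k (fun y => rotNormal c (s y) (g y) (h y)) x :=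
  (((contDiff_const.mul (contDiff_si c)).neg.comp_contMDiffAt hs).smul hg).add
    (((contDiff_co c).comp_contMDiffAt hs).smul hh)

section Differential

variable (hs : MDifferentiableAt (𝓡 n) 𝓘(ℝ, ℝ) s x)
  (hg : MDifferentiableAt (𝓡 n) 𝓘(ℝ, Amb c n) g x)
  (hh : MDifferentiableAt (𝓡 n) 𝓘(ℝ, Amb c n) h x)

include hs hg hh

lemma mdifferentiableAt_rot :
    MDifferentiableAt (𝓡 n) 𝓘(ℝ, Amb c n) (fun y => rot c (s y) (g y) (h y)) x :=
  ((((contDiff_co c).differentiable one_ne_zero).differentiableAt.comp_mdifferentiableAt hs).smul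
    hg).add ((((contDiff_si c).differentiable one_ne_zero).differentiableAt.comp_mdifferentiableAt
      hs).smul hh)

lemma mdifferentiableAt_rotNormal :
    MDifferentiableAt (𝓡 n) 𝓘(ℝ, Amb c n) (fun y => rotNormal c (s y) (g y) (h y)) x :=
  (((((contDiff_const.mul (contDiff_si c)).neg.differentiable
    one_ne_zero).differentiableAt.comp_mdifferentiableAt hs).smul hg).add
    ((((contDiff_co c).differentiable one_ne_zero).differentiableAt.comp_mdifferentiableAt
      hs).smul hh))

lemma dmap_rot (v : EuclideanSpace ℝ (Fin n)) :
    dmap (fun y => rot c (s y) (g y) (h y)) x v = co c (s x) • dmap g x v + si c (s x) • dmap h x v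
      + dmap s x v • rotNormal c (s x) (g x) (h x) := by
  rw [dmap_eq_of_hasFDerivAt (mdifferentiableAt_rot hs hg hh).continuousAt (hasFDerivAt_rot
    (hasFDerivAt_chart hs) (hasFDerivAt_chart hg) (hasFDerivAt_chart hh))]
  simp

lemma dmap_rotNormal (v : EuclideanSpace ℝ (Fin n)) :
    dmap (fun y => rotNormal c (s y) (g y) (h y)) x v =
      -((c : ℝ) * si c (s x)) • dmap g x v + co c (s x) • dmap h x v
      - ((c : ℝ) * dmap s x v) • rot c (s x) (g x) (h x) := by
  rw [dmap_eq_of_hasFDerivAt (mdifferentiableAt_rotNormal hs hg hh).continuousAt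
    (hasFDerivAt_rotNormal (hasFDerivAt_chart hs) (hasFDerivAt_chart hg) (hasFDerivAt_chart hh))]
  simp

end Differential

lemma dmap_comp_of_hasDerivAt {θ : ℝ → ℝ} {θ' : ℝ} (hs : MDifferentiableAt (𝓡 n) 𝓘(ℝ, ℝ) s x)
    (hθ : HasDerivAt θ θ' (s x)) (v : EuclideanSpace ℝ (Fin n)) :
    dmap (fun y => θ (s y)) x v = θ' * dmap s x v := by
  have hθ' : HasDerivAt θ θ' ((s ∘ (extChartAt (𝓡 n) x).symm) (extChartAt (𝓡 n) x x)) := by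
    simpa using hθ
  rw [dmap_eq_of_hasFDerivAt (f := fun y => θ (s y)) (hθ.continuousAt.comp hs.continuousAt)
    (hθ'.comp_hasFDerivAt _ (hasFDerivAt_chart hs))]
  rfl

end Rotation

section Hypersurface

variable {n : ℕ} {M : Type*} [TopologicalSpace M] [ChartedSpace (EuclideanSpace ℝ (Fin n)) M]
  {c : SignType} {U : Set M} {φ ν : M → Amb c n} {x : M}

namespace IsHypersurface

lemma contMDiffAt (h : IsHypersurface c U φ ν) (hU : IsOpen U) (hx : x ∈ U) :
    ContMDiffAt (𝓡 n) 𝓘(ℝ, Amb c n) 4 φ x :=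
  h.contMDiffOn.contMDiffAt (hU.mem_nhds hx)

lemma mdifferentiableAt (h : IsHypersurface c U φ ν) (hU : IsOpen U) (hx : x ∈ U) :
    MDifferentiableAt (𝓡 n) 𝓘(ℝ, Amb c n) φ x :=
  (h.contMDiffAt hU hx).mdifferentiableAt (by norm_num)

lemma adaptedFrame (h : IsHypersurface c U φ ν) (hU : IsOpen U) (hx : x ∈ U) :
    AdaptedFrame (φ x) (dmap φ x) (ν x) :=
  ⟨⟨h.mem x hx, h.immersion x hx,
    sign_mul_form_dmap_self (h.mdifferentiableAt hU hx)
      (Filter.eventually_of_mem (hU.mem_nhds hx) h.mem)⟩,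
    h.normal x hx, h.tangent x hx, h.unit x hx⟩

variable [IsManifold (𝓡 n) 1 M]

lemma contMDiffAt_normal (h : IsHypersurface c U φ ν) (hU : IsOpen U) (hx : x ∈ U) :
    ContMDiffAt (𝓡 n) 𝓘(ℝ, Amb c n) 3 ν x := by
  have hxU : ∀ᶠ y in 𝓝 x, y ∈ U := hU.mem_nhds hx
  refine contMDiffAt_unit_field (m := 4) (g := φ) (h := fun _ => 0) (τ := fun _ => 0) (by norm_num)
    (by norm_num) (hxU.mono fun y hy => h.contMDiffAt hU hy)
    (Filter.Eventually.of_forall fun y => contMDiffAt_const) contMDiffAt_const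
    (h.continuousOn.continuousAt (hU.mem_nhds hx)) (hxU.mono fun y hy v => ?_)
    (hxU.mono h.tangent) (hxU.mono h.unit) fun W hframe htangent hnormal => ?_
  · rw [h.normal y hy, zero_mul]
  · exact (h.adaptedFrame hU hx).eq_zero htangent (by rw [form_comm, hnormal]) hframe

lemma mdifferentiableAt_normal (h : IsHypersurface c U φ ν) (hU : IsOpen U) (hx : x ∈ U) :
    MDifferentiableAt (𝓡 n) 𝓘(ℝ, Amb c n) ν x :=
  (h.contMDiffAt_normal hU hx).mdifferentiableAt (by norm_num)

lemma dmap_normal (h : IsHypersurface c U φ ν) (hU : IsOpen U) (hx : x ∈ U)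
    (v : EuclideanSpace ℝ (Fin n)) : dmap ν x v = -dmap φ x (shapeOperator φ ν x v) := by
  have hxU : ∀ᶠ y in 𝓝 x, y ∈ U := hU.mem_nhds hx
  have hφ := h.mdifferentiableAt hU hx
  have hν := h.mdifferentiableAt_normal hU hx
  have htangent : ∀ v : EuclideanSpace ℝ (Fin n),
      (c : ℝ) * form c n (φ x) ((-dmap ν x) v) = 0 := by
    intro v
    have hderiv := mul_form_dmap_add_eq_zero hφ hν (hxU.mono h.tangent) v
    rw [neg_apply, form_neg_right]
    linear_combination -hderiv + (c : ℝ) * h.normal x hx v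
  have hnormal : ∀ v : EuclideanSpace ℝ (Fin n), form c n ((-dmap ν x) v) (ν x) = 0 := by
    intro v
    have hderiv := mul_form_dmap_add_eq_zero (s := 1) hν hν
      (hxU.mono fun y hy => by rw [h.unit y hy, one_mul]) v
    rw [form_comm c n (ν x)] at hderiv
    rw [neg_apply, form_neg_left]
    linear_combination -(1 / 2) * hderiv
  obtain ⟨A, hA⟩ := (h.adaptedFrame hU hx).exists_factor (-dmap ν x) htangent hnormal
  have hex : ∃ A : Module.End ℝ (EuclideanSpace ℝ (Fin n)), ∀ v, dmap ν x v = -dmap φ x (A v) :=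
    ⟨A, fun v => by rw [← hA, neg_apply, neg_neg]⟩
  exact Classical.epsilon_spec hex v

lemma form_dmap_dmap_normal (h : IsHypersurface c U φ ν) (hU : IsOpen U) (hx : x ∈ U)
    (u v : EuclideanSpace ℝ (Fin n)) :
    form c n (dmap φ x v) (dmap ν x u) = -form c n (ddmap φ x u v) (ν x) := by
  set χ := extChartAt (𝓡 n) x with hχ
  have hφ : DifferentiableAt ℝ (fderiv ℝ (φ ∘ χ.symm)) (χ x) :=
    ((contDiffAt_chart (h.contMDiffAt hU hx)).fderiv_right (m := 1)
      (by norm_num)).differentiableAt one_ne_zero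
  have hφv : HasFDerivAt (fun q => fderiv ℝ (φ ∘ χ.symm) q v)
      ((fderiv ℝ (fderiv ℝ (φ ∘ χ.symm)) (χ x)).flip v) (χ x) :=
    (hφ.hasFDerivAt.clm_apply (hasFDerivAt_const v (χ x))).congr_fderiv (by
      rw [ContinuousLinearMap.comp_zero, zero_add])
  have hνx := hasFDerivAt_chart (h.mdifferentiableAt_normal hU hx)
  have hnormal : (fun _ => (0 : ℝ)) =ᶠ[𝓝 (χ x)] fun q =>
      formL c n (fderiv ℝ (φ ∘ χ.symm) q v) ((ν ∘ χ.symm) q) := by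
    filter_upwards [eventually_fderiv_chart_eq x, eventually_chart.2 (hU.mem_nhds hx)]
      with q ⟨T, hT⟩ hq
    rw [hT _ φ (h.mdifferentiableAt hU hq)]
    exact (h.normal _ hq (T v)).symm
  have hderiv := DFunLike.congr_fun ((((formL c n).hasFDerivAt_of_bilinear hφv
    hνx).congr_of_eventuallyEq hnormal).unique (hasFDerivAt_const 0 _)) u
  simp only [Function.comp_apply, hχ, extChartAt_to_inv,
    ← dmap_eq_fderiv (h.mdifferentiableAt hU hx)] at hderiv
  exact eq_neg_of_add_eq_zero_left hderiv

lemma form_dmap_shapeOperator (h : IsHypersurface c U φ ν) (hU : IsOpen U) (hx : x ∈ U)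
    (u v : EuclideanSpace ℝ (Fin n)) :
    form c n (dmap φ x (shapeOperator φ ν x u)) (dmap φ x v) = form c n (ddmap φ x u v) (ν x) := by
  rw [form_comm, ← neg_inj, ← form_neg_right, ← h.dmap_normal hU hx,
    h.form_dmap_dmap_normal hU hx]

lemma shapeOperator_symm (h : IsHypersurface c U φ ν) (hU : IsOpen U) (hx : x ∈ U)
    (u v : EuclideanSpace ℝ (Fin n)) :
    form c n (dmap φ x (shapeOperator φ ν x u)) (dmap φ x v) =
      form c n (dmap φ x u) (dmap φ x (shapeOperator φ ν x v)) := by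
  have hsymm : ddmap φ x u v = ddmap φ x v u :=
    (contDiffAt_chart (h.contMDiffAt hU hx)).isSymmSndFDerivAt (by simp; norm_num) u v
  rw [form_comm c n (dmap φ x u), h.form_dmap_shapeOperator hU hx, h.form_dmap_shapeOperator hU hx,
    hsymm]

end IsHypersurface

end Hypersurface

section FocalOperator

variable {V : Type*} [AddCommGroup V] [Module ℝ V] {c : SignType} {s : ℝ} {A : Module.End ℝ V}

/-- The endomorphism `co(s) - si(s) A`. If `A` is the shape operator of a hypersurface `φ`, then
`dφ` composed with it is the differential of the parallel hypersurface at distance `s`, which has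
a singularity where it is not injective. -/
def focalOperator (c : SignType) (s : ℝ) (A : Module.End ℝ V) : Module.End ℝ V :=
  co c s • LinearMap.id - si c s • A

lemma focalOperator_apply (v : V) : focalOperator c s A v = co c s • v - si c s • A v := rfl

lemma focalOperator_apply_of_mem_eigenspace {κ : ℝ} {v : V} (hv : v ∈ A.eigenspace κ) :
    focalOperator c s A v = (co c s - si c s * κ) • v := by
  rw [focalOperator_apply, Module.End.mem_eigenspace_iff.1 hv, smul_smul, sub_smul]

lemma co_ne_zero_of_si_eq_zero (hs : si c s = 0) : co c s ≠ 0 := by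
  intro h
  simpa [hs, h] using co_sq_add_si_sq c s

lemma co_sub_si_mul_eq_zero_iff {κ : ℝ} :
    co c s - si c s * κ = 0 ↔ si c s ≠ 0 ∧ ct c s = κ := by
  by_cases hs : si c s = 0
  · simp [hs, co_ne_zero_of_si_eq_zero hs]
  · rw [ct, div_eq_iff hs, sub_eq_zero, mul_comm]
    exact (and_iff_right hs).symm

lemma injective_focalOperator_iff : Function.Injective (focalOperator c s A) ↔
    ∀ κ : Module.End.Eigenvalues A, si c s = 0 ∨ ct c s ≠ (κ : ℝ) := by
  rw [injective_iff_map_eq_zero]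
  constructor
  · rintro hinj ⟨κ, hκA⟩
    by_contra! hκ
    obtain ⟨v, hv, hv0⟩ := Module.End.HasEigenvalue.exists_hasEigenvector hκA
    have hzero : co c s - si c s * κ = 0 := co_sub_si_mul_eq_zero_iff.2 hκ
    exact hv0 (hinj v (by rw [focalOperator_apply_of_mem_eigenspace hv, hzero, zero_smul]))
  · intro hfocal v hv
    by_contra hv0
    rw [focalOperator_apply] at hv
    have hs : si c s ≠ 0 := by
      intro hs
      rw [hs, zero_smul, sub_zero, smul_eq_zero] at hv
      exact hv.elim (co_ne_zero_of_si_eq_zero hs) hv0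
    have hA : A v = ct c s • v := by
      rw [ct, div_eq_inv_mul, mul_smul, sub_eq_zero.1 hv, smul_smul, inv_mul_cancel₀ hs, one_smul]
    have hκ : Module.End.HasEigenvalue A (ct c s) :=
      Module.End.hasEigenvalue_of_hasEigenvector ⟨Module.End.mem_eigenspace_iff.2 hA, hv0⟩
    exact (hfocal ⟨_, hκ⟩).elim hs fun hne => hne rfl

lemma curvTerm_mul_co_sub {κ : ℝ} (hκ : co c s - si c s * κ ≠ 0) :
    curvTerm c κ s * (co c s - si c s * κ) = c * si c s + co c s * κ := by
  by_cases hs : si c s = 0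
  · simp [curvTerm, hs, mul_comm]
  · have hct : co c s / si c s - κ ≠ 0 := by
      rwa [div_sub' hs, div_ne_zero_iff, and_iff_left hs]
    rw [curvTerm, if_neg hs, ct, div_mul_eq_mul_div, div_eq_iff hct]
    field_simp
    ring

lemma trace_eq_sum_curvTerm [FiniteDimensional ℝ V]
    (hA : DirectSum.IsInternal fun κ : Module.End.Eigenvalues A => A.eigenspace (κ : ℝ))
    (hinj : Function.Injective (focalOperator c s A)) {K : Module.End ℝ V}
    (hK : ∀ v, focalOperator c s A (K v) = ((c : ℝ) * si c s) • v + co c s • A v) :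
    LinearMap.trace ℝ V K = ∑ κ : Module.End.Eigenvalues A,
      Module.finrank ℝ (A.eigenspace (κ : ℝ)) * curvTerm c κ s := by
  refine trace_eq_sum_eigenvalues hA (q := fun κ => curvTerm c κ s) fun κ v hv => ?_
  rcases eq_or_ne v 0 with rfl | hv0
  · rw [map_zero, smul_zero]
  have hκ : co c s - si c s * κ ≠ 0 := by
    intro h0
    refine hv0 (hinj ?_)
    rw [focalOperator_apply_of_mem_eigenspace hv, h0, zero_smul, map_zero]
  apply hinj
  rw [hK, map_smul, focalOperator_apply_of_mem_eigenspace hv, smul_smul, curvTerm_mul_co_sub hκ,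
    Module.End.mem_eigenspace_iff.1 hv, smul_smul, add_smul]

end FocalOperator

section PhiBar

variable {n : ℕ} {M : Type*} {c : SignType} {φ ν : M → Amb c n} {x : M} {w : ℝ → ℝ} {t₀ : ℝ}
  {τ : M → ℝ}

lemma phiBar_fst : (phiBar w t₀ φ ν τ x).1 = rot c (theta w t₀ (τ x)) (φ x) (ν x) := rfl

lemma phiBar_snd : (phiBar w t₀ φ ν τ x).2 = τ x := rfl

lemma nuBar_eq :
    nuBar w t₀ φ ν τ x = (rotNormal c (theta w t₀ (τ x)) (φ x) (ν x), w (τ x)) := rfl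

variable [TopologicalSpace M] [ChartedSpace (EuclideanSpace ℝ (Fin n)) M] {U : Set M}

namespace IsHypersurface

variable (h : IsHypersurface c U φ ν)

include h

lemma phiBar_fst_mem (hx : x ∈ U) : (phiBar w t₀ φ ν τ x).1 ∈ spaceForm c n :=
  rot_mem (h.mem x hx) (h.tangent x hx) (h.unit x hx) _

lemma form_dmap_rotNormal (hU : IsOpen U) (hx : x ∈ U) (s : ℝ) (v : EuclideanSpace ℝ (Fin n)) :
    form c n (dmap φ x v) (rotNormal c s (φ x) (ν x)) = 0 := by
  rw [rotNormal, form_add_right, form_smul_right, form_smul_right, h.normal x hx, form_comm]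
  linear_combination (-si c s) * (h.adaptedFrame hU hx).tangent v

variable [IsManifold (𝓡 n) 1 M] (hU : IsOpen U) (hx : x ∈ U)

include hU hx

lemma isInternal_eigenspace_shapeOperator :
    DirectSum.IsInternal fun κ : Module.End.Eigenvalues (shapeOperator φ ν x) =>
      (shapeOperator φ ν x).eigenspace (κ : ℝ) :=
  isInternal_eigenspace_of_posDef (g := (inducedForm (dmap φ x)).toLinearMap₁₂)
    (fun _ _ => form_comm c n _ _) (fun _ hv => (h.adaptedFrame hU hx).pos hv)
    (h.shapeOperator_symm hU hx)

lemma contMDiffAt_phiBar {k : ℕ∞ω} (hk : k ≤ 3) (hτ : ContMDiffAt (𝓡 n) 𝓘(ℝ, ℝ) k τ x)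
    (hθ : ContDiffAt ℝ k (theta w t₀) (τ x)) :
    ContMDiffAt (𝓡 n) 𝓘(ℝ, Amb c n × ℝ) k (phiBar w t₀ φ ν τ) x :=
  (contMDiffAt_rot (hθ.comp_contMDiffAt hτ) ((h.contMDiffAt hU hx).of_le (hk.trans (by norm_num)))
    ((h.contMDiffAt_normal hU hx).of_le hk)).prodMk_space hτ

section Differential

variable (hτ : MDifferentiableAt (𝓡 n) 𝓘(ℝ, ℝ) τ x)
  (hθ : HasDerivAt (theta w t₀) (w (τ x))⁻¹ (τ x))

include hτ hθ

lemma mdifferentiableAt_phiBar :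
    MDifferentiableAt (𝓡 n) 𝓘(ℝ, Amb c n × ℝ) (phiBar w t₀ φ ν τ) x :=
  (mdifferentiableAt_rot (hθ.differentiableAt.comp_mdifferentiableAt hτ)
    (h.mdifferentiableAt hU hx) (h.mdifferentiableAt_normal hU hx)).prodMk_space hτ

lemma dmap_phiBar (v : EuclideanSpace ℝ (Fin n)) : dmap (phiBar w t₀ φ ν τ) x v =
    (dmap φ x (focalOperator c (theta w t₀ (τ x)) (shapeOperator φ ν x) v) +
      ((w (τ x))⁻¹ * dmap τ x v) • rotNormal c (theta w t₀ (τ x)) (φ x) (ν x), dmap τ x v) := by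
  have hd := h.mdifferentiableAt_phiBar hU hx hτ hθ
  refine Prod.ext ?_ (dmap_snd hd v).symm
  have hrot := dmap_rot (hθ.differentiableAt.comp_mdifferentiableAt hτ) (h.mdifferentiableAt hU hx)
    (h.mdifferentiableAt_normal hU hx) v
  rw [← dmap_fst hd]
  refine hrot.trans ?_
  rw [Function.comp_def, dmap_comp_of_hasDerivAt hτ hθ, h.dmap_normal hU hx, focalOperator_apply,
    map_sub, map_smul, map_smul]
  module

lemma screenMap_phiBar (v : EuclideanSpace ℝ (Fin n)) :
    screenMap w (phiBar w t₀ φ ν τ) x (rotNormal c (theta w t₀ (τ x)) (φ x) (ν x)) v =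
      dmap φ x (focalOperator c (theta w t₀ (τ x)) (shapeOperator φ ν x) v) := by
  rw [screenMap_apply, h.dmap_phiBar hU hx hτ hθ, phiBar_snd]
  exact add_sub_cancel_right _ _

lemma form_dmap_phiBar (hw : w (τ x) ≠ 0) (v : EuclideanSpace ℝ (Fin n)) :
    w (τ x) * form c n (dmap (phiBar w t₀ φ ν τ) x v).1
      (rotNormal c (theta w t₀ (τ x)) (φ x) (ν x)) = (dmap (phiBar w t₀ φ ν τ) x v).2 := by
  rw [h.dmap_phiBar hU hx hτ hθ, form_add_left, form_smul_left, h.form_dmap_rotNormal hU hx,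
    form_rotNormal_self (h.mem x hx) (h.tangent x hx) (h.unit x hx), zero_add, mul_one,
    mul_inv_cancel_left₀ hw]

lemma isNormalAt_nuBar (hw : w (τ x) ≠ 0) :
    IsNormalAt w (phiBar w t₀ φ ν τ) x (nuBar w t₀ φ ν τ x) := by
  refine ⟨form_rot_rotNormal (h.mem x hx) (h.tangent x hx) (h.unit x hx) _, fun v => ?_⟩
  rw [nuBar_eq, warpedMetric, phiBar_snd]
  linear_combination w (τ x) * h.form_dmap_phiBar hU hx hτ hθ hw v

lemma sign_mul_form_dmap_phiBar (v : EuclideanSpace ℝ (Fin n)) :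
    (c : ℝ) * form c n (phiBar w t₀ φ ν τ x).1 (dmap (phiBar w t₀ φ ν τ) x v).1 = 0 := by
  have hd := h.mdifferentiableAt_phiBar hU hx hτ hθ
  rw [← dmap_fst hd]
  exact sign_mul_form_dmap_self (mdifferentiableAt_clm (ContinuousLinearMap.fst ℝ (Amb c n) ℝ) hd)
    (Filter.eventually_of_mem (hU.mem_nhds hx) fun y hy => h.phiBar_fst_mem hy) v

lemma adaptedFrame_screenMap_phiBar (hw : w (τ x) ≠ 0) (hinj : Function.Injective
      (focalOperator c (theta w t₀ (τ x)) (shapeOperator φ ν x))) :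
    AdaptedFrame (phiBar w t₀ φ ν τ x).1
      (screenMap w (phiBar w t₀ φ ν τ) x (rotNormal c (theta w t₀ (τ x)) (φ x) (ν x)))
      (rotNormal c (theta w t₀ (τ x)) (φ x) (ν x)) := by
  have hscreen := h.screenMap_phiBar hU hx hτ hθ
  have hN : (c : ℝ) * form c n (phiBar w t₀ φ ν τ x).1
      (rotNormal c (theta w t₀ (τ x)) (φ x) (ν x)) = 0 := (h.isNormalAt_nuBar hU hx hτ hθ hw).1
  refine ⟨⟨h.phiBar_fst_mem hx, fun u v huv => ?_, fun v => ?_⟩, fun v => ?_, hN,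
    form_rotNormal_self (h.mem x hx) (h.tangent x hx) (h.unit x hx) _⟩
  · rw [hscreen, hscreen] at huv
    exact hinj (h.immersion x hx huv)
  · rw [screenMap_apply, form_sub_right, form_smul_right]
    linear_combination h.sign_mul_form_dmap_phiBar hU hx hτ hθ v -
      (w (phiBar w t₀ φ ν τ x).2)⁻¹ * (dmap (phiBar w t₀ φ ν τ) x v).2 * hN
  · rw [hscreen, h.form_dmap_rotNormal hU hx]

lemma warpedMetric_dmap_phiBar_pos_iff (hw : w (τ x) ≠ 0) :
    (∀ v : EuclideanSpace ℝ (Fin n), v ≠ 0 → 0 < warpedMetric c n w (phiBar w t₀ φ ν τ x)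
      (dmap (phiBar w t₀ φ ν τ) x v) (dmap (phiBar w t₀ φ ν τ) x v)) ↔
      Function.Injective (focalOperator c (theta w t₀ (τ x)) (shapeOperator φ ν x)) := by
  constructor
  · intro hpos u v huv
    have hframe := adaptedFrame_screenMap (z := rotNormal c (theta w t₀ (τ x)) (φ x) (ν x))
      (h.phiBar_fst_mem hx) (h.sign_mul_form_dmap_phiBar hU hx hτ hθ) hw hpos
      (h.isNormalAt_nuBar hU hx hτ hθ hw)
      (form_rotNormal_self (h.mem x hx) (h.tangent x hx) (h.unit x hx) _)
    apply hframe.injective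
    rw [h.screenMap_phiBar hU hx hτ hθ, h.screenMap_phiBar hU hx hτ hθ, huv]
  · intro hinj v hv
    exact (h.adaptedFrame_screenMap_phiBar hU hx hτ hθ hw hinj).warpedMetric_dmap_pos hw hv

lemma isWeingarten_phiBar {K : Module.End ℝ (EuclideanSpace ℝ (Fin n))}
    (hK : ∀ v, focalOperator c (theta w t₀ (τ x)) (shapeOperator φ ν x) (K v) =
      ((c : ℝ) * si c (theta w t₀ (τ x))) • v + co c (theta w t₀ (τ x)) • shapeOperator φ ν x v) :
    IsWeingarten w (phiBar w t₀ φ ν τ) (fun y => rotNormal c (theta w t₀ (τ y)) (φ y) (ν y)) x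
      (-K) := by
  intro v
  have hrot := dmap_rotNormal (hθ.differentiableAt.comp_mdifferentiableAt hτ)
    (h.mdifferentiableAt hU hx) (h.mdifferentiableAt_normal hU hx) v
  simp only [Function.comp_def, dmap_comp_of_hasDerivAt hτ hθ] at hrot
  rw [h.screenMap_phiBar hU hx hτ hθ, hrot, h.dmap_phiBar hU hx hτ hθ, phiBar_snd, phiBar_fst,
    LinearMap.neg_apply, map_neg, hK, h.dmap_normal hU hx, map_neg, map_add, map_smul, map_smul]
  module

end Differential

lemma exists_meanCurvatureVector_phiBar_eq_smul_iff (hn : n ≠ 0)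
    (hτ : ContMDiffOn (𝓡 n) 𝓘(ℝ, ℝ) 2 τ U) (hθ : ContDiffAt ℝ 2 (theta w t₀) (τ x))
    (hθ' : ∀ y ∈ U, HasDerivAt (theta w t₀) (w (τ y))⁻¹ (τ y)) (hw : ∀ y ∈ U, w (τ y) ≠ 0)
    (hwd : DifferentiableAt ℝ w (τ x)) (hinj : Function.Injective
      (focalOperator c (theta w t₀ (τ x)) (shapeOperator φ ν x))) :
    (∃ a : ℝ, meanCurvatureVector w (phiBar w t₀ φ ν τ) x = a • nuBar w t₀ φ ν τ x) ↔
      n * deriv w (τ x) - ∑ κ : Module.End.Eigenvalues (shapeOperator φ ν x),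
        principalMultiplicity φ ν x κ * curvTerm c κ (theta w t₀ (τ x)) = 0 := by
  have hτd : ∀ y ∈ U, MDifferentiableAt (𝓡 n) 𝓘(ℝ, ℝ) τ y := fun y hy =>
    (hτ.contMDiffAt (hU.mem_nhds hy)).mdifferentiableAt (by norm_num)
  let S := LinearEquiv.ofInjectiveEndo _ hinj
  let K : Module.End ℝ (EuclideanSpace ℝ (Fin n)) := S.symm.toLinearMap ∘ₗ
    (((c : ℝ) * si c (theta w t₀ (τ x))) • LinearMap.id +
      co c (theta w t₀ (τ x)) • shapeOperator φ ν x)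
  have hK : ∀ v, focalOperator c (theta w t₀ (τ x)) (shapeOperator φ ν x) (K v) =
      ((c : ℝ) * si c (theta w t₀ (τ x))) • v +
        co c (theta w t₀ (τ x)) • shapeOperator φ ν x v := fun v => S.apply_symm_apply _
  have htrace := trace_eq_sum_curvTerm (h.isInternal_eigenspace_shapeOperator hU hx) hinj hK
  have hcollinear := exists_meanCurvatureVector_eq_smul_iff (f := phiBar w t₀ φ ν τ)
    (ζ := fun y => rotNormal c (theta w t₀ (τ y)) (φ y) (ν y))
    (h.contMDiffAt_phiBar hU hx (by norm_num) (hτ.contMDiffAt (hU.mem_nhds hx)) hθ)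
    (mdifferentiableAt_rotNormal
      ((hθ' x hx).differentiableAt.comp_mdifferentiableAt (hτd x hx))
      (h.mdifferentiableAt hU hx) (h.mdifferentiableAt_normal hU hx)) hwd
    (Filter.eventually_of_mem (hU.mem_nhds hx) fun y hy =>
      h.form_dmap_phiBar hU hy (hτd y hy) (hθ' y hy) (hw y hy)) hn (hw x hx)
    (h.adaptedFrame_screenMap_phiBar hU hx (hτd x hx) (hθ' x hx) (hw x hx) hinj)
    (h.isWeingarten_phiBar hU hx (hτd x hx) (hθ' x hx) hK)
  rw [nuBar_eq]
  refine hcollinear.trans ?_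
  rw [map_neg, htrace, neg_add_eq_sub]
  rfl

lemma mainEquation_iff (hn : n ≠ 0)
    (hτ : ContMDiffOn (𝓡 n) 𝓘(ℝ, ℝ) 2 τ U) (hθ : ContDiffAt ℝ 2 (theta w t₀) (τ x))
    (hθ' : ∀ y ∈ U, HasDerivAt (theta w t₀) (w (τ y))⁻¹ (τ y)) (hw : ∀ y ∈ U, w (τ y) ≠ 0)
    (hwd : DifferentiableAt ℝ w (τ x)) : MainEquation w t₀ φ ν τ x ↔
    (∀ v : EuclideanSpace ℝ (Fin n), v ≠ 0 → 0 < warpedMetric c n w (phiBar w t₀ φ ν τ x)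
      (dmap (phiBar w t₀ φ ν τ) x v) (dmap (phiBar w t₀ φ ν τ) x v)) ∧
    ∃ a : ℝ, meanCurvatureVector w (phiBar w t₀ φ ν τ) x = a • nuBar w t₀ φ ν τ x := by
  rw [MainEquation, ← injective_focalOperator_iff, h.warpedMetric_dmap_phiBar_pos_iff hU hx
    ((hτ.contMDiffAt (hU.mem_nhds hx)).mdifferentiableAt (by norm_num)) (hθ' x hx) (hw x hx)]
  exact and_congr_right fun hinj =>
    (h.exists_meanCurvatureVector_phiBar_eq_smul_iff hU hx hn hτ hθ hθ' hw hwd hinj).symm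

end IsHypersurface

end PhiBar

section Trapped

variable {n : ℕ} {M : Type*} [TopologicalSpace M] [ChartedSpace (EuclideanSpace ℝ (Fin n)) M]
  {c : SignType} {I : Set ℝ} {w : ℝ → ℝ}

theorem isMarginallyTrappedAlong_phiBar_iff [IsManifold (𝓡 n) 1 M] (hn : n ≠ 0) (hI : IsOpen I)
    (hI' : I.OrdConnected) (hw : ContDiffOn ℝ 1 w I) (hw0 : ∀ t ∈ I, w t ≠ 0) {t₀ : ℝ}
    (h₀ : t₀ ∈ I) {φ ν : M → Amb c n} {τ : M → ℝ} (h : IsHypersurface c univ φ ν)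
    (hτ : ContMDiff (𝓡 n) 𝓘(ℝ, ℝ) 2 τ) (hτI : ∀ x, τ x ∈ I) :
    (IsSpacelike c I w 2 univ (phiBar w t₀ φ ν τ) ∧
      IsMarginallyTrappedAlong w univ (phiBar w t₀ φ ν τ) (nuBar w t₀ φ ν τ)) ↔
        ∀ x, MainEquation w t₀ φ ν τ x := by
  have hτd : ∀ x, MDifferentiableAt (𝓡 n) 𝓘(ℝ, ℝ) τ x := fun x => hτ.mdifferentiable (by simp) x
  have hθ' : ∀ x, HasDerivAt (theta w t₀) (w (τ x))⁻¹ (τ x) := fun x =>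
    hasDerivAt_theta hI hI' hw.continuousOn hw0 h₀ (hτI x)
  have hθ : ∀ x, ContDiffAt ℝ 2 (theta w t₀) (τ x) := fun x =>
    (contDiffOn_theta hI hI' (k := 1) hw hw0 h₀).contDiffAt (hI.mem_nhds (hτI x))
  have hwτ : ∀ x, ContDiffAt ℝ 1 w (τ x) := fun x => hw.contDiffAt (hI.mem_nhds (hτI x))
  have hmain : ∀ x, MainEquation w t₀ φ ν τ x ↔ _ := fun x =>
    h.mainEquation_iff isOpen_univ (mem_univ x) hn hτ.contMDiffOn (hθ x) (fun y _ => hθ' y)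
      (fun y _ => hw0 _ (hτI y)) ((hwτ x).differentiableAt one_ne_zero)
  constructor
  · rintro ⟨hspacelike, htrapped⟩ x
    exact (hmain x).2 ⟨hspacelike.pos x (mem_univ x), htrapped.collinear x (mem_univ x)⟩
  · intro hM
    refine ⟨⟨fun x hx => ⟨h.phiBar_fst_mem hx, hτI x⟩, fun x hx =>
      (h.contMDiffAt_phiBar isOpen_univ hx (by norm_num) (hτ x) (hθ x)).contMDiffWithinAt,
      fun x _ => ((hmain x).1 (hM x)).1⟩, fun x hx => ?_, fun x _ hzero => ?_,
      fun x hx => h.isNormalAt_nuBar isOpen_univ hx (hτd x) (hθ' x) (hw0 _ (hτI x)),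
      fun x hx => ?_, fun x _ => ((hmain x).1 (hM x)).2⟩
    · have hrot := mdifferentiableAt_rotNormal
        ((hθ' x).differentiableAt.comp_mdifferentiableAt (hτd x))
        (h.mdifferentiableAt isOpen_univ hx) (h.mdifferentiableAt_normal isOpen_univ hx)
      exact (hrot.continuousAt.prodMk
        ((hwτ x).continuousAt.comp hτ.continuous.continuousAt)).continuousWithinAt
    · exact hw0 _ (hτI x) (congrArg Prod.snd hzero)
    · exact warpedMetric_null _ (form_rotNormal_self (h.mem x hx) (h.tangent x hx)
        (h.unit x hx) _) rfl

lemma IsMarginallyTrappedAlong.isMarginallyTrapped {U : Set M} {f N : M → Amb c n × ℝ}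
    (h : IsMarginallyTrappedAlong w U f N) : IsMarginallyTrapped w U f := by
  intro x hx
  obtain ⟨a, ha⟩ := h.collinear x hx
  rw [ha, warpedMetric_smul_left, warpedMetric_smul_right, h.null x hx, mul_zero, mul_zero]

end Trapped

section NullField

variable {n : ℕ} {M : Type*} [TopologicalSpace M] [ChartedSpace (EuclideanSpace ℝ (Fin n)) M]
  {c : SignType} {I : Set ℝ} {w : ℝ → ℝ}

/-- `(ζ, w ∘ τ)` is a continuous null normal field along the spacelike immersion `f = (f₁, τ)`.
Every null normal field is collinear to one of this form. -/
structure IsNullField (w : ℝ → ℝ) (V : Set M) (f : M → Amb c n × ℝ) (ζ : M → Amb c n) : Prop where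
  continuousOn : ContinuousOn ζ V
  frame : ∀ y ∈ V, AdaptedFrame (f y).1 (screenMap w f y (ζ y)) (ζ y)

lemma snd_ne_zero_of_null {p N : Amb c n × ℝ} (hp : p.1 ∈ spaceForm c n) (hw : w p.2 ≠ 0)
    (htangent : (c : ℝ) * form c n p.1 N.1 = 0) (hnull : warpedMetric c n w p N N = 0)
    (hN : N ≠ 0) : N.2 ≠ 0 := by
  intro hsnd
  rw [warpedMetric, hsnd, mul_zero, sub_zero, mul_eq_zero, or_iff_right (pow_ne_zero 2 hw)]
    at hnull
  have hfst : N.1 = 0 := by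
    by_contra hne
    exact (form_self_pos hp htangent hne).ne' hnull
  exact hN (Prod.ext hfst hsnd)

namespace IsSpacelike

variable {k : ℕ∞} {f : M → Amb c n × ℝ}

lemma contMDiffAt (hf : IsSpacelike c I w k univ f) (x : M) :
    ContMDiffAt (𝓡 n) 𝓘(ℝ, Amb c n × ℝ) k f x :=
  hf.contMDiffOn.contMDiffAt Filter.univ_mem

lemma mdifferentiableAt (hf : IsSpacelike c I w k univ f) (hk : k ≠ 0) (x : M) :
    MDifferentiableAt (𝓡 n) 𝓘(ℝ, Amb c n × ℝ) f x :=
  (hf.contMDiffAt x).mdifferentiableAt (by exact_mod_cast hk)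

lemma sign_mul_form_dmap (hf : IsSpacelike c I w k univ f) (hk : k ≠ 0) (x : M)
    (v : EuclideanSpace ℝ (Fin n)) : (c : ℝ) * form c n (f x).1 (dmap f x v).1 = 0 := by
  have hd := hf.mdifferentiableAt hk x
  rw [← dmap_fst hd]
  exact sign_mul_form_dmap_self
    (mdifferentiableAt_clm (ContinuousLinearMap.fst ℝ (Amb c n) ℝ) hd)
    (Filter.Eventually.of_forall fun y => (hf.mem y (mem_univ y)).1) v

lemma adaptedFrame_screenMap (hf : IsSpacelike c I w k univ f) (hk : k ≠ 0)
    (hw0 : ∀ t ∈ I, w t ≠ 0) {x : M} {z : Amb c n} (hz : IsNormalAt w f x (z, w (f x).2))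
    (hunit : form c n z z = 1) : AdaptedFrame (f x).1 (screenMap w f x z) z :=
  have hx := hf.mem x (mem_univ x)
  RobertsonWalker.adaptedFrame_screenMap hx.1 (hf.sign_mul_form_dmap hk x) (hw0 _ hx.2)
    (hf.pos x (mem_univ x)) hz hunit

end IsSpacelike

lemma IsMarginallyTrappedAlong.exists_isNullField (hw : ContinuousOn w I)
    (hw0 : ∀ t ∈ I, w t ≠ 0) {k : ℕ∞} (hk : k ≠ 0) {f N : M → Amb c n × ℝ}
    (hf : IsSpacelike c I w k univ f) {V : Set M} (hN : IsMarginallyTrappedAlong w V f N) :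
    ∃ ζ : M → Amb c n, IsNullField w V f ζ ∧
      ∀ y ∈ V, ∃ a : ℝ, meanCurvatureVector w f y = a • (ζ y, w (f y).2) := by
  have hwf : ∀ y, w (f y).2 ≠ 0 := fun y => hw0 _ (hf.mem y (mem_univ y)).2
  have hN2 : ∀ y ∈ V, (N y).2 ≠ 0 := fun y hy =>
    snd_ne_zero_of_null (hf.mem y (mem_univ y)).1 (hwf y) (hN.normal y hy).1 (hN.null y hy)
      (hN.ne_zero y hy)
  let r : M → ℝ := fun y => w (f y).2 / (N y).2
  have hr : ∀ y ∈ V, ((r y • (N y).1, w (f y).2) : Amb c n × ℝ) = r y • N y := fun y hy =>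
    Prod.ext rfl (div_mul_cancel₀ _ (hN2 y hy)).symm
  refine ⟨fun y => r y • (N y).1, ⟨?_, fun y hy => ?_⟩, fun y hy => ?_⟩
  · have hwc : ContinuousOn (fun y => w (f y).2) V :=
      hw.comp (hf.contMDiffOn.continuousOn.snd.mono (subset_univ V))
        fun y _ => (hf.mem y (mem_univ y)).2
    exact (hwc.div hN.continuousOn.snd hN2).smul hN.continuousOn.fst
  · have hnormal : IsNormalAt w f y (r y • (N y).1, w (f y).2) := by
      rw [hr y hy]
      refine ⟨?_, fun v => ?_⟩
      · rw [Prod.smul_fst, form_smul_right, mul_left_comm, (hN.normal y hy).1, mul_zero]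
      · rw [warpedMetric_smul_right, (hN.normal y hy).2, mul_zero]
    have hunit : form c n (r y • (N y).1) (r y • (N y).1) = 1 := by
      have hnull := hN.null y hy
      have hNy := hN2 y hy
      rw [warpedMetric] at hnull
      simp only [form_smul_left, form_smul_right, r]
      field_simp
      linear_combination hnull
    exact hf.adaptedFrame_screenMap hk hw0 hnormal hunit
  · obtain ⟨a, ha⟩ := hN.collinear y hy
    refine ⟨a / r y, ?_⟩
    rw [hr y hy, ha, smul_smul, div_mul_cancel₀ _ (div_ne_zero (hwf y) (hN2 y hy))]

end NullField

section BasePoint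

variable {V : Type*} [AddCommGroup V] [Module ℝ V] [FiniteDimensional ℝ V]

lemma eventually_injective_focalOperator (c : SignType) (D : Module.End ℝ V) (s₀ : ℝ) :
    ∀ᶠ s in 𝓝[≠] s₀, Function.Injective (focalOperator c s D) := by
  have hne : ∀ κ : Module.End.Eigenvalues D,
      ∀ᶠ s in 𝓝[≠] s₀, co c s - si c s * (κ : ℝ) ≠ 0 := by
    intro κ
    have hana : AnalyticOnNhd ℝ (fun s => co c s - si c s * (κ : ℝ)) univ :=
      (analyticOnNhd_co c).sub ((analyticOnNhd_si c).mul analyticOnNhd_const)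
    refine (hana s₀ (mem_univ s₀)).eventually_eq_zero_or_eventually_ne_zero.resolve_left
      fun hzero => ?_
    have h0 := hana.eqOn_zero_of_preconnected_of_eventuallyEq_zero isPreconnected_univ
      (mem_univ s₀) hzero (mem_univ 0)
    simp [co_zero, si_zero] at h0
  filter_upwards [Filter.eventually_all.2 hne] with s hs
  refine injective_focalOperator_iff.2 fun κ => ?_
  by_contra! hκ
  exact hs κ (co_sub_si_mul_eq_zero_iff.2 hκ)

lemma exists_injective_focalOperator_theta {I : Set ℝ} {w : ℝ → ℝ} (hI : IsOpen I)
    (hI' : I.OrdConnected) (hw : ContinuousOn w I) (hw0 : ∀ t ∈ I, w t ≠ 0) (c : SignType)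
    (D : Module.End ℝ V) {t t₁ : ℝ} (ht : t ∈ I) (h₁ : t₁ ∈ I) {ε : ℝ} (hε : 0 < ε) :
    ∃ t₀ ∈ I, |t₀ - t₁| < ε ∧ Function.Injective (focalOperator c (theta w t₀ t) D) := by
  have htend := (hasDerivAt_theta_left hI hI' hw hw0 h₁ ht).tendsto_nhdsNE
    (neg_ne_zero.2 (inv_ne_zero (hw0 t₁ h₁)))
  have hnear : ∀ᶠ s in 𝓝[≠] t₁, s ∈ I ∧ |s - t₁| < ε :=
    nhdsWithin_le_nhds ((hI.eventually_mem h₁).and (Metric.ball_mem_nhds t₁ hε))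
  obtain ⟨t₀, ⟨ht₀, hdist⟩, hinj⟩ :=
    (hnear.and (htend.eventually (eventually_injective_focalOperator c D _))).exists
  exact ⟨t₀, ht₀, hdist, hinj⟩

end BasePoint

section Immersion

variable {n : ℕ} {M : Type*} [TopologicalSpace M] [ChartedSpace (EuclideanSpace ℝ (Fin n)) M]
  [IsManifold (𝓡 n) 1 M] {F : Type*} [NormedAddCommGroup F] [NormedSpace ℝ F]

lemma eventually_injective_dmap {f : M → F} {x : M} {k : ℕ∞ω} (hk : 1 ≤ k)
    (hf : ∀ᶠ y in 𝓝 x, ContMDiffAt (𝓡 n) 𝓘(ℝ, F) k f y)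
    (hinj : Function.Injective (dmap (n := n) f x)) :
    ∀ᶠ y in 𝓝 x, Function.Injective (dmap (n := n) f y) := by
  have hk0 : k ≠ 0 := (zero_lt_one.trans_le hk).ne'
  rw [dmap_eq_fderiv (hf.self_of_nhds.mdifferentiableAt hk0)] at hinj
  have hcont : ContinuousAt (fderiv ℝ (f ∘ (extChartAt (𝓡 n) x).symm)) (extChartAt (𝓡 n) x x) :=
    ((contDiffAt_chart hf.self_of_nhds).fderiv_right (m := 0) (by simpa using hk)).continuousAt
  refine (eventually_chart (n := n)).1 ?_
  filter_upwards [hcont.eventually (ContinuousLinearMap.isOpen_injective.mem_nhds hinj),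
    eventually_fderiv_chart_eq x, (eventually_chart (n := n)).2 hf] with z hz ⟨T, hT⟩ hfz u v huv
  have hz' : Function.Injective (fderiv ℝ (f ∘ (extChartAt (𝓡 n) x).symm) z) := hz
  rw [hT _ f (hfz.mdifferentiableAt hk0)] at hz'
  exact T.symm.injective (hz' (by simpa using huv))

end Immersion

section BaseMap

variable {n : ℕ} {M : Type*} {c : SignType} {w : ℝ → ℝ} {t₀ : ℝ} {f : M → Amb c n × ℝ}
  {ζ : M → Amb c n} {x : M}

/-- The hypersurface obtained from `f` by following the null geodesics with initial velocity
`(ζ, w ∘ τ)` to the slice of height `t₀`; it is the `φ` for which `f` has the form `phiBar`. -/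
def baseMap (w : ℝ → ℝ) (t₀ : ℝ) (f : M → Amb c n × ℝ) (ζ : M → Amb c n) (x : M) : Amb c n :=
  rot c (-theta w t₀ (f x).2) (f x).1 (ζ x)

/-- The Gauss map of `baseMap`. -/
def baseNormal (w : ℝ → ℝ) (t₀ : ℝ) (f : M → Amb c n × ℝ) (ζ : M → Amb c n) (x : M) : Amb c n :=
  rotNormal c (-theta w t₀ (f x).2) (f x).1 (ζ x)

lemma phiBar_baseMap :
    phiBar w t₀ (baseMap w t₀ f ζ) (baseNormal w t₀ f ζ) (fun y => (f y).2) = f := by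
  funext y
  have h := rot_neg_rot (-theta w t₀ (f y).2) (f y).1 (ζ y)
  rw [neg_neg] at h
  exact Prod.ext h rfl

lemma nuBar_baseMap : nuBar w t₀ (baseMap w t₀ f ζ) (baseNormal w t₀ f ζ) (fun y => (f y).2) x =
    (ζ x, w (f x).2) := by
  have h := rotNormal_neg_rot (-theta w t₀ (f x).2) (f x).1 (ζ x)
  rw [neg_neg] at h
  exact Prod.ext h rfl

variable [TopologicalSpace M] [ChartedSpace (EuclideanSpace ℝ (Fin n)) M]

lemma dmap_baseMap {D : Module.End ℝ (EuclideanSpace ℝ (Fin n))}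
    (hf : MDifferentiableAt (𝓡 n) 𝓘(ℝ, Amb c n × ℝ) f x)
    (hζ : MDifferentiableAt (𝓡 n) 𝓘(ℝ, Amb c n) ζ x)
    (hθ : HasDerivAt (theta w t₀) (w (f x).2)⁻¹ (f x).2) (hD : IsWeingarten w f ζ x D)
    (v : EuclideanSpace ℝ (Fin n)) : dmap (baseMap w t₀ f ζ) x v =
      screenMap w f x (ζ x) (focalOperator c (theta w t₀ (f x).2) D v) := by
  have hψ := mdifferentiableAt_clm (ContinuousLinearMap.fst ℝ (Amb c n) ℝ) hf
  have hτ : MDifferentiableAt (𝓡 n) 𝓘(ℝ, ℝ) (fun y => (f y).2) x :=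
    mdifferentiableAt_clm (ContinuousLinearMap.snd ℝ (Amb c n) ℝ) hf
  have hs : MDifferentiableAt (𝓡 n) 𝓘(ℝ, ℝ) (fun y => -theta w t₀ (f y).2) x :=
    DifferentiableAt.comp_mdifferentiableAt (f := fun y => (f y).2)
      (g := fun t => -theta w t₀ t) hθ.neg.differentiableAt hτ
  have hrot := dmap_rot hs hψ hζ v
  have hdζ : dmap ζ x v = screenMap w f x (ζ x) (D v) -
      ((c : ℝ) * ((w (f x).2)⁻¹ * (dmap f x v).2)) • (f x).1 := by rw [← hD]; abel
  have hdψ : (dmap f x v).1 =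
      screenMap w f x (ζ x) v + ((w (f x).2)⁻¹ * (dmap f x v).2) • ζ x := by
    rw [screenMap_apply]; abel
  refine hrot.trans ?_
  rw [dmap_comp_of_hasDerivAt (θ := fun t => -theta w t₀ t) hτ hθ.neg, dmap_snd hf, dmap_clm _ hf,
    ContinuousLinearMap.coe_fst', hdζ, hdψ, focalOperator_apply, map_sub, map_smul, map_smul,
    rotNormal, co_neg, si_neg]
  module

end BaseMap

section IsNullField

variable {n : ℕ} {M : Type*} [TopologicalSpace M] [ChartedSpace (EuclideanSpace ℝ (Fin n)) M]
  {c : SignType} {I : Set ℝ} {w : ℝ → ℝ} {f : M → Amb c n × ℝ} {V : Set M} {ζ : M → Amb c n}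
  {x : M}

namespace IsNullField

lemma mul_form_dmap (hN : IsNullField w V f ζ) (hx : x ∈ V) (hw : w (f x).2 ≠ 0)
    (v : EuclideanSpace ℝ (Fin n)) :
    w (f x).2 * form c n (dmap f x v).1 (ζ x) = (dmap f x v).2 := by
  rw [(hN.frame x hx).form_fst, mul_inv_cancel_left₀ hw]

lemma mono (hN : IsNullField w V f ζ) {V' : Set M} (h : V' ⊆ V) : IsNullField w V' f ζ :=
  ⟨hN.continuousOn.mono h, fun y hy => hN.frame y (h hy)⟩

lemma exists_isWeingarten (hN : IsNullField w V f ζ) (hV : IsOpen V) (hx : x ∈ V)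
    (hf : MDifferentiableAt (𝓡 n) 𝓘(ℝ, Amb c n × ℝ) f x)
    (hζ : MDifferentiableAt (𝓡 n) 𝓘(ℝ, Amb c n) ζ x) :
    ∃ D : Module.End ℝ (EuclideanSpace ℝ (Fin n)), IsWeingarten w f ζ x D :=
  RobertsonWalker.exists_isWeingarten hf hζ (hN.frame x hx)
    (Filter.eventually_of_mem (hV.mem_nhds hx) fun y hy => (hN.frame y hy).tangent_unit)
    (Filter.eventually_of_mem (hV.mem_nhds hx) fun y hy => (hN.frame y hy).unit)

variable [IsManifold (𝓡 n) 1 M]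

lemma contMDiffAt {k : ℕ∞} (hk : k ≠ 0) (hI : IsOpen I) (hw : ContDiffOn ℝ k w I)
    (hw0 : ∀ t ∈ I, w t ≠ 0) (hf : IsSpacelike c I w (k + 1) univ f) (hV : IsOpen V)
    (hN : IsNullField w V f ζ) (hx : x ∈ V) : ContMDiffAt (𝓡 n) 𝓘(ℝ, Amb c n) k ζ x := by
  have hfd := hf.mdifferentiableAt (by simp)
  have hψ : ∀ y, ContMDiffAt (𝓡 n) 𝓘(ℝ, Amb c n) (k + 1 : ℕ∞) (fun y => (f y).1) y := fun y =>
    contDiff_fst.contDiffAt.comp_contMDiffAt (hf.contMDiffAt y)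
  have hτ : ∀ y, ContMDiffAt (𝓡 n) 𝓘(ℝ, ℝ) (k + 1 : ℕ∞) (fun y => (f y).2) y := fun y =>
    contDiff_snd.contDiffAt.comp_contMDiffAt (hf.contMDiffAt y)
  have hτx := (hf.mem x (mem_univ x)).2
  have hwτ : ContMDiffAt (𝓡 n) 𝓘(ℝ, ℝ) k (fun y => (w (f y).2)⁻¹) x :=
    ((hw.contDiffAt (hI.mem_nhds hτx)).inv (hw0 _ hτx)).comp_contMDiffAt
      (f := fun y => (f y).2) ((hτ x).of_le (by exact_mod_cast le_self_add))
  have hV' : ∀ᶠ y in 𝓝 x, y ∈ V := hV.mem_nhds hx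
  refine contMDiffAt_unit_field (by exact_mod_cast hk) (m := (k + 1 : ℕ∞)) (by norm_cast)
    (Filter.Eventually.of_forall hψ) (Filter.Eventually.of_forall hτ) hwτ
    (hN.continuousOn.continuousAt hV') (hV'.mono fun y hy v => ?_)
    (hV'.mono fun y hy => (hN.frame y hy).tangent_unit)
    (hV'.mono fun y hy => (hN.frame y hy).unit) fun W hdψW hψW hζW => ?_
  · rw [dmap_fst (hfd y), dmap_snd (hfd y)]
    exact (hN.frame y hy).form_fst v
  · refine (hN.frame x hx).eq_zero hψW (by rw [form_comm, hζW]) fun v => ?_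
    have hv := hdψW v
    rw [dmap_fst (hfd x)] at hv
    rw [screenMap_apply, form_sub_left, form_smul_left, hζW, hv, mul_zero, sub_zero]

section Representation

variable (hI : IsOpen I) (hI' : I.OrdConnected) (hw : ContDiffOn ℝ 4 w I)
  (hw0 : ∀ t ∈ I, w t ≠ 0) (hf : IsSpacelike c I w 5 univ f) (hV : IsOpen V)
  (hN : IsNullField w V f ζ)

include hI hI' hw hw0 hf hV hN

lemma contMDiffAt_baseMap {t₀ : ℝ} (h₀ : t₀ ∈ I) (hx : x ∈ V) :
    ContMDiffAt (𝓡 n) 𝓘(ℝ, Amb c n) 4 (baseMap w t₀ f ζ) x ∧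
      ContMDiffAt (𝓡 n) 𝓘(ℝ, Amb c n) 4 (baseNormal w t₀ f ζ) x := by
  have hfx : ContMDiffAt (𝓡 n) 𝓘(ℝ, Amb c n × ℝ) 4 f x := (hf.contMDiffAt x).of_le (by norm_num)
  have hθ : ContDiffAt ℝ 4 (fun t => -theta w t₀ t) (f x).2 :=
    (((contDiffOn_theta hI hI' (k := 4) hw hw0 h₀).contDiffAt
      (hI.mem_nhds (hf.mem x (mem_univ x)).2)).of_le (by norm_num)).neg
  have hs : ContMDiffAt (𝓡 n) 𝓘(ℝ, ℝ) 4 (fun y => -theta w t₀ (f y).2) x :=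
    hθ.comp_contMDiffAt (f := fun y => (f y).2) (contDiff_snd.contDiffAt.comp_contMDiffAt hfx)
  have hψ : ContMDiffAt (𝓡 n) 𝓘(ℝ, Amb c n) 4 (fun y => (f y).1) x :=
    contDiff_fst.contDiffAt.comp_contMDiffAt hfx
  have hζ := hN.contMDiffAt (k := 4) (by simp) hI hw hw0 hf hV hx
  exact ⟨contMDiffAt_rot hs hψ hζ, contMDiffAt_rotNormal hs hψ hζ⟩

lemma exists_dmap_baseMap_eq (hx : x ∈ V) :
    ∃ D : Module.End ℝ (EuclideanSpace ℝ (Fin n)), ∀ t₀ ∈ I, ∀ v, dmap (baseMap w t₀ f ζ) x v =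
      screenMap w f x (ζ x) (focalOperator c (theta w t₀ (f x).2) D v) := by
  have hfd := hf.mdifferentiableAt (by norm_num) x
  have hζ := (hN.contMDiffAt (k := 4) (by simp) hI hw hw0 hf hV hx).mdifferentiableAt (by simp)
  obtain ⟨D, hD⟩ := hN.exists_isWeingarten hV hx hfd hζ
  exact ⟨D, fun t₀ h₀ => dmap_baseMap hfd hζ
    (hasDerivAt_theta hI hI' hw.continuousOn hw0 h₀ (hf.mem x (mem_univ x)).2) hD⟩

lemma isHypersurface_baseMap {t₀ : ℝ} (h₀ : t₀ ∈ I) {U : Set M} (hUV : U ⊆ V)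
    (hinj : ∀ y ∈ U, Function.Injective (dmap (n := n) (baseMap w t₀ f ζ) y)) :
    IsHypersurface c U (baseMap w t₀ f ζ) (baseNormal w t₀ f ζ) := by
  have hC := fun y hy => hN.contMDiffAt_baseMap hI hI' hw hw0 hf hV h₀ (hUV hy) (x := y)
  have hF := fun y hy => hN.frame y (hUV hy)
  refine ⟨fun y hy => rot_mem (hF y hy).mem (hF y hy).tangent_unit (hF y hy).unit _,
    fun y hy => (hC y hy).1.contMDiffWithinAt, hinj,
    fun y hy => (hC y hy).2.continuousAt.continuousWithinAt,
    fun y hy => form_rot_rotNormal (hF y hy).mem (hF y hy).tangent_unit (hF y hy).unit _,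
    fun y hy v => ?_,
    fun y hy => form_rotNormal_self (hF y hy).mem (hF y hy).tangent_unit (hF y hy).unit _⟩
  obtain ⟨D, hD⟩ := hN.exists_dmap_baseMap_eq hI hI' hw hw0 hf hV (hUV hy)
  rw [hD t₀ h₀, baseNormal, rotNormal, form_add_right, form_smul_right, form_smul_right,
    (hF y hy).normal, form_comm]
  linear_combination (-si c (-theta w t₀ (f y).2)) * (hF y hy).tangent _

theorem isLocallyRepresentedAt (hn : n ≠ 0)
    (hH : ∀ y ∈ V, ∃ a : ℝ, meanCurvatureVector w f y = a • (ζ y, w (f y).2)) (hx : x ∈ V) :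
    IsLocallyRepresentedAt I w f x := by
  intro t₁ h₁ ε hε
  have hτI : ∀ y, (f y).2 ∈ I := fun y => (hf.mem y (mem_univ y)).2
  obtain ⟨D, hD⟩ := hN.exists_dmap_baseMap_eq hI hI' hw hw0 hf hV hx
  obtain ⟨t₀, h₀, hdist, hfocal⟩ :=
    exists_injective_focalOperator_theta hI hI' hw.continuousOn hw0 c D (hτI x) h₁ hε
  have hinjx : Function.Injective (dmap (n := n) (baseMap w t₀ f ζ) x) := by
    intro u v huv
    rw [hD t₀ h₀, hD t₀ h₀] at huv
    exact hfocal ((hN.frame x hx).injective huv)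
  have hinj := eventually_injective_dmap (k := 4) (by norm_num)
    (Filter.eventually_of_mem (hV.mem_nhds hx) fun y hy =>
      (hN.contMDiffAt_baseMap hI hI' hw hw0 hf hV h₀ hy).1) hinjx
  obtain ⟨U, hU, hUo, hxU⟩ := mem_nhds_iff.1 (hinj.and (hV.mem_nhds hx))
  have hhyp := hN.isHypersurface_baseMap hI hI' hw hw0 hf hV h₀ (fun y hy => (hU hy).2)
    fun y hy => (hU hy).1
  have hτ : ContMDiffOn (𝓡 n) 𝓘(ℝ, ℝ) 2 (fun y => (f y).2) U := fun y _ =>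
    (contDiff_snd.contDiffAt.comp_contMDiffAt
      ((hf.contMDiffAt y).of_le (by norm_num))).contMDiffWithinAt
  refine ⟨t₀, h₀, hdist, U, baseMap w t₀ f ζ, baseNormal w t₀ f ζ, fun y => (f y).2, hUo, hxU,
    hhyp, hτ, fun y _ => congrFun phiBar_baseMap.symm y, fun y hy => ?_⟩
  have hyI := hI.mem_nhds (hτI y)
  rw [hhyp.mainEquation_iff hUo hy hn hτ
    (((contDiffOn_theta hI hI' (k := 4) hw hw0 h₀).contDiffAt hyI).of_le (by norm_num))
    (fun z _ => hasDerivAt_theta hI hI' hw.continuousOn hw0 h₀ (hτI z)) (fun z _ => hw0 _ (hτI z))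
    ((hw.contDiffAt hyI).differentiableAt (by norm_num)), phiBar_baseMap, nuBar_baseMap]
  exact ⟨hf.pos y (mem_univ y), hH y (hU hy).2⟩

end Representation

end IsNullField

end IsNullField

section UnitFields

variable {c : SignType} {n : ℕ}

lemma continuousAt_inverse_apply {X V : Type*} [TopologicalSpace X] [NormedAddCommGroup V]
    [NormedSpace ℝ V] [FiniteDimensional ℝ V] {g : X → V →L[ℝ] V →L[ℝ] ℝ} {ℓ : X → V →L[ℝ] ℝ}
    {x : X} (hg : ContinuousAt g x) (hℓ : ContinuousAt ℓ x) (hpos : ∀ v, v ≠ 0 → 0 < g x v v) :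
    ContinuousAt (fun y => (g y).inverse (ℓ y)) x := by
  have := FiniteDimensional.complete ℝ V
  obtain ⟨e, he⟩ := isInvertible_of_pos hpos
  have hinverse : ContinuousAt ContinuousLinearMap.inverse (g x) := by
    rw [← he]
    exact (contDiffAt_map_inverse (n := 0) e).continuousAt
  exact (ContinuousAt.comp (g := ContinuousLinearMap.inverse) (f := g) hinverse hg).clm_apply hℓ

lemma continuous_inducedForm :
    Continuous (inducedForm : (EuclideanSpace ℝ (Fin n) →L[ℝ] Amb c n) → _) := by
  let precomp := (ContinuousLinearMap.compL ℝ (EuclideanSpace ℝ (Fin n)) (Amb c n) ℝ).flip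
  have heq : (inducedForm : (EuclideanSpace ℝ (Fin n) →L[ℝ] Amb c n) → _) =
      fun A => (precomp A).comp ((formL c n).comp A) := rfl
  rw [heq]
  exact precomp.continuous.clm_comp (continuous_const.clm_comp continuous_id)

/-- The vector in the range of `a` that represents the functional `ℓ` with respect to the first
fundamental form: its scalar product with `a v` is `ℓ v`. -/
def rangeVector (a : EuclideanSpace ℝ (Fin n) →L[ℝ] Amb c n)
    (ℓ : EuclideanSpace ℝ (Fin n) →L[ℝ] ℝ) : Amb c n :=
  a ((inducedForm a).inverse ℓ)

/-- The component of `W` orthogonal to the position vector `p` and to the range of `a`. -/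
def normalPart (p : Amb c n) (a : EuclideanSpace ℝ (Fin n) →L[ℝ] Amb c n) (W : Amb c n) :
    Amb c n :=
  W - rangeVector a (((formL c n).flip W).comp a) - ((c : ℝ) * form c n p W) • p

namespace TangentFrame

variable {p : Amb c n} {a : EuclideanSpace ℝ (Fin n) →L[ℝ] Amb c n}

lemma form_rangeVector (h : TangentFrame p a) (ℓ : EuclideanSpace ℝ (Fin n) →L[ℝ] ℝ)
    (v : EuclideanSpace ℝ (Fin n)) : form c n (a v) (rangeVector a ℓ) = ℓ v := by
  obtain ⟨e, he⟩ := isInvertible_of_pos (g := inducedForm a) fun v hv => h.pos hv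
  have hinv : inducedForm a ((inducedForm a).inverse ℓ) = ℓ := by rw [← he]; simp
  rw [form_comm, rangeVector, ← inducedForm_apply, hinv]

lemma form_rangeVector_self_lt_one (h : TangentFrame p a) {ℓ : EuclideanSpace ℝ (Fin n) →L[ℝ] ℝ}
    (hℓ : ∀ v, v ≠ 0 → ℓ v ^ 2 < form c n (a v) (a v)) :
    form c n (rangeVector a ℓ) (rangeVector a ℓ) < 1 := by
  set u := (inducedForm a).inverse ℓ
  have hself : form c n (a u) (a u) = ℓ u := h.form_rangeVector ℓ u
  change form c n (a u) (a u) < 1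
  rcases eq_or_ne u 0 with h0 | h0
  · rw [h0, map_zero, form_zero_left]
    exact one_pos
  · have hlt := hℓ u h0
    have hpos := h.pos h0
    rw [hself] at hlt hpos ⊢
    nlinarith

lemma sign_mul_form_normalPart (h : TangentFrame p a) (W : Amb c n) :
    (c : ℝ) * form c n p (normalPart p a W) = 0 := by
  rw [normalPart, form_sub_right, form_sub_right, form_smul_right, rangeVector]
  linear_combination -(h.tangent _) - c * form c n p W * sign_mul_form_self h.mem -
    form c n p W * sign_cube c

lemma form_normalPart (h : TangentFrame p a) (W : Amb c n) (v : EuclideanSpace ℝ (Fin n)) :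
    form c n (a v) (normalPart p a W) = 0 := by
  have hℓ : ((formL c n).flip W).comp a v = form c n (a v) W := rfl
  rw [normalPart, form_sub_right, form_sub_right, form_smul_right, h.form_rangeVector, hℓ,
    form_comm c n (a v) p]
  linear_combination -(form c n p W) * h.tangent v

lemma exists_normal_ne_zero (h : TangentFrame p a) :
    ∃ W : Amb c n, W ≠ 0 ∧ (c : ℝ) * form c n p W = 0 ∧ ∀ v, form c n (a v) W = 0 := by
  let L : tangentSub p →ₗ[ℝ] (EuclideanSpace ℝ (Fin n) →ₗ[ℝ] ℝ) :=
    (LinearMap.mk₂ ℝ (fun W v => form c n (a v) W)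
      (fun _ _ _ => form_add_right _ _ _) (fun _ _ _ => form_smul_right _ _ _)
      (fun _ _ _ => by rw [map_add, form_add_left])
      (fun _ _ _ => by rw [map_smul, form_smul_left, smul_eq_mul])).domRestrict (tangentSub p)
  have hker : LinearMap.ker L ≠ ⊥ := by
    refine LinearMap.ker_ne_bot_of_finrank_lt ?_
    rw [finrank_tangentSub h.mem, Module.finrank_linearMap_self, finrank_euclideanSpace_fin]
    exact Nat.lt_succ_self n
  obtain ⟨W, hW, hne⟩ := (Submodule.ne_bot_iff _).1 hker
  exact ⟨W, fun h0 => hne (Subtype.ext h0), mem_tangentSub.1 W.2,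
    fun v => LinearMap.congr_fun hW v⟩

end TangentFrame

lemma normalPart_eq_self {p W : Amb c n} {a : EuclideanSpace ℝ (Fin n) →L[ℝ] Amb c n}
    (hp : (c : ℝ) * form c n p W = 0) (ha : ∀ v, form c n (a v) W = 0) : normalPart p a W = W := by
  have hℓ : ((formL c n).flip W).comp a = 0 := ContinuousLinearMap.ext ha
  rw [normalPart, hℓ, hp, rangeVector, map_zero, map_zero, sub_zero, zero_smul, sub_zero]

lemma AdaptedFrame.unitConstraint_rangeVector_add_smul {p z : Amb c n}
    {a : EuclideanSpace ℝ (Fin n) →L[ℝ] Amb c n} (h : AdaptedFrame p a z)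
    (ℓ : EuclideanSpace ℝ (Fin n) →L[ℝ] ℝ) {s : ℝ}
    (hs : s ^ 2 = 1 - form c n (rangeVector a ℓ) (rangeVector a ℓ)) :
    unitConstraint a ℓ p (rangeVector a ℓ + s • z) = 0 := by
  have hz : form c n (rangeVector a ℓ) z = 0 := h.normal _
  have htangent : (c : ℝ) * form c n p (rangeVector a ℓ) = 0 := h.tangent _
  refine unitConstraint_eq_zero_iff.2 ⟨fun v => ?_, ?_, ?_⟩
  · rw [form_add_right, form_smul_right, h.normal, h.form_rangeVector, mul_zero, add_zero]
  · rw [form_add_right, form_smul_right]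
    linear_combination htangent + s * h.tangent_unit
  · simp only [form_add_left, form_add_right, form_smul_left, form_smul_right, h.unit, hz,
      form_comm c n z (rangeVector a ℓ)]
    linear_combination hs

section Continuity

variable {X : Type*} [TopologicalSpace X] {p : X → Amb c n}
  {a : X → EuclideanSpace ℝ (Fin n) →L[ℝ] Amb c n} {ℓ : X → EuclideanSpace ℝ (Fin n) →L[ℝ] ℝ}
  {x : X}

lemma continuousAt_form {Y Z : X → Amb c n} (hY : ContinuousAt Y x) (hZ : ContinuousAt Z x) :
    ContinuousAt (fun y => form c n (Y y) (Z y)) x :=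
  ((formL c n).continuous.continuousAt.comp hY).clm_apply hZ

lemma continuousAt_rangeVector (ha : ContinuousAt a x) (hℓ : ContinuousAt ℓ x)
    (h : TangentFrame (p x) (a x)) : ContinuousAt (fun y => rangeVector (a y) (ℓ y)) x :=
  ha.clm_apply (continuousAt_inverse_apply (continuous_inducedForm.continuousAt.comp ha) hℓ
    fun _ hv => h.pos hv)

lemma continuousAt_normalPart (ha : ContinuousAt a x) (hp : ContinuousAt p x)
    (h : TangentFrame (p x) (a x)) (W : Amb c n) :
    ContinuousAt (fun y => normalPart (p y) (a y) W) x :=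
  (continuousAt_const.sub (continuousAt_rangeVector ha (continuousAt_const.clm_comp ha) h)).sub
    ((continuousAt_const.mul (continuousAt_form hp continuousAt_const)).smul hp)

lemma exists_continuousAt_adaptedFrame (ha : ∀ᶠ y in 𝓝 x, ContinuousAt a y)
    (hp : ∀ᶠ y in 𝓝 x, ContinuousAt p y) (hframe : ∀ᶠ y in 𝓝 x, TangentFrame (p y) (a y)) :
    ∃ η : X → Amb c n, ∀ᶠ y in 𝓝 x, ContinuousAt η y ∧ AdaptedFrame (p y) (a y) (η y) := by
  obtain ⟨W₀, hne, hpW₀, haW₀⟩ := hframe.self_of_nhds.exists_normal_ne_zero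
  let W : X → Amb c n := fun y => normalPart (p y) (a y) W₀
  have hW : ∀ᶠ y in 𝓝 x, ContinuousAt W y := by
    filter_upwards [ha, hp, hframe] with y hay hpy hy
    exact continuousAt_normalPart hay hpy hy W₀
  have hpos : ∀ᶠ y in 𝓝 x, 0 < form c n (W y) (W y) := by
    refine (continuousAt_form hW.self_of_nhds hW.self_of_nhds).eventually (lt_mem_nhds ?_)
    have hWx : W x = W₀ := normalPart_eq_self hpW₀ haW₀
    change 0 < form c n (W x) (W x)
    rw [hWx]
    exact form_self_pos hframe.self_of_nhds.mem hpW₀ hne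
  refine ⟨fun y => (√(form c n (W y) (W y)))⁻¹ • W y, ?_⟩
  filter_upwards [hW, hpos, hframe] with y hWy hposy hy
  have hsqrt : √(form c n (W y) (W y)) ≠ 0 := (Real.sqrt_pos.2 hposy).ne'
  refine ⟨((Real.continuous_sqrt.continuousAt.comp (continuousAt_form hWy hWy)).inv₀ hsqrt).smul
    hWy, hy, fun v => ?_, ?_, ?_⟩
  · rw [form_smul_right, hy.form_normalPart, mul_zero]
  · rw [form_smul_right, mul_left_comm, hy.sign_mul_form_normalPart, mul_zero]
  · rw [form_smul_left, form_smul_right, ← mul_assoc, ← mul_inv, Real.mul_self_sqrt hposy.le,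
      inv_mul_cancel₀ hposy.ne']

lemma exists_pair_continuousAt_unitConstraint (ha : ∀ᶠ y in 𝓝 x, ContinuousAt a y)
    (hℓ : ∀ᶠ y in 𝓝 x, ContinuousAt ℓ y) (hp : ∀ᶠ y in 𝓝 x, ContinuousAt p y)
    (hframe : ∀ᶠ y in 𝓝 x, TangentFrame (p y) (a y))
    (hlt : ∀ᶠ y in 𝓝 x, ∀ v, v ≠ 0 → ℓ y v ^ 2 < form c n (a y v) (a y v)) :
    ∃ ζ₁ ζ₂ : X → Amb c n, ∀ᶠ y in 𝓝 x, ζ₁ y ≠ ζ₂ y ∧ ∀ ζ ∈ ({ζ₁, ζ₂} : Set (X → Amb c n)),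
      ContinuousAt ζ y ∧ unitConstraint (a y) (ℓ y) (p y) (ζ y) = 0 := by
  obtain ⟨η, hη⟩ := exists_continuousAt_adaptedFrame ha hp hframe
  let Y : X → Amb c n := fun y => rangeVector (a y) (ℓ y)
  let r : X → ℝ := fun y => √(1 - form c n (Y y) (Y y))
  refine ⟨fun y => Y y + r y • η y, fun y => Y y + (-r y) • η y, ?_⟩
  filter_upwards [ha, hℓ, hframe, hlt, hη] with y hay hℓy hy hlty ⟨hηc, hηy⟩
  have hYc : ContinuousAt Y y := continuousAt_rangeVector hay hℓy hy
  have hrc : ContinuousAt r y := Real.continuous_sqrt.continuousAt.comp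
    (continuousAt_const.sub (continuousAt_form hYc hYc))
  have hY1 : form c n (Y y) (Y y) < 1 := hy.form_rangeVector_self_lt_one hlty
  have hr : 0 < r y := Real.sqrt_pos.2 (sub_pos.2 hY1)
  have hr2 : r y ^ 2 = 1 - form c n (Y y) (Y y) := Real.sq_sqrt (sub_pos.2 hY1).le
  refine ⟨fun heq => ?_, ?_⟩
  · have hform := congrArg (fun W => form c n W (η y)) heq
    simp only [form_add_left, form_smul_left, hηy.unit] at hform
    linarith
  · rintro ζ (rfl | rfl)
    · exact ⟨hYc.add (hrc.smul hηc), hηy.unitConstraint_rangeVector_add_smul _ hr2⟩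
    · exact ⟨hYc.add (hrc.neg.smul hηc),
        hηy.unitConstraint_rangeVector_add_smul _ (by rw [neg_sq, hr2])⟩

end Continuity

end UnitFields

section NullFields

variable {n : ℕ} {M : Type*} [TopologicalSpace M] [ChartedSpace (EuclideanSpace ℝ (Fin n)) M]
  {c : SignType} {I : Set ℝ} {w : ℝ → ℝ} {f : M → Amb c n × ℝ}

lemma TangentFrame.comp_equiv {p : Amb c n} {a : EuclideanSpace ℝ (Fin n) →L[ℝ] Amb c n}
    (h : TangentFrame p a) (T : EuclideanSpace ℝ (Fin n) ≃L[ℝ] EuclideanSpace ℝ (Fin n)) :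
    TangentFrame p (a.comp (T : EuclideanSpace ℝ (Fin n) →L[ℝ] EuclideanSpace ℝ (Fin n))) :=
  ⟨h.mem, h.injective.comp T.injective, fun v => h.tangent (T v)⟩

namespace IsSpacelike

variable {k : ℕ∞}

lemma sq_snd_dmap_lt (hf : IsSpacelike c I w k univ f) (hw0 : ∀ t ∈ I, w t ≠ 0) (x : M)
    {v : EuclideanSpace ℝ (Fin n)} (hv : v ≠ 0) :
    ((w (f x).2)⁻¹ * (dmap f x v).2) ^ 2 < form c n (dmap f x v).1 (dmap f x v).1 := by
  have hpos := hf.pos x (mem_univ x) v hv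
  have hwx := hw0 _ (hf.mem x (mem_univ x)).2
  rw [warpedMetric, sub_pos] at hpos
  rw [mul_pow, inv_pow, inv_mul_lt_iff₀ (by positivity), sq (dmap f x v).2]
  exact hpos

lemma tangentFrame (hf : IsSpacelike c I w k univ f) (hk : k ≠ 0) (hw0 : ∀ t ∈ I, w t ≠ 0)
    (x : M) : TangentFrame (f x).1 ((ContinuousLinearMap.fst ℝ (Amb c n) ℝ).comp (dmap f x)) := by
  refine ⟨(hf.mem x (mem_univ x)).1, ?_, hf.sign_mul_form_dmap hk x⟩
  rw [injective_iff_map_eq_zero]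
  intro v hv
  by_contra hne
  have hlt := hf.sq_snd_dmap_lt hw0 x hne
  have hv' : (dmap f x v).1 = 0 := hv
  rw [hv', form_zero_left] at hlt
  exact hlt.not_ge (sq_nonneg _)

lemma adaptedFrame_of_unitConstraint (hf : IsSpacelike c I w k univ f) (hk : k ≠ 0)
    (hw0 : ∀ t ∈ I, w t ≠ 0) {x : M} {z : Amb c n}
    (T : EuclideanSpace ℝ (Fin n) ≃L[ℝ] EuclideanSpace ℝ (Fin n))
    (hz : unitConstraint
      ((ContinuousLinearMap.fst ℝ (Amb c n) ℝ).comp ((dmap f x).comp T.toContinuousLinearMap))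
      ((w (f x).2)⁻¹ •
        (ContinuousLinearMap.snd ℝ (Amb c n) ℝ).comp ((dmap f x).comp T.toContinuousLinearMap))
      (f x).1 z = 0) :
    AdaptedFrame (f x).1 (screenMap w f x z) z := by
  obtain ⟨hscalar, htangent, hunit⟩ := unitConstraint_eq_zero_iff.1 hz
  refine hf.adaptedFrame_screenMap hk hw0 ⟨htangent, fun v => ?_⟩ hunit
  have hwx := hw0 _ (hf.mem x (mem_univ x)).2
  have hv : form c n (dmap f x v).1 z = (w (f x).2)⁻¹ * (dmap f x v).2 := by
    simpa using hscalar (T.symm v)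
  rw [warpedMetric, hv]
  field_simp
  ring

variable [IsManifold (𝓡 n) 1 M]

lemma exists_pair_continuousAt_adaptedFrame_chart (hf : IsSpacelike c I w 1 univ f)
    (hI : IsOpen I) (hw : ContinuousOn w I) (hw0 : ∀ t ∈ I, w t ≠ 0) (x : M) :
    ∃ ζ₁ ζ₂ : EuclideanSpace ℝ (Fin n) → Amb c n, ∀ᶠ z in 𝓝 (extChartAt (𝓡 n) x x),
      ζ₁ z ≠ ζ₂ z ∧ ∀ ζ ∈ ({ζ₁, ζ₂} : Set (_ → Amb c n)), ContinuousAt ζ z ∧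
        AdaptedFrame (f ((extChartAt (𝓡 n) x).symm z)).1
          (screenMap w f ((extChartAt (𝓡 n) x).symm z) (ζ z)) (ζ z) := by
  set χ := extChartAt (𝓡 n) x with hχ
  have hfd := hf.mdifferentiableAt one_ne_zero
  have hC : ∀ᶠ z in 𝓝 (χ x), ContDiffAt ℝ 1 (f ∘ χ.symm) z :=
    (contDiffAt_chart (hf.contMDiffAt x)).eventually (by simp)
  have hdc : ∀ᶠ z in 𝓝 (χ x), ContinuousAt (fderiv ℝ (f ∘ χ.symm)) z :=
    hC.mono fun z hz => (hz.fderiv_right (m := 0) (by norm_num)).continuousAt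
  have hwc : ∀ᶠ z in 𝓝 (χ x), ContinuousAt (fun z => (w (f (χ.symm z)).2)⁻¹) z :=
    hC.mono fun z hz => (ContinuousAt.comp (g := w) (f := fun z => (f (χ.symm z)).2)
      (hw.continuousAt (hI.mem_nhds (hf.mem _ (mem_univ _)).2)) hz.continuousAt.snd).inv₀
      (hw0 _ (hf.mem _ (mem_univ _)).2)
  have hT := eventually_fderiv_chart_eq (n := n) x
  rw [← hχ] at hT
  obtain ⟨ζ₁, ζ₂, hζ⟩ := exists_pair_continuousAt_unitConstraint (x := χ x)
    (a := fun z => (ContinuousLinearMap.fst ℝ (Amb c n) ℝ).comp (fderiv ℝ (f ∘ χ.symm) z))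
    (ℓ := fun z => (w (f (χ.symm z)).2)⁻¹ •
      (ContinuousLinearMap.snd ℝ (Amb c n) ℝ).comp (fderiv ℝ (f ∘ χ.symm) z))
    (p := fun z => (f (χ.symm z)).1)
    (hdc.mono fun z hz => continuousAt_const.clm_comp hz)
    (hdc.mp (hwc.mono fun z hz hz' => hz.smul (continuousAt_const.clm_comp hz')))
    (hC.mono fun z hz => hz.continuousAt.fst)
    (hT.mono fun z ⟨T, hT⟩ => by
      rw [hT _ f (hfd _)]
      exact (hf.tangentFrame one_ne_zero hw0 _).comp_equiv T)
    (hT.mono fun z ⟨T, hT⟩ v hv => by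
      rw [hT _ f (hfd _)]
      exact hf.sq_snd_dmap_lt hw0 _ (by simpa using hv))
  refine ⟨ζ₁, ζ₂, (hζ.and hT).mono fun z ⟨⟨hne, hz⟩, T, hT⟩ => ⟨hne, fun ζ hζ =>
    ⟨(hz ζ hζ).1, hf.adaptedFrame_of_unitConstraint one_ne_zero hw0 T ?_⟩⟩⟩
  have hc := (hz ζ hζ).2
  rwa [hT _ f (hfd _)] at hc

theorem exists_pair_isNullField (hf : IsSpacelike c I w 1 univ f) (hI : IsOpen I)
    (hw : ContinuousOn w I) (hw0 : ∀ t ∈ I, w t ≠ 0) (x : M) :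
    ∃ (V : Set M) (ζ₁ ζ₂ : M → Amb c n), IsOpen V ∧ x ∈ V ∧ IsNullField w V f ζ₁ ∧
      IsNullField w V f ζ₂ ∧ ∀ y ∈ V, ζ₁ y ≠ ζ₂ y := by
  set χ := extChartAt (𝓡 n) x with hχ
  obtain ⟨ζ₁, ζ₂, hζ⟩ := hf.exists_pair_continuousAt_adaptedFrame_chart hI hw hw0 x
  rw [← hχ] at hζ
  have hev : ∀ᶠ y in 𝓝 x, ζ₁ (χ y) ≠ ζ₂ (χ y) ∧ ∀ ζ ∈ ({ζ₁, ζ₂} : Set (_ → Amb c n)),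
      ContinuousAt (fun y => ζ (χ y)) y ∧
      AdaptedFrame (f y).1 (screenMap w f y (ζ (χ y))) (ζ (χ y)) := by
    filter_upwards [(tendsto_chart x).eventually hζ, extChartAt_source_mem_nhds (I := 𝓡 n) x]
      with y ⟨hne, hy⟩ hs
    have hyy : χ.symm (χ y) = y := χ.left_inv hs
    rw [hyy] at hy
    exact ⟨hne, fun ζ hζ => ⟨(hy ζ hζ).1.comp (continuousAt_extChartAt' hs), (hy ζ hζ).2⟩⟩
  obtain ⟨V, hVs, hVo, hxV⟩ := mem_nhds_iff.1 hev
  have hnull : ∀ ζ ∈ ({ζ₁, ζ₂} : Set (_ → Amb c n)), IsNullField w V f fun y => ζ (χ y) :=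
    fun ζ hζ => ⟨fun y hy => ((hVs hy).2 ζ hζ).1.continuousWithinAt,
      fun y hy => ((hVs hy).2 ζ hζ).2⟩
  exact ⟨V, fun y => ζ₁ (χ y), fun y => ζ₂ (χ y), hVo, hxV, hnull ζ₁ (Or.inl rfl),
    hnull ζ₂ (Or.inr rfl), fun y hy => (hVs hy).1⟩

end IsSpacelike

end NullFields

section Trace

lemma exists_continuousAt_trace {X E F : Type*} [TopologicalSpace X] [NormedAddCommGroup E]
    [NormedSpace ℝ E] [FiniteDimensional ℝ E] [NormedAddCommGroup F] [NormedSpace ℝ F]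
    [FiniteDimensional ℝ F] {Y R : X → E →L[ℝ] F} {x : X} (hY : ContinuousAt Y x)
    (hR : ContinuousAt R x) (hinj : Function.Injective (Y x)) :
    ∃ t : X → ℝ, ContinuousAt t x ∧ ∀ᶠ z in 𝓝 x, ∀ D : Module.End ℝ E,
      (∀ v, R z v = Y z (D v)) → LinearMap.trace ℝ E D = t z := by
  have := FiniteDimensional.complete ℝ E
  obtain ⟨Γ₀, hΓ₀⟩ := (Y x).toLinearMap.exists_leftInverse_of_injective
    (LinearMap.ker_eq_bot.2 hinj)
  let Γ : F →L[ℝ] E := LinearMap.toContinuousLinearMap Γ₀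
  have hΓ : Γ.comp (Y x) = (ContinuousLinearEquiv.refl ℝ E : E →L[ℝ] E) :=
    ContinuousLinearMap.ext fun v => LinearMap.congr_fun hΓ₀ v
  have hΓY : ContinuousAt (fun z => Γ.comp (Y z)) x := continuousAt_const.clm_comp hY
  have hinverse : ContinuousAt (fun z => (Γ.comp (Y z)).inverse) x := by
    refine ContinuousAt.comp (g := ContinuousLinearMap.inverse) (f := fun z => Γ.comp (Y z)) ?_ hΓY
    rw [hΓ]
    exact (contDiffAt_map_inverse (n := 0) _).continuousAt
  have hinvertible : ∀ᶠ z in 𝓝 x, (Γ.comp (Y z)).IsInvertible := by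
    refine hΓY.eventually ?_
    change ∀ᶠ A in 𝓝 (Γ.comp (Y x)), A.IsInvertible
    rw [hΓ]
    exact ContinuousLinearEquiv.nhds _
  let trace : (E →L[ℝ] E) →ₗ[ℝ] ℝ := LinearMap.trace ℝ E ∘ₗ ContinuousLinearMap.coeLM ℝ
  refine ⟨fun z => trace ((Γ.comp (Y z)).inverse.comp (Γ.comp (R z))),
    (LinearMap.continuous_of_finiteDimensional trace).continuousAt.comp
      (hinverse.clm_comp (continuousAt_const.clm_comp hR)), ?_⟩
  filter_upwards [hinvertible] with z ⟨e, he⟩ D hD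
  have hfactor : Γ.comp (R z) = (Γ.comp (Y z)).comp (LinearMap.toContinuousLinearMap D) :=
    ContinuousLinearMap.ext fun v => congrArg Γ (hD v)
  have hcomp : (Γ.comp (Y z)).inverse.comp (Γ.comp (R z)) = LinearMap.toContinuousLinearMap D := by
    rw [hfactor, ← he, ContinuousLinearMap.inverse_equiv, ← ContinuousLinearMap.comp_assoc]
    ext1 v
    simp
  rw [hcomp]
  rfl

lemma exists_continuousAt_trace_of_null {X E F : Type*} [TopologicalSpace X]
    [NormedAddCommGroup E] [NormedSpace ℝ E] [FiniteDimensional ℝ E] [NormedAddCommGroup F]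
    [NormedSpace ℝ F] [FiniteDimensional ℝ F] {a : X → E →L[ℝ] F × ℝ} {b : X → E →L[ℝ] F}
    {r : X → ℝ} {p q : X → F} {x : X} (ha : ContinuousAt a x) (hb : ContinuousAt b x)
    (hr : ContinuousAt r x) (hp : ContinuousAt p x) (hq : ContinuousAt q x)
    (hinj : Function.Injective fun v => (a x v).1 - (r x * (a x v).2) • q x) :
    ∃ t : X → ℝ, ContinuousAt t x ∧ ∀ᶠ z in 𝓝 x, ∀ D : Module.End ℝ E,
      (∀ v, b z v + (r z * (a z v).2) • p z = (a z (D v)).1 - (r z * (a z (D v)).2) • q z) →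
        LinearMap.trace ℝ E D = t z := by
  let τ : X → E →L[ℝ] ℝ := fun z => r z • (ContinuousLinearMap.snd ℝ F ℝ).comp (a z)
  have hτ : ContinuousAt τ x := hr.smul (continuousAt_const.clm_comp ha)
  have hsmulRight : ∀ {g : X → F}, ContinuousAt g x →
      ContinuousAt (fun z => (τ z).smulRight (g z)) x := fun hg =>
    ((ContinuousLinearMap.smulRightL ℝ E F).continuous.continuousAt.comp hτ).clm_apply hg
  exact exists_continuousAt_trace
    (Y := fun z => (ContinuousLinearMap.fst ℝ F ℝ).comp (a z) - (τ z).smulRight (q z))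
    (R := fun z => b z + (τ z).smulRight (p z))
    ((continuousAt_const.clm_comp ha).sub (hsmulRight hq)) (hb.add (hsmulRight hp)) hinj

end Trace

section MeanCurvature

variable {n : ℕ} {M : Type*} [TopologicalSpace M] [ChartedSpace (EuclideanSpace ℝ (Fin n)) M]
  {c : SignType} {I : Set ℝ} {w : ℝ → ℝ} {f : M → Amb c n × ℝ}

lemma IsSpacelike.of_le {k l : ℕ∞} {U : Set M} (hf : IsSpacelike c I w k U f) (h : l ≤ k) :
    IsSpacelike c I w l U f :=
  ⟨hf.mem, hf.contMDiffOn.of_le (by exact_mod_cast h), hf.pos⟩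

lemma IsSpacelike.isNormalAt_meanCurvatureVector {k : ℕ∞} (hf : IsSpacelike c I w k univ f)
    (hk : k ≠ 0) (hI : IsOpen I) (hw : DifferentiableOn ℝ w I) (hw0 : ∀ t ∈ I, w t ≠ 0) (y : M) :
    IsNormalAt w f y (meanCurvatureVector w f y) :=
  have hy := hf.mem y (mem_univ y)
  (meanCurvatureVector_spec hy.1 (hw0 _ hy.2) (hw.differentiableAt (hI.mem_nhds hy.2))
    (hf.sign_mul_form_dmap hk y) (hf.pos y (mem_univ y))).1

lemma IsNormalAt.exists_eq_smul_of_null {x : M} {H : Amb c n × ℝ} (hH : IsNormalAt w f x H)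
    (hnull : warpedMetric c n w (f x) H H = 0) (hw : w (f x).2 ≠ 0) {z₁ z₂ : Amb c n}
    (h₁ : AdaptedFrame (f x).1 (screenMap w f x z₁) z₁)
    (h₂ : AdaptedFrame (f x).1 (screenMap w f x z₂) z₂) (hne : z₁ ≠ z₂)
    (hH₂ : warpedMetric c n w (f x) H (z₂, w (f x).2) ≠ 0) :
    ∃ a : ℝ, H = a • (z₁, w (f x).2) := by
  set N₁ : Amb c n × ℝ := (z₁, w (f x).2) with hN₁
  set N₂ : Amb c n × ℝ := (z₂, w (f x).2) with hN₂
  have hG : warpedMetric c n w (f x) N₁ N₂ ≠ 0 := by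
    intro hG
    have hmul := h₂.eq_smul_null hw h₁.isNormalAt hG
    rw [mul_inv_cancel₀ hw, one_smul] at hmul
    exact hne (congrArg Prod.fst hmul)
  obtain ⟨a, ha⟩ : ∃ a, a * warpedMetric c n w (f x) N₁ N₂ = warpedMetric c n w (f x) H N₂ :=
    ⟨_, div_mul_cancel₀ _ hG⟩
  have hnormal : IsNormalAt w f x (H - a • N₁) := by
    refine ⟨?_, fun v => ?_⟩
    · rw [Prod.fst_sub, Prod.smul_fst, form_sub_right, form_smul_right]
      linear_combination hH.1 - a * h₁.isNormalAt.1
    · rw [warpedMetric_sub_right, warpedMetric_smul_right, hH.2, h₁.isNormalAt.2, mul_zero,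
        sub_zero]
  have horth : warpedMetric c n w (f x) (H - a • N₁) N₂ = 0 := by
    rw [warpedMetric_sub_left, warpedMetric_smul_left, ha, sub_self]
  obtain ⟨b, hb⟩ : ∃ b : ℝ, H - a • N₁ = b • N₂ := ⟨_, h₂.eq_smul_null hw hnormal horth⟩
  have hHab : H = a • N₁ + b • N₂ := by rw [← hb, add_sub_cancel]
  have hprod : 2 * a * warpedMetric c n w (f x) N₁ N₂ * b = 0 := by
    rw [hHab] at hnull
    simp only [warpedMetric_add_left, warpedMetric_add_right, warpedMetric_smul_left,
      warpedMetric_smul_right, warpedMetric_null _ h₁.unit rfl, warpedMetric_null _ h₂.unit rfl,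
      hN₁, hN₂, warpedMetric_comm (f x) (z₂, w (f x).2) (z₁, w (f x).2)] at hnull ⊢
    linear_combination hnull
  rw [mul_assoc 2, ha] at hprod
  have hb0 : b = 0 := (mul_eq_zero.1 hprod).resolve_left (mul_ne_zero two_ne_zero hH₂)
  exact ⟨a, by rw [hHab, hb0, zero_smul, add_zero]⟩

variable [IsManifold (𝓡 n) 1 M]

lemma exists_continuousAt_trace_isWeingarten {V : Set M} {ζ : M → Amb c n} {x : M}
    (hV : V ∈ 𝓝 x) (hf : ∀ y ∈ V, ContMDiffAt (𝓡 n) 𝓘(ℝ, Amb c n × ℝ) 1 f y)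
    (hζ : ∀ y ∈ V, ContMDiffAt (𝓡 n) 𝓘(ℝ, Amb c n) 1 ζ y) (hw : ContinuousAt w (f x).2)
    (hw0 : w (f x).2 ≠ 0) (hinj : Function.Injective (screenMap w f x (ζ x))) :
    ∃ t : M → ℝ, ContinuousAt t x ∧ ∀ᶠ y in 𝓝 x, ∀ D : Module.End ℝ (EuclideanSpace ℝ (Fin n)),
      IsWeingarten w f ζ y D → LinearMap.trace ℝ _ D = t y := by
  have hx := mem_of_mem_nhds hV
  have hfd := fun y hy => (hf y hy).mdifferentiableAt one_ne_zero
  have hζd := fun y hy => (hζ y hy).mdifferentiableAt one_ne_zero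
  have hfc := contDiffAt_chart (hf x hx)
  have hζc := contDiffAt_chart (hζ x hx)
  set χ := extChartAt (𝓡 n) x with hχ
  have hxx : χ.symm (χ x) = x := extChartAt_to_inv x
  have hwc : ContinuousAt (fun z => (w (f (χ.symm z)).2)⁻¹) (χ x) :=
    (ContinuousAt.comp (g := w) (f := fun z => (f (χ.symm z)).2) (by rwa [hxx])
      hfc.continuousAt.snd).inv₀ (by rwa [Function.comp_apply, hxx])
  have hp : ContinuousAt (fun z => (c : ℝ) • (f (χ.symm z)).1) (χ x) :=
    (continuous_const_smul (c : ℝ)).continuousAt.comp hfc.continuousAt.fst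
  have hinj' : Function.Injective fun v => (fderiv ℝ (f ∘ χ.symm) (χ x) v).1 -
      ((w (f (χ.symm (χ x))).2)⁻¹ * (fderiv ℝ (f ∘ χ.symm) (χ x) v).2) • ζ (χ.symm (χ x)) := by
    rw [hxx, hχ, ← dmap_eq_fderiv (hfd x hx)]
    simpa only [← screenMap_apply] using hinj
  obtain ⟨t, ht, hev⟩ := exists_continuousAt_trace_of_null
    (p := fun z => (c : ℝ) • (f (χ.symm z)).1) (q := fun z => ζ (χ.symm z))
    (hfc.fderiv_right (m := 0) (by norm_num)).continuousAt
    (hζc.fderiv_right (m := 0) (by norm_num)).continuousAt hwc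
    hp hζc.continuousAt hinj'
  refine ⟨fun y => t (χ y), ContinuousAt.comp (g := t) ht (continuousAt_extChartAt x), ?_⟩
  filter_upwards [(tendsto_chart x).eventually ((eventually_fderiv_chart_eq x).and hev), hV,
    extChartAt_source_mem_nhds (I := 𝓡 n) x] with y ⟨⟨T, hT⟩, hy⟩ hyV hs D hD
  have hyy : χ.symm (χ y) = y := χ.left_inv hs
  rw [← hχ, hyy] at hT
  rw [← LinearMap.trace_conj' D T.symm.toLinearEquiv]
  refine hy _ fun v => ?_
  have hDv := hD (T v)
  rw [screenMap_apply] at hDv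
  rw [hT _ f (hfd y hyV), hT _ ζ (hζd y hyV), hyy]
  simpa [smul_smul, mul_assoc, mul_comm (c : ℝ)] using hDv

lemma IsNullField.eventually_warpedMetric_meanCurvatureVector_ne_zero {V : Set M}
    {ζ : M → Amb c n} {x : M} (hN : IsNullField w V f ζ) (hn : n ≠ 0) (hI : IsOpen I)
    (hw : ContDiffOn ℝ 1 w I) (hw0 : ∀ t ∈ I, w t ≠ 0) (hf : IsSpacelike c I w 2 univ f)
    (hV : IsOpen V) (hx : x ∈ V)
    (hne : warpedMetric c n w (f x) (meanCurvatureVector w f x) (ζ x, w (f x).2) ≠ 0) :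
    ∀ᶠ y in 𝓝 x,
      warpedMetric c n w (f y) (meanCurvatureVector w f y) (ζ y, w (f y).2) ≠ 0 := by
  have hτI : ∀ y, (f y).2 ∈ I := fun y => (hf.mem y (mem_univ y)).2
  have hwd : ∀ y, ContDiffAt ℝ 1 w (f y).2 := fun y => hw.contDiffAt (hI.mem_nhds (hτI y))
  have hζ : ∀ y ∈ V, ContMDiffAt (𝓡 n) 𝓘(ℝ, Amb c n) 1 ζ y := fun y hy =>
    hN.contMDiffAt (k := 1) one_ne_zero hI hw hw0 hf hV hy
  obtain ⟨t, ht, htrace⟩ := exists_continuousAt_trace_isWeingarten (hV.mem_nhds hx)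
    (fun y _ => (hf.contMDiffAt y).of_le one_le_two) hζ (hwd x).continuousAt (hw0 _ (hτI x))
    (hN.frame x hx).injective
  have hmean : ∀ᶠ y in 𝓝 x,
      n * warpedMetric c n w (f y) (meanCurvatureVector w f y) (ζ y, w (f y).2) =
        -(t y + n * deriv w (f y).2) := by
    filter_upwards [htrace, hV.mem_nhds hx] with y hy hyV
    have hζy := (hζ y hyV).mdifferentiableAt one_ne_zero
    obtain ⟨D, hD⟩ := hN.exists_isWeingarten hV hyV (hf.mdifferentiableAt two_ne_zero y) hζy
    rw [← hy D hD]
    exact mul_warpedMetric_meanCurvatureVector (hf.contMDiffAt y) hζy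
      ((hwd y).differentiableAt one_ne_zero) (Filter.eventually_of_mem (hV.mem_nhds hyV)
        fun z hz => hN.mul_form_dmap hz (hw0 _ (hτI z))) hn (hw0 _ (hτI y)) (hN.frame y hyV) hD
  have hderiv : ContinuousAt (fun y => deriv w (f y).2) x :=
    ContinuousAt.comp (g := deriv w) (f := fun y => (f y).2)
      ((hw.continuousOn_deriv_of_isOpen hI le_rfl).continuousAt (hI.mem_nhds (hτI x)))
      (hf.contMDiffAt x).continuousAt.snd
  have hcont : ContinuousAt (fun y => -(t y + n * deriv w (f y).2)) x :=
    (ht.add (continuousAt_const.mul hderiv)).neg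
  have hne' : -(t x + n * deriv w (f x).2) ≠ 0 := by
    rw [← hmean.self_of_nhds]
    exact mul_ne_zero (Nat.cast_ne_zero.2 hn) hne
  filter_upwards [hcont.eventually_ne hne', hmean] with y hy heq hzero
  rw [hzero, mul_zero] at heq
  exact hy heq.symm

theorem dense_isLocallyRepresentedAt (hn : n ≠ 0) (hI : IsOpen I) (hI' : I.OrdConnected)
    (hw : ContDiffOn ℝ 4 w I) (hw0 : ∀ t ∈ I, w t ≠ 0) (hf : IsSpacelike c I w 5 univ f)
    (hT : IsMarginallyTrapped w univ f) : Dense {x | IsLocallyRepresentedAt I w f x} := by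
  rw [dense_iff_inter_open]
  rintro O hO ⟨x, hx⟩
  obtain ⟨V, ζ₁, ζ₂, hV, hxV, hN₁, hN₂, hne⟩ :=
    (hf.of_le (by norm_num)).exists_pair_isNullField hI hw.continuousOn hw0 x
  have hwf : ∀ y, w (f y).2 ≠ 0 := fun y => hw0 _ (hf.mem y (mem_univ y)).2
  have hnormal := hf.isNormalAt_meanCurvatureVector (by norm_num) hI
    (hw.differentiableOn (by norm_num)) hw0
  by_cases hcase : ∃ y ∈ V ∩ O,
      warpedMetric c n w (f y) (meanCurvatureVector w f y) (ζ₂ y, w (f y).2) ≠ 0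
  · obtain ⟨y, hy, hy2⟩ := hcase
    have hev := hN₂.eventually_warpedMetric_meanCurvatureVector_ne_zero hn hI
      (hw.of_le (by norm_num)) hw0 (hf.of_le (by norm_num)) hV hy.1 hy2
    obtain ⟨V', hV', hV'o, hyV'⟩ := mem_nhds_iff.1 (hev.and (hV.mem_nhds hy.1))
    exact ⟨y, hy.2, (hN₁.mono fun z hz => (hV' hz).2).isLocallyRepresentedAt hI hI' hw hw0 hf
      hV'o hn (fun z hz => (hnormal z).exists_eq_smul_of_null (hT z (mem_univ z)) (hwf z)
        (hN₁.frame z (hV' hz).2) (hN₂.frame z (hV' hz).2) (hne z (hV' hz).2) (hV' hz).1) hyV'⟩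
  · push Not at hcase
    exact ⟨x, hx, (hN₂.mono inter_subset_left).isLocallyRepresentedAt hI hI' hw hw0 hf
      (hV.inter hO) hn (fun z hz => ⟨_, (hN₂.frame z hz.1).eq_smul_null (hwf z) (hnormal z)
        (hcase z hz)⟩) ⟨hxV, hx⟩⟩

end MeanCurvature

end

end RobertsonWalker

theorem theorem2_general (c : SignType) (n : ℕ) (hn : n ≠ 0)
    (I : Set ℝ) (hI : IsOpen I) (hI' : I.OrdConnected)
    (w : ℝ → ℝ) (hw : ContDiffOn ℝ 4 w I) (hw0 : ∀ t ∈ I, w t ≠ 0)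
    (M : Type*) [TopologicalSpace M] [ChartedSpace (EuclideanSpace ℝ (Fin n)) M]
    [IsManifold (𝓡 n) 1 M] :
    (∀ t₀ ∈ I, ∀ (φ ν : M → Amb c n) (τ : M → ℝ), IsHypersurface c univ φ ν →
      ContMDiff (𝓡 n) 𝓘(ℝ, ℝ) 2 τ → (∀ x, τ x ∈ I) →
      ((IsSpacelike c I w 2 univ (phiBar w t₀ φ ν τ) ∧
          IsMarginallyTrappedAlong w univ (phiBar w t₀ φ ν τ) (nuBar w t₀ φ ν τ)) ↔
        ∀ x, MainEquation w t₀ φ ν τ x) ∧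
      ((∀ x, MainEquation w t₀ φ ν τ x) → IsMarginallyTrapped w univ (phiBar w t₀ φ ν τ))) ∧
    (∀ f : M → Amb c n × ℝ, IsSpacelike c I w 5 univ f →
      ((∀ (x : M) (V : Set M) (N : M → Amb c n × ℝ), IsOpen V → x ∈ V →
          IsMarginallyTrappedAlong w V f N → IsLocallyRepresentedAt I w f x) ∧
        (IsMarginallyTrapped w univ f → Dense {x | IsLocallyRepresentedAt I w f x}))) := by
  refine ⟨fun t₀ h₀ φ ν τ h hτ hτI => ?_, fun f hf => ⟨fun x V N hV hx hN => ?_, fun hT => ?_⟩⟩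
  · have hiff := isMarginallyTrappedAlong_phiBar_iff hn hI hI' (hw.of_le (by norm_num)) hw0 h₀ h
      hτ hτI
    exact ⟨hiff, fun hM => (hiff.2 hM).2.isMarginallyTrapped⟩
  · obtain ⟨ζ, hζ, hH⟩ := hN.exists_isNullField hw.continuousOn hw0 (by norm_num) hf
    exact hζ.isLocallyRepresentedAt hI hI' hw hw0 hf hV hn hH hx
  · exact dense_isLocallyRepresentedAt hn hI hI' hw hw0 hf hT

theorem theorem2 (c : SignType) (n : ℕ) (hn : 1 ≤ n)
    (I : Set ℝ) (hI : IsOpen I) (hI' : I.OrdConnected)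
    (w : ℝ → ℝ) (hw : ContDiffOn ℝ ∞ w I) (hw' : ∀ t ∈ I, 0 < w t)
    (M : Type*) [TopologicalSpace M] [ChartedSpace (EuclideanSpace ℝ (Fin n)) M]
    [IsManifold (𝓡 n) ∞ M] :
    -- the map built from `φ`, `ν`, `τ` is marginally trapped if and only if the equation holds
    (∀ t₀ ∈ I, ∀ (φ ν : M → Amb c n) (τ : M → ℝ), IsHypersurface c univ φ ν →
      ContMDiff (𝓡 n) 𝓘(ℝ, ℝ) 2 τ → (∀ x, τ x ∈ I) →
      ((IsSpacelike c I w 2 univ (phiBar w t₀ φ ν τ) ∧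
          IsMarginallyTrappedAlong w univ (phiBar w t₀ φ ν τ) (nuBar w t₀ φ ν τ)) ↔
        ∀ x, MainEquation w t₀ φ ν τ x) ∧
      ((∀ x, MainEquation w t₀ φ ν τ x) → IsMarginallyTrapped w univ (phiBar w t₀ φ ν τ))) ∧
    -- conversely, marginally trapped submanifolds of codimension two are locally of this form
    (∀ f : M → Amb c n × ℝ, IsSpacelike c I w 5 univ f →
      ((∀ (x : M) (V : Set M) (N : M → Amb c n × ℝ), IsOpen V → x ∈ V →
          IsMarginallyTrappedAlong w V f N → IsLocallyRepresentedAt I w f x) ∧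
        (IsMarginallyTrapped w univ f → Dense {x | IsLocallyRepresentedAt I w f x}))) :=
  theorem2_general c n (Nat.one_le_iff_ne_zero.1 hn) I hI hI' w (hw.of_le ENat.LEInfty.out)
    (fun t ht => (hw' t ht).ne') M
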